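/- All Lie algebras are real. Let $\mathfrak s=\bigoplus_{p\in\mathbb Z}\mathfrak s_p$ be a $\mathbb Z$-graded Lie algebra. A gradation of an $\mathfrak s$-module $\mathfrak l$ is a decomposition $\mathfrak l=\bigoplus_p\mathfrak l_p$ with $[\mathfrak s_p,\mathfrak l_q]\subset\mathfrak l_{p+q}$; the graded module $\mathfrak l$ is *transitive* if $[\mathfrak s_{-1},Y]\ne0$ for $0\neq Y\in\mathfrak l_p$, $p\ge0$; *nondegenerate* if $[\mathfrak s_{-1},Y]\neq 0$ for $0\ne Y\in\mathfrak l_{-1}$; *fundamental* if $\mathfrak l_{p-1}=[\mathfrak s_{-1},\mathfrak l_p]$ for $p<0$. A graded Lie algebra has one of these properties if its adjoint module has it. A *graded $CR$ algebra* is a graded Lie algebra $\mathfrak s$ with a linear map $J:\mathfrak s_{-1}\to\mathfrak s_{-1}$ such that $J^2=-\mathrm{Id}$, $[JX,JY]=[X,Y]$ for $X,Y\in\mathfrak s_{-1}$, and $[A,JX]=J[A,X]$ for $A\in\mathfrak s_0$, $X\in\mathfrak s_{-1}$. A *graded $CR$ module* is a graded $\mathfrak s$-module $\mathfrak l$ with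 a linear map $J:\mathfrak l_{-1}\to\mathfrak l_{-1}$ that makes the Abelian extension $\mathfrak s\oplus\mathfrak l$ (where $[\mathfrak l,\mathfrak l]=0$) a graded $CR$ algebra. Write $\mathfrak a_-=\bigoplus_{p<0}\mathfrak a_p$. For a fundamental nondegenerate graded $CR$ algebra $\mathfrak a$, let $\mathfrak g(\mathfrak a)=\bigoplus_p\mathfrak g_p$ be the maximal transitive graded $CR$ algebra with negative part $\mathfrak m=\mathfrak a_-$ (including its $J$); that is, for $p\ge0$, bracketing with $\mathfrak m$ identifies $\mathfrak g_p$ with the space of all derivations $\mathfrak m\to\bigoplus_{q<p}\mathfrak g_q$ of degree $p$, which for $p=0$ are required to commute with $J$ on $\mathfrak m_{-1}$. If $\mathfrak s$ is semisimple, $\mathfrak l$ is a transitive graded $CR$ $\mathfrak s$-module, and $\mathfrak s\oplus\mathfrak l$ is fundamental and nondegenerate, then $\mathfrak g(\mathfrak s\oplus\mathfrak l)$ is called the Levi–Tanaka extension of $\mathfrak s$ by $\mathfrak l$. It is *proper* if it contains no nonzero semisimple ideal. **Proposition.** Let $\mathfrak s$ be a finite dimensional semisimple fundamental transitive graded $CR$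 algebra and $\mathfrak l$ a finite dimensional transitive fundamental graded $CR$ $\mathfrak s$-module such that $\mathfrak s\oplus\mathfrak l$ is nondegenerate. Let $\mathfrak g$ be the Levi–Tanaka extension of $\mathfrak s$ by $\mathfrak l$. Then there exist two graded $CR$ ideals $\mathfrak s',\mathfrak s''$ of $\mathfrak s$ and two graded $CR$ $\mathfrak s$-submodules $\mathfrak l',\mathfrak l''$ of $\mathfrak l$ such that: (i) $\mathfrak s=\mathfrak s'\oplus\mathfrak s''$ and $\mathfrak l=\mathfrak l'\oplus\mathfrak l''$; (ii) $\mathfrak s'\oplus\mathfrak l'$ and $\mathfrak s''\oplus\mathfrak l''$ are ideals in $\mathfrak s\oplus\mathfrak l$; (iii) $\mathfrak g=\mathfrak g(\mathfrak s'\oplus\mathfrak l')\oplus\mathfrak g(\mathfrak s''\oplus\mathfrak l'')$ as a sum of graded $CR$ ideals, compatibly with the inclusions of $\mathfrak s'_-\oplus\mathfrak l'_-$ and $\mathfrak s''_-\oplus\mathfrak l''_-$ in $\mathfrak s_-\oplus\mathfrak l_-=\mathfrak g_-$; (iv) $\mathfrak g(\mathfrak s'\oplus\mathfrak l')$ is a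 Levi–Tanaka extension of $\mathfrak s'$ by $\mathfrak l'$ and is semisimple; (v) $\mathfrak g(\mathfrak s''\oplus\mathfrak l'')$ is a Levi–Tanaka extension of $\mathfrak s''$ by $\mathfrak l''$ and is proper. -/

import Mathlib

namespace LeviTanaka

/-- A `ℤ`-gradation `L = ⨁ₚ Lₚ`, `[Lₚ, L_q] ⊆ L_{p+q}`, of a real Lie algebra `L`. -/
structure LieGrading (L : Type*) [LieRing L] [LieAlgebra ℝ L] where
  deg : ℤ → Submodule ℝ L
  isInternal : DirectSum.IsInternal deg
  lie_mem : ∀ {p q : ℤ} {x y : L}, x ∈ deg p → y ∈ deg q → ⁅x, y⁆ ∈ deg (p + q)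

/-- A gradation `V = ⨁ₚ Vₚ`, `[Lₚ, V_q] ⊆ V_{p+q}`, of a module `V` over a graded Lie algebra. -/
structure ModuleGrading {L : Type*} [LieRing L] [LieAlgebra ℝ L] (S : LieGrading L)
    (V : Type*) [AddCommGroup V] [Module ℝ V] [LieRingModule L V] [LieModule ℝ L V] where
  deg : ℤ → Submodule ℝ V
  isInternal : DirectSum.IsInternal deg
  lie_mem : ∀ {p q : ℤ} {x : L} {y : V}, x ∈ S.deg p → y ∈ deg q → ⁅x, y⁆ ∈ deg (p + q)

namespace ModuleGrading

variable {L : Type*} [LieRing L] [LieAlgebra ℝ L] {S : LieGrading L}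
  {V : Type*} [AddCommGroup V] [Module ℝ V] [LieRingModule L V] [LieModule ℝ L V]

/-- `[L₋₁, Y] ≠ 0` for every nonzero `Y ∈ Vₚ`, `p ≥ 0`. -/
def IsTransitive (M : ModuleGrading S V) : Prop :=
  ∀ p : ℤ, 0 ≤ p → ∀ y ∈ M.deg p, y ≠ 0 → ∃ x ∈ S.deg (-1), ⁅x, y⁆ ≠ 0

/-- `[L₋₁, Y] ≠ 0` for every nonzero `Y ∈ V₋₁`. -/
def IsNondegenerate (M : ModuleGrading S V) : Prop :=
  ∀ y ∈ M.deg (-1), y ≠ 0 → ∃ x ∈ S.deg (-1), ⁅x, y⁆ ≠ 0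

/-- `V_{p-1} = [L₋₁, Vₚ]` for every `p < 0`. -/
def IsFundamental (M : ModuleGrading S V) : Prop :=
  ∀ p : ℤ, p < 0 →
    M.deg (p - 1) = Submodule.span ℝ {z | ∃ x ∈ S.deg (-1), ∃ y ∈ M.deg p, ⁅x, y⁆ = z}

end ModuleGrading

namespace LieGrading

variable {L : Type*} [LieRing L] [LieAlgebra ℝ L]

/-- A graded Lie algebra as a graded module over itself, by the adjoint representation. -/
def adjoint (S : LieGrading L) : ModuleGrading S L where
  deg := S.deg
  isInternal := S.isInternal
  lie_mem := S.lie_mem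

def IsTransitive (S : LieGrading L) : Prop := S.adjoint.IsTransitive

def IsNondegenerate (S : LieGrading L) : Prop := S.adjoint.IsNondegenerate

def IsFundamental (S : LieGrading L) : Prop := S.adjoint.IsFundamental

/-- The subalgebra `L₋ = ⨁_{p < 0} Lₚ`. -/
def neg (S : LieGrading L) : LieSubalgebra ℝ L where
  toSubmodule := ⨆ p : {p : ℤ // p < 0}, S.deg p
  lie_mem' := by
    intro x y hx hy
    refine Submodule.iSup_induction _ (motive := fun x => ⁅x, y⁆ ∈ _) hx ?_ (by simp) ?_
    · intro p x hx
      refine Submodule.iSup_induction _ (motive := fun y => ⁅x, y⁆ ∈ _) hy ?_ (by simp) ?_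
      · intro q y hy
        exact Submodule.mem_iSup_of_mem (⟨p + q, by have := p.2; have := q.2; omega⟩ : {p : ℤ // p < 0})
          (S.lie_mem hx hy)
      · intro a b ha hb
        rw [lie_add]; exact Submodule.add_mem _ ha hb
    · intro a b ha hb
      rw [add_lie]; exact Submodule.add_mem _ ha hb

theorem mem_neg (S : LieGrading L) {p : ℤ} (hp : p < 0) {x : L} (hx : x ∈ S.deg p) : x ∈ S.neg :=
  Submodule.mem_iSup_of_mem (p := fun p : {p : ℤ // p < 0} => S.deg p) ⟨p, hp⟩ hx

end LieGrading

/-- `J : L₋₁ → L₋₁` is a partial complex structure making `L` a graded `CR` algebra. -/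
structure IsCRStructure {L : Type*} [LieRing L] [LieAlgebra ℝ L] (S : LieGrading L)
    (J : S.deg (-1) →ₗ[ℝ] S.deg (-1)) : Prop where
  sq : ∀ x, J (J x) = -x
  lie_J_J : ∀ x y : S.deg (-1), ⁅(J x : L), (J y : L)⁆ = ⁅(x : L), (y : L)⁆
  /-- `[A, J x] = J [A, x]` for `A ∈ L₀` and `x ∈ L₋₁`; here `y` is `[A, x]`. -/
  lie_zero : ∀ a ∈ S.deg 0, ∀ x y : S.deg (-1), ⁅a, (x : L)⁆ = y → ⁅a, (J x : L)⁆ = J y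

/-- The structure of a graded `CR` algebra on a real Lie algebra. -/
structure CRAlgebra (L : Type*) [LieRing L] [LieAlgebra ℝ L] extends LieGrading L where
  J : deg (-1) →ₗ[ℝ] deg (-1)
  isCR : IsCRStructure toLieGrading J

/-! ### The Abelian extension of a Lie algebra by a module -/

/-- The Abelian extension `L ⊕ V` of a Lie algebra `L` by an `L`-module `V`. -/
@[ext] structure AbExt (L V : Type*) where
  fst : L
  snd : V

namespace AbExt

section

variable (L V : Type*)

def toProd : AbExt L V ≃ L × V where
  toFun x := (x.fst, x.snd)
  invFun x := ⟨x.1, x.2⟩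

variable [AddCommGroup L] [AddCommGroup V] [Module ℝ L] [Module ℝ V]

instance : AddCommGroup (AbExt L V) := (toProd L V).addCommGroup

instance : Module ℝ (AbExt L V) := (toProd L V).module ℝ

/-- The underlying vector space of `L ⊕ V` is `L × V`. -/
def toProdl : AbExt L V ≃ₗ[ℝ] L × V where
  toEquiv := toProd L V
  map_add' _ _ := rfl
  map_smul' _ _ := rfl

end

variable {L V : Type*} [LieRing L] [LieAlgebra ℝ L]
  [AddCommGroup V] [Module ℝ V] [LieRingModule L V] [LieModule ℝ L V]

instance : Bracket (AbExt L V) (AbExt L V) :=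
  ⟨fun a b => ⟨⁅a.fst, b.fst⁆, ⁅a.fst, b.snd⁆ - ⁅b.fst, a.snd⁆⟩⟩

instance : LieRing (AbExt L V) where
  add_lie a b c := by
    refine AbExt.ext (add_lie a.fst b.fst c.fst) ?_
    change ⁅a.fst + b.fst, c.snd⁆ - ⁅c.fst, a.snd + b.snd⁆
      = (⁅a.fst, c.snd⁆ - ⁅c.fst, a.snd⁆) + (⁅b.fst, c.snd⁆ - ⁅c.fst, b.snd⁆)
    rw [add_lie, lie_add]; abel
  lie_add a b c := by
    refine AbExt.ext (lie_add a.fst b.fst c.fst) ?_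
    change ⁅a.fst, b.snd + c.snd⁆ - ⁅b.fst + c.fst, a.snd⁆
      = (⁅a.fst, b.snd⁆ - ⁅b.fst, a.snd⁆) + (⁅a.fst, c.snd⁆ - ⁅c.fst, a.snd⁆)
    rw [add_lie, lie_add]; abel
  lie_self a := AbExt.ext (lie_self a.fst) (sub_self _)
  leibniz_lie a b c := by
    refine AbExt.ext (leibniz_lie a.fst b.fst c.fst) ?_
    change ⁅a.fst, ⁅b.fst, c.snd⁆ - ⁅c.fst, b.snd⁆⁆ - ⁅⁅b.fst, c.fst⁆, a.snd⁆
      = (⁅⁅a.fst, b.fst⁆, c.snd⁆ - ⁅c.fst, ⁅a.fst, b.snd⁆ - ⁅b.fst, a.snd⁆⁆)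
        + (⁅b.fst, ⁅a.fst, c.snd⁆ - ⁅c.fst, a.snd⁆⁆ - ⁅⁅a.fst, c.fst⁆, b.snd⁆)
    simp only [lie_sub, lie_lie]
    abel

instance : LieAlgebra ℝ (AbExt L V) where
  lie_smul t a b := by
    refine AbExt.ext (lie_smul t a.fst b.fst) ?_
    change ⁅a.fst, t • b.snd⁆ - ⁅t • b.fst, a.snd⁆ = t • (⁅a.fst, b.snd⁆ - ⁅b.fst, a.snd⁆)
    rw [lie_smul, smul_lie, smul_sub]

end AbExt

/-- `Lₚ ⊕ Vₚ` as a subspace of `L ⊕ V`. -/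
def AbExt.sum {L V : Type*} [AddCommGroup L] [AddCommGroup V] [Module ℝ L] [Module ℝ V]
    (A : Submodule ℝ L) (B : Submodule ℝ V) : Submodule ℝ (AbExt L V) :=
  (A.prod B).comap (AbExt.toProdl L V).toLinearMap

theorem AbExt.isInternal_sum {L V : Type*} [AddCommGroup L] [AddCommGroup V] [Module ℝ L]
    [Module ℝ V] {A : ℤ → Submodule ℝ L} {B : ℤ → Submodule ℝ V}
    (hA : DirectSum.IsInternal A) (hB : DirectSum.IsInternal B) :
    DirectSum.IsInternal fun p => AbExt.sum (A p) (B p) := by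
  rw [DirectSum.isInternal_submodule_iff_iSupIndep_and_iSup_eq_top] at *
  constructor
  · intro p
    rw [Submodule.disjoint_def]
    intro x hx hx'
    have key : (⨆ j, ⨆ (_ : j ≠ p), AbExt.sum (A j) (B j)) ≤
        AbExt.sum (⨆ j, ⨆ (_ : j ≠ p), A j) (⨆ j, ⨆ (_ : j ≠ p), B j) := by
      refine iSup₂_le fun j hj y hy => ⟨?_, ?_⟩
      · exact (le_iSup₂ (f := fun j (_ : j ≠ p) => A j) j hj) hy.1
      · exact (le_iSup₂ (f := fun j (_ : j ≠ p) => B j) j hj) hy.2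
    have h1 := Submodule.disjoint_def.1 (hA.1 p) x.fst hx.1 (key hx').1
    have h2 := Submodule.disjoint_def.1 (hB.1 p) x.snd hx.2 (key hx').2
    exact AbExt.ext h1 h2
  · rw [eq_top_iff]
    intro x _
    let i : L →ₗ[ℝ] AbExt L V :=
      (AbExt.toProdl L V).symm.toLinearMap ∘ₗ LinearMap.inl ℝ L V
    let j : V →ₗ[ℝ] AbExt L V :=
      (AbExt.toProdl L V).symm.toLinearMap ∘ₗ LinearMap.inr ℝ L V
    have hi : (⨆ p, A p) ≤ (⨆ p, AbExt.sum (A p) (B p)).comap i :=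
      iSup_le fun p y hy => Submodule.mem_iSup_of_mem p ⟨hy, zero_mem (B p)⟩
    have hj : (⨆ p, B p) ≤ (⨆ p, AbExt.sum (A p) (B p)).comap j :=
      iSup_le fun p y hy => Submodule.mem_iSup_of_mem p ⟨zero_mem (A p), hy⟩
    have e : x = i x.fst + j x.snd := AbExt.ext (add_zero x.fst).symm (zero_add x.snd).symm
    rw [e]
    exact add_mem (hi (hA.2 ▸ Submodule.mem_top)) (hj (hB.2 ▸ Submodule.mem_top))

section Extension

variable {L : Type*} [LieRing L] [LieAlgebra ℝ L]
  {V : Type*} [AddCommGroup V] [Module ℝ V] [LieRingModule L V] [LieModule ℝ L V]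

/-- The gradation `(L ⊕ V)ₚ = Lₚ ⊕ Vₚ` of the Abelian extension. -/
def ModuleGrading.ext {S : LieGrading L} (M : ModuleGrading S V) : LieGrading (AbExt L V) where
  deg p := AbExt.sum (S.deg p) (M.deg p)
  isInternal := AbExt.isInternal_sum S.isInternal M.isInternal
  lie_mem := by
    intro p q x y hx hy
    refine ⟨S.lie_mem hx.1 hy.1, sub_mem (M.lie_mem hx.1 hy.2) ?_⟩
    rw [add_comm]
    exact M.lie_mem hy.1 hx.2

/-- The partial complex structure `J ⊕ J'` on `(L ⊕ V)₋₁ = L₋₁ ⊕ V₋₁`. -/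
def ModuleGrading.extJ {S : LieGrading L} (M : ModuleGrading S V)
    (J : S.deg (-1) →ₗ[ℝ] S.deg (-1)) (J' : M.deg (-1) →ₗ[ℝ] M.deg (-1)) :
    M.ext.deg (-1) →ₗ[ℝ] M.ext.deg (-1) where
  toFun z := ⟨⟨J ⟨z.1.fst, z.2.1⟩, J' ⟨z.1.snd, z.2.2⟩⟩, (J _).2, (J' _).2⟩
  map_add' a b := Subtype.ext (AbExt.ext
    (congrArg Subtype.val (J.map_add ⟨a.1.fst, a.2.1⟩ ⟨b.1.fst, b.2.1⟩))
    (congrArg Subtype.val (J'.map_add ⟨a.1.snd, a.2.2⟩ ⟨b.1.snd, b.2.2⟩)))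
  map_smul' t a := Subtype.ext (AbExt.ext
    (congrArg Subtype.val (J.map_smul t ⟨a.1.fst, a.2.1⟩))
    (congrArg Subtype.val (J'.map_smul t ⟨a.1.snd, a.2.2⟩)))

/-- The structure of a graded `CR` module over a graded `CR` algebra: a gradation and a complex
structure on the component of degree `-1` making the Abelian extension a graded `CR` algebra. -/
structure CRModule (S : CRAlgebra L) (V : Type*) [AddCommGroup V] [Module ℝ V]
    [LieRingModule L V] [LieModule ℝ L V] extends ModuleGrading S.toLieGrading V where
  J : deg (-1) →ₗ[ℝ] deg (-1)
  isCR : IsCRStructure toModuleGrading.ext (toModuleGrading.extJ S.J J)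

/-- The Abelian extension as a graded `CR` algebra. -/
def CRModule.extCR {S : CRAlgebra L} (M : CRModule S V) : CRAlgebra (AbExt L V) where
  toLieGrading := M.toModuleGrading.ext
  J := M.toModuleGrading.extJ S.J M.J
  isCR := M.isCR

end Extension

/-- The graded `CR` structure of a Lie subalgebra or ideal `A'` of `A` (with inclusion `i`) is the
one induced from `A`; its existence says that `A'` is a graded `CR` subalgebra or ideal. -/
structure CRAlgebra.IsInduced {A' A : Type*} [LieRing A'] [LieAlgebra ℝ A'] [LieRing A]
    [LieAlgebra ℝ A] (S' : CRAlgebra A') (S : CRAlgebra A) (i : A' → A) : Prop where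
  mem_deg : ∀ p x, x ∈ S'.deg p ↔ i x ∈ S.deg p
  map_J : ∀ (x : S'.deg (-1)) (y : S.deg (-1)), i x = y → i (S'.J x) = S.J y

/-- The graded `CR` structure of a submodule `V'` of `V` (with inclusion `i`), regarded as a module
over a subalgebra or ideal, is the one induced from `V`. -/
structure CRModule.IsInduced {L' L V' V : Type*} [LieRing L'] [LieAlgebra ℝ L'] [LieRing L]
    [LieAlgebra ℝ L] [AddCommGroup V'] [Module ℝ V'] [LieRingModule L' V'] [LieModule ℝ L' V']
    [AddCommGroup V] [Module ℝ V] [LieRingModule L V] [LieModule ℝ L V]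
    {S' : CRAlgebra L'} {S : CRAlgebra L} (M' : CRModule S' V') (M : CRModule S V)
    (i : V' → V) : Prop where
  mem_deg : ∀ p x, x ∈ M'.deg p ↔ i x ∈ M.deg p
  map_J : ∀ (x : M'.deg (-1)) (y : M.deg (-1)), i x = y → i (M'.J x) = M.J y

/-! ### The Levi–Tanaka prolongation -/

/-- `G`, a graded `CR` structure on `g`, is the maximal transitive `CR` prolongation `g(m)` of the
negative part `m = A₋` of the graded `CR` algebra `A`, the identification of `m` with `g₋` being
given by `ι`. By `transitive` and `complete`, taking brackets with elements of `g₋ = m` identifies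
`gₚ`, for `p ≥ 0`, with the space of all the derivations `m → ⨁_{q < p} g_q` of degree `p`
(which for `p = 0` have to commute with `J` on `m₋₁`). -/
structure IsProlongation {A g : Type*} [LieRing A] [LieAlgebra ℝ A] [LieRing g] [LieAlgebra ℝ g]
    (S : CRAlgebra A) (G : CRAlgebra g) (ι : S.neg →ₗ⁅ℝ⁆ g) : Prop where
  injective : Function.Injective ι
  mem_deg : ∀ p : ℤ, p < 0 → ∀ y : g, y ∈ G.deg p ↔ ∃ x : S.neg, (x : A) ∈ S.deg p ∧ ι x = y
  map_J : ∀ (x : S.deg (-1)) (y : G.deg (-1)), ι ⟨x, S.mem_neg (by norm_num) x.2⟩ = y →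
    ι ⟨S.J x, S.mem_neg (by norm_num) (S.J x).2⟩ = G.J y
  transitive : G.IsTransitive
  complete : ∀ p : ℤ, 0 ≤ p → ∀ D : LieDerivation ℝ G.neg g,
    (∀ q : ℤ, q < 0 → ∀ x : G.neg, (x : g) ∈ G.deg q → D x ∈ G.deg (q + p)) →
    (p = 0 → ∀ x y : G.deg (-1), D ⟨x, G.mem_neg (by norm_num) x.2⟩ = y →
      D ⟨G.J x, G.mem_neg (by norm_num) (G.J x).2⟩ = G.J y) →
    ∃ a ∈ G.deg p, ∀ x : G.neg, D x = ⁅a, (x : g)⁆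

section Extensions

variable {s : Type*} [LieRing s] [LieAlgebra ℝ s]
  {l : Type*} [AddCommGroup l] [Module ℝ l] [LieRingModule s l] [LieModule ℝ s l]

/-- `s ⊕ l` is a partial Levi–Tanaka extension of `s` by `l`. -/
structure IsPartialExtension {S : CRAlgebra s} (M : CRModule S l) : Prop where
  semisimple : LieAlgebra.IsSemisimple ℝ s
  transitive : M.IsTransitive
  fundamental : M.extCR.IsFundamental
  nondegenerate : M.extCR.IsNondegenerate

/-- `g` is the Levi–Tanaka extension `g(s ⊕ l)` of `s` by `l`. -/
structure IsExtension {S : CRAlgebra s} (M : CRModule S l) {g : Type*} [LieRing g]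
    [LieAlgebra ℝ g] (G : CRAlgebra g) (ι : M.extCR.neg →ₗ⁅ℝ⁆ g) : Prop where
  isPartial : IsPartialExtension M
  isProlongation : IsProlongation M.extCR G ι

end Extensions

/-- `g` contains no (nonzero) semisimple ideal. -/
def IsProper (g : Type*) [LieRing g] [LieAlgebra ℝ g] : Prop :=
  ∀ a : LieIdeal ℝ g, LieAlgebra.IsSemisimple ℝ a → a = ⊥

/-! ### Existence of the prolongation

The prolongation of `m = A₋` is realised inside `End U(m)`: the elements of `m` are the left
multiplications, an element of degree `p ≥ 0` is an endomorphism killing `1` whose brackets with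
elements of `m_q` belong to the component of degree `p + q`. -/

namespace Existence

attribute [local instance 100] LieRing.ofAssociativeRing

variable {A : Type*} [LieRing A] [LieAlgebra ℝ A] (S : CRAlgebra A)

/-- The ambient Lie algebra. -/
abbrev Amb : Type _ := Module.End ℝ (UniversalEnvelopingAlgebra ℝ S.neg)

/-- `m` acting on `U(m)` by left multiplication. -/
noncomputable def lam : S.neg →ₗ⁅ℝ⁆ Amb S :=
  ((Algebra.lmul ℝ (UniversalEnvelopingAlgebra ℝ S.neg)).toLieHom).comp
    (UniversalEnvelopingAlgebra.ι ℝ)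

theorem lam_apply (x : S.neg) (u : UniversalEnvelopingAlgebra ℝ S.neg) :
    lam S x u = UniversalEnvelopingAlgebra.ι ℝ x * u := rfl

/-- The inclusion `m₋₁ → m`. -/
def nu : S.deg (-1) →ₗ[ℝ] S.neg where
  toFun x := ⟨x, S.mem_neg (by norm_num) x.2⟩
  map_add' _ _ := rfl
  map_smul' _ _ := rfl

/-- The components of the prolongation. -/
inductive Mem : ℤ → Amb S → Prop
  | neg (p : ℤ) (hp : p < 0) (x : S.neg) (hx : (x : A) ∈ S.deg p) : Mem p (lam S x)
  | nonneg (p : ℤ) (hp : 0 ≤ p) (T : Amb S) (h1 : T 1 = 0)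
      (h : ∀ q : ℤ, q < 0 → ∀ x : S.neg, (x : A) ∈ S.deg q → Mem (p + q) ⁅T, lam S x⁆)
      (hJ : p = 0 → ∀ x y : S.deg (-1),
        ⁅T, lam S (nu S x)⁆ = lam S (nu S y) → ⁅T, lam S (nu S (S.J x))⁆ = lam S (nu S (S.J y))) : Mem p T

variable {S}

theorem mem_neg_iff {p : ℤ} (hp : p < 0) (T : Amb S) :
    Mem S p T ↔ ∃ x : S.neg, (x : A) ∈ S.deg p ∧ lam S x = T := by
  constructor
  · intro h
    cases h with
    | neg _ _ x hx => exact ⟨x, hx, rfl⟩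
    | nonneg _ h0 => omega
  · rintro ⟨x, hx, rfl⟩
    exact .neg p hp x hx

theorem mem_nonneg_iff {p : ℤ} (hp : 0 ≤ p) (T : Amb S) :
    Mem S p T ↔ T 1 = 0 ∧
      (∀ q : ℤ, q < 0 → ∀ x : S.neg, (x : A) ∈ S.deg q → Mem S (p + q) ⁅T, lam S x⁆) ∧
      (p = 0 → ∀ x y : S.deg (-1),
        ⁅T, lam S (nu S x)⁆ = lam S (nu S y) → ⁅T, lam S (nu S (S.J x))⁆ = lam S (nu S (S.J y))) := by
  constructor
  · intro h
    cases h with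
    | neg _ h0 => omega
    | nonneg _ h0 _ h1 h2 h3 => exact ⟨h1, h2, h3⟩
  · rintro ⟨h1, h2, h3⟩
    exact .nonneg p hp T h1 h2 h3

/-- Induction over `S.neg` from homogeneous elements. -/
theorem neg_induction {P : S.neg → Prop} (h0 : P 0) (hadd : ∀ x y, P x → P y → P (x + y))
    (h : ∀ q : ℤ, q < 0 → ∀ x : S.neg, (x : A) ∈ S.deg q → P x) (x : S.neg) : P x := by
  obtain ⟨x, hx⟩ := x
  have hx' : x ∈ ⨆ p : {p : ℤ // p < 0}, S.deg p := hx
  induction hx' using Submodule.iSup_induction' with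
  | mem p x hx' => exact h p p.2 _ hx'
  | zero => exact h0
  | add x y hx' hy' ihx ihy =>
    exact hadd ⟨x, hx'⟩ ⟨y, hy'⟩ (ihx hx') (ihy hy')

/-- An endomorphism of `U(m)` killing `1` and commuting with `m` is zero. -/
theorem ext_zero {T : Amb S} (h1 : T 1 = 0) (h : ∀ x, ⁅T, lam S x⁆ = 0) : T = 0 := by
  have hc : ∀ x u, T (UniversalEnvelopingAlgebra.ι ℝ x * u)
      = UniversalEnvelopingAlgebra.ι ℝ x * T u := by
    intro x u
    have := LinearMap.congr_fun (h x) u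
    rw [Ring.lie_def] at this
    simpa [sub_eq_zero, lam_apply] using this
  let B : Subalgebra ℝ (UniversalEnvelopingAlgebra ℝ S.neg) :=
    { carrier := {a | ∀ u, T (a * u) = a * T u}
      mul_mem' := by
        intro a b ha hb u
        rw [mul_assoc, ha, hb, mul_assoc]
      add_mem' := by
        intro a b ha hb u
        rw [add_mul, map_add, ha, hb, add_mul]
      algebraMap_mem' := by
        intro r u
        rw [← Algebra.smul_def, ← Algebra.smul_def, map_smul] }
  let f : S.neg →ₗ⁅ℝ⁆ B :=
    { toFun := fun x => ⟨UniversalEnvelopingAlgebra.ι ℝ x, hc x⟩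
      map_add' := fun x y => Subtype.ext (by simp)
      map_smul' := fun t x => Subtype.ext (by simp)
      map_lie' := by
        intro x y
        refine Subtype.ext ?_
        simp only [LieHom.map_lie, Ring.lie_def]
        rfl }
  have hf : B.val.comp (UniversalEnvelopingAlgebra.lift ℝ f) = AlgHom.id ℝ _ := by
    apply UniversalEnvelopingAlgebra.hom_ext
    ext x
    simp [f]
  have hB : ∀ a u, T (a * u) = a * T u := by
    intro a
    have := congrArg (fun g => g a) hf
    have h2 : ((UniversalEnvelopingAlgebra.lift ℝ f a : B) :
      UniversalEnvelopingAlgebra ℝ S.neg) = a := this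
    rw [← h2]
    exact (UniversalEnvelopingAlgebra.lift ℝ f a).2
  ext u
  have := hB u 1
  simpa [h1] using this

/-- Every derivation `m → End U(m)` is the bracket with an endomorphism killing `1`. -/
theorem exists_of_derivation (D : S.neg →ₗ[ℝ] Amb S)
    (hD : ∀ x y, D ⁅x, y⁆ = ⁅D x, lam S y⁆ + ⁅lam S x, D y⁆) :
    ∃ T : Amb S, T 1 = 0 ∧ ∀ x, ⁅T, lam S x⁆ = D x := by
  let U := UniversalEnvelopingAlgebra ℝ S.neg
  let f : S.neg →ₗ⁅ℝ⁆ Module.End ℝ (U × U) :=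
    { toFun := fun x => LinearMap.prod
        ((lam S x).comp (LinearMap.fst ℝ U U) + (D x).comp (LinearMap.snd ℝ U U))
        ((lam S x).comp (LinearMap.snd ℝ U U))
      map_add' := by
        intro x y
        refine LinearMap.ext fun u => Prod.ext ?_ ?_
        · simp; abel
        · simp
      map_smul' := by
        intro t x
        refine LinearMap.ext fun u => Prod.ext ?_ ?_ <;> simp
      map_lie' := by
        intro x y
        refine LinearMap.ext fun u => Prod.ext ?_ ?_
        · simp [hD, Ring.lie_def]; abel
        · simp [Ring.lie_def] }
  let F := UniversalEnvelopingAlgebra.lift ℝ f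
  have hF : ∀ x u, F (UniversalEnvelopingAlgebra.ι ℝ x * u) = f x * F u := by
    intro x u
    simp [F]
  let T : Amb S := (LinearMap.fst ℝ U U).comp
    ((LinearMap.applyₗ ((0, 1) : U × U)).comp F.toLinearMap)
  have hT : ∀ u, T u = (F u (0, 1)).1 := fun u => rfl
  have h2 : ∀ u, (F u (0, 1)).2 = u := by
    let Q : Amb S := (LinearMap.snd ℝ U U).comp
      ((LinearMap.applyₗ ((0, 1) : U × U)).comp F.toLinearMap)
    have hQ : Q - 1 = 0 := by
      apply ext_zero
      · simp [Q]
      · intro x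
        refine LinearMap.ext fun u => ?_
        have e : Q (UniversalEnvelopingAlgebra.ι ℝ x * u)
            = UniversalEnvelopingAlgebra.ι ℝ x * Q u := by
          change (F (UniversalEnvelopingAlgebra.ι ℝ x * u) (0, 1)).2 = _
          rw [hF]
          rfl
        change Q (UniversalEnvelopingAlgebra.ι ℝ x * u) - UniversalEnvelopingAlgebra.ι ℝ x * u
          - UniversalEnvelopingAlgebra.ι ℝ x * (Q u - u) = 0
        rw [e, mul_sub, sub_self]
    intro u
    have := LinearMap.congr_fun hQ u
    simpa [Q, sub_eq_zero] using this
  refine ⟨T, by simp [hT], fun x => ?_⟩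
  ext u
  simp only [Ring.lie_def, LinearMap.sub_apply, Module.End.mul_apply, lam_apply, hT, hF]
  simp only [f]
  simp [h2, lam_apply]

/-- The degree derivation of `A`. -/
theorem exists_degree : ∃ δ : A →ₗ[ℝ] A, ∀ p : ℤ, ∀ x ∈ S.deg p, δ x = (p : ℝ) • x := by
  classical
  let e := LinearEquiv.ofBijective (DirectSum.coeLinearMap S.deg) S.isInternal
  refine ⟨(DirectSum.toModule ℝ ℤ A fun p => (p : ℝ) • (S.deg p).subtype) ∘ₗ
    e.symm.toLinearMap, fun p x hx => ?_⟩
  have : e.symm x = DirectSum.lof ℝ ℤ (fun p => S.deg p) p ⟨x, hx⟩ := by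
    rw [LinearEquiv.symm_apply_eq]
    exact (DirectSum.coeLinearMap_lof S.deg p ⟨x, hx⟩).symm
  simp [this]

theorem lam_injective : Function.Injective (lam S) := by
  obtain ⟨δ, hδ⟩ := exists_degree (S := S)
  have hder : ∀ x y : S.neg, δ ⁅(x : A), (y : A)⁆ = ⁅δ x, (y : A)⁆ + ⁅(x : A), δ y⁆ := by
    intro x y
    induction x using neg_induction with
    | h0 => simp
    | hadd x x' hx hx' => simp [add_lie, hx, hx']; abel
    | h q hq x hx =>
      induction y using neg_induction with
      | h0 => simp
      | hadd y y' hy hy' => simp [lie_add, hy, hy']; abel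
      | h r hr y hy =>
        rw [hδ _ _ (S.lie_mem hx hy), hδ _ _ hx, hδ _ _ hy]
        simp [add_smul]
  let f : S.neg →ₗ⁅ℝ⁆ Module.End ℝ (A × ℝ) :=
    { toFun := fun x => LinearMap.prod
        (((LieAlgebra.ad ℝ A x : Module.End ℝ A)).comp (LinearMap.fst ℝ A ℝ)
          - (LinearMap.toSpanSingleton ℝ A (δ x)).comp (LinearMap.snd ℝ A ℝ)) 0
      map_add' := by
        intro x y
        refine LinearMap.ext fun u => Prod.ext ?_ ?_
        · simp; abel
        · simp
      map_smul' := by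
        intro t x
        refine LinearMap.ext fun u => Prod.ext ?_ ?_
        · simp [smul_sub, smul_comm t u.2]
        · simp
      map_lie' := by
        intro x y
        refine LinearMap.ext fun u => Prod.ext ?_ ?_
        · change ⁅⁅(x : A), (y : A)⁆, u.1⁆ - u.2 • δ ⁅(x : A), (y : A)⁆
            = (⁅(x : A), ⁅(y : A), u.1⁆ - u.2 • δ y⁆ - (0 : ℝ) • δ x)
              - (⁅(y : A), ⁅(x : A), u.1⁆ - u.2 • δ x⁆ - (0 : ℝ) • δ y)
          rw [hder, ← lie_skew (δ x) (y : A)]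
          simp only [lie_lie, lie_sub, lie_smul, smul_add, smul_neg, zero_smul]
          abel
        · simp [Ring.lie_def] }
  have hx0 : ∀ x : S.neg, UniversalEnvelopingAlgebra.ι ℝ x = 0 → x = 0 := by
    intro x hx
    have h1 : f x = 0 := by
      rw [← UniversalEnvelopingAlgebra.lift_ι_apply ℝ f x, hx, map_zero]
    have h2 : δ x = 0 := by
      have := congrArg Prod.fst (LinearMap.congr_fun h1 (0, 1))
      simpa [f] using this
    have h3 : (x : A) ∈ ⨆ μ : ℝ, ⨆ (_ : μ ≠ 0), Module.End.eigenspace δ μ := by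
      have : (x : A) ∈ ⨆ p : {p : ℤ // p < 0}, S.deg p := x.2
      refine (iSup_le fun p => ?_ : (⨆ p : {p : ℤ // p < 0}, S.deg p) ≤ _) this
      intro y hy
      have hp : ((p : ℤ) : ℝ) ≠ 0 := by exact_mod_cast p.2.ne
      exact (le_iSup₂ (f := fun (μ : ℝ) (_ : μ ≠ 0) => Module.End.eigenspace δ μ) _ hp)
        (Module.End.mem_eigenspace_iff.2 (hδ p y hy))
    have h4 : (x : A) ∈ Module.End.eigenspace δ 0 :=
      Module.End.mem_eigenspace_iff.2 (by simp [h2])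
    exact Subtype.ext
      (Submodule.disjoint_def.1 (Module.End.eigenspaces_iSupIndep δ 0) x h4 h3)
  intro x y hxy
  rw [← sub_eq_zero]
  apply hx0
  have := LinearMap.congr_fun hxy 1
  simpa [lam_apply, sub_eq_zero] using this

theorem nu_injective : Function.Injective (nu S) :=
  fun _ _ h => Subtype.ext (congrArg (fun z : S.neg => (z : A)) h)

theorem exists_nu {p : ℤ} {T : Amb S} (h : Mem S (p + -1) T) (hp : p = 0) :
    ∃ z : S.deg (-1), T = lam S (nu S z) := by
  subst hp
  obtain ⟨x, hx, rfl⟩ := (mem_neg_iff (by norm_num) T).1 h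
  exact ⟨⟨x, hx⟩, rfl⟩

/-- The components of the prolongation are subspaces. -/
theorem mem_submodule (p : ℤ) : Mem S p 0 ∧ (∀ T T', Mem S p T → Mem S p T' → Mem S p (T + T')) ∧
    (∀ (t : ℝ) T, Mem S p T → Mem S p (t • T)) := by
  suffices H : ∀ n : ℕ, ∀ p : ℤ, p < n → (Mem S p 0 ∧
      (∀ T T', Mem S p T → Mem S p T' → Mem S p (T + T')) ∧
      (∀ (t : ℝ) T, Mem S p T → Mem S p (t • T))) from
    H (p.toNat + 1) p (by omega)
  intro n
  induction n with
  | zero =>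
    intro p hp
    have hp : p < 0 := by simpa using hp
    simp only [mem_neg_iff hp]
    refine ⟨⟨0, zero_mem (S.deg p), by simp⟩, ?_, ?_⟩
    · rintro _ _ ⟨x, hx, rfl⟩ ⟨y, hy, rfl⟩
      exact ⟨x + y, add_mem (S := Submodule ℝ A) hx hy, by simp⟩
    · rintro t _ ⟨x, hx, rfl⟩
      exact ⟨t • x, (S.deg p).smul_mem t hx, by simp⟩
  | succ n ih =>
    intro p hp
    by_cases hp' : p < n
    · exact ih p hp'
    have hp0 : 0 ≤ p := by omega
    have key : ∀ q : ℤ, q < 0 → _ := fun q hq => ih (p + q) (by omega)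
    simp only [mem_nonneg_iff hp0]
    refine ⟨⟨rfl, fun q hq x hx => ?_, fun _ x y h => ?_⟩, ?_, ?_⟩
    · rw [zero_lie]; exact (key q hq).1
    · rw [zero_lie] at h ⊢
      have : y = 0 := nu_injective (lam_injective (by rw [← h]; simp))
      simp [this]
    · rintro T T' ⟨h1, h2, h3⟩ ⟨h1', h2', h3'⟩
      refine ⟨by simp [h1, h1'], fun q hq x hx => ?_, fun hp x y h => ?_⟩
      · rw [add_lie]; exact (key q hq).2.1 _ _ (h2 q hq x hx) (h2' q hq x hx)
      · obtain ⟨z, hz⟩ := exists_nu (h2 (-1) (by norm_num) (nu S x) x.2) hp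
        obtain ⟨z', hz'⟩ := exists_nu (h2' (-1) (by norm_num) (nu S x) x.2) hp
        have : y = z + z' := nu_injective (lam_injective (by rw [← h, add_lie, hz, hz']; simp))
        rw [add_lie, h3 hp x z hz, h3' hp x z' hz', this]
        simp
    · rintro t T ⟨h1, h2, h3⟩
      refine ⟨by simp [h1], fun q hq x hx => ?_, fun hp x y h => ?_⟩
      · rw [smul_lie]; exact (key q hq).2.2 _ _ (h2 q hq x hx)
      · obtain ⟨z, hz⟩ := exists_nu (h2 (-1) (by norm_num) (nu S x) x.2) hp
        have : y = t • z := nu_injective (lam_injective (by rw [← h, smul_lie, hz]; simp))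
        rw [smul_lie, h3 hp x z hz, this]
        simp

variable (S) in
/-- The component of degree `p` of the prolongation. -/
def comp (p : ℤ) : Submodule ℝ (Amb S) where
  carrier := {T | Mem S p T}
  zero_mem' := (mem_submodule p).1
  add_mem' ha hb := (mem_submodule p).2.1 _ _ ha hb
  smul_mem' t _ ha := (mem_submodule p).2.2 t _ ha

theorem mem_lie_neg {p q : ℤ} (hq : q < 0) {T B : Amb S} (hT : Mem S p T) (hB : Mem S q B) :
    Mem S (p + q) ⁅T, B⁆ := by
  obtain ⟨y, hy, rfl⟩ := (mem_neg_iff hq B).1 hB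
  rcases lt_or_ge p 0 with hp | hp
  · obtain ⟨x, hx, rfl⟩ := (mem_neg_iff hp T).1 hT
    rw [← LieHom.map_lie]
    exact .neg _ (by omega) _ (S.lie_mem hx hy)
  · exact ((mem_nonneg_iff hp T).1 hT).2.1 q hq y hy

theorem mem_lie_neg' {p q : ℤ} (hp : p < 0) {T B : Amb S} (hT : Mem S p T) (hB : Mem S q B) :
    Mem S (p + q) ⁅T, B⁆ := by
  rw [← lie_skew, add_comm]
  exact (comp S (q + p)).neg_mem (mem_lie_neg hp hB hT)

theorem mem_lie {p q : ℤ} {T B : Amb S} (hT : Mem S p T) (hB : Mem S q B) :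
    Mem S (p + q) ⁅T, B⁆ := by
  suffices H : ∀ n : ℕ, ∀ (p q : ℤ) (T B : Amb S), p.toNat + q.toNat < n → Mem S p T →
      Mem S q B → Mem S (p + q) ⁅T, B⁆ from H (p.toNat + q.toNat + 1) p q T B (by omega) hT hB
  clear hT hB
  intro n
  induction n with
  | zero => intro p q T B h; omega
  | succ n ih =>
    intro p q T B hn hT hB
    rcases lt_or_ge q 0 with hq | hq
    · exact mem_lie_neg hq hT hB
    rcases lt_or_ge p 0 with hp | hp
    · exact mem_lie_neg' hp hT hB
    obtain ⟨h1, h2, h3⟩ := (mem_nonneg_iff hp T).1 hT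
    obtain ⟨h1', h2', h3'⟩ := (mem_nonneg_iff hq B).1 hB
    refine (mem_nonneg_iff (by omega) _).2 ⟨?_, fun r hr x hx => ?_, fun hpq x y h => ?_⟩
    · simp [Ring.lie_def, h1, h1']
    · rw [lie_lie]
      refine (comp S (p + q + r)).sub_mem ?_ ?_
      · change Mem S _ _
        rw [add_assoc]
        rcases lt_or_ge (q + r) 0 with hqr | hqr
        · exact mem_lie_neg hqr hT (h2' r hr x hx)
        · exact ih _ _ _ _ (by omega) hT (h2' r hr x hx)
      · change Mem S _ _
        rw [show p + q + r = q + (p + r) by ring]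
        rcases lt_or_ge (p + r) 0 with hpr | hpr
        · exact mem_lie_neg hpr hB (h2 r hr x hx)
        · exact ih _ _ _ _ (by omega) hB (h2 r hr x hx)
    · have hp0 : p = 0 := by omega
      have hq0 : q = 0 := by omega
      obtain ⟨z, hz⟩ := exists_nu (h2 (-1) (by norm_num) (nu S x) x.2) hp0
      obtain ⟨z', hz'⟩ := exists_nu (h2' (-1) (by norm_num) (nu S x) x.2) hq0
      obtain ⟨w, hw⟩ := exists_nu (h2 (-1) (by norm_num) (nu S z') z'.2) hp0
      obtain ⟨w', hw'⟩ := exists_nu (h2' (-1) (by norm_num) (nu S z) z.2) hq0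
      have : y = w - w' := nu_injective (lam_injective (by
        rw [← h, lie_lie, hz, hz', hw, hw']; simp))
      rw [lie_lie, h3 hp0 x z hz, h3' hq0 x z' hz', h3 hp0 z' w hw, h3' hq0 z w' hw', this]
      simp

theorem exists_degree_neg : ∃ T : Amb S, ∀ p : ℤ, ∀ B : Amb S, Mem S p B →
    ⁅T, B⁆ = (p : ℝ) • B := by
  obtain ⟨δ, hδ⟩ := exists_degree (S := S)
  have hneg : ∀ x : S.neg, δ x ∈ S.neg := by
    intro x
    induction x using neg_induction with
    | h0 => simp
    | hadd x y hx hy =>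
      have := add_mem hx hy
      simpa using this
    | h q hq x hx =>
      rw [hδ q x hx]
      exact S.neg.smul_mem _ x.2
  let δ' : S.neg →ₗ[ℝ] S.neg :=
    { toFun := fun x => ⟨δ x, hneg x⟩
      map_add' := fun x y => Subtype.ext (by simp)
      map_smul' := fun t x => Subtype.ext (by simp) }
  have hδ' : ∀ q : ℤ, ∀ x : S.neg, (x : A) ∈ S.deg q → δ' x = (q : ℝ) • x :=
    fun q x hx => Subtype.ext (hδ q x hx)
  obtain ⟨T, hT1, hT⟩ := exists_of_derivation ((lam S : S.neg →ₗ[ℝ] Amb S).comp δ') (by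
    intro x y
    induction x using neg_induction with
    | h0 => simp
    | hadd x x' hx hx' => simp only [add_lie, map_add, hx, hx']; abel
    | h q hq x hx =>
      induction y using neg_induction with
      | h0 => simp
      | hadd y y' hy hy' => simp only [lie_add, map_add, hy, hy']; abel
      | h r hr y hy =>
        simp [hδ' (q + r) ⁅x, y⁆ (S.lie_mem hx hy), hδ' q x hx, hδ' r y hy, add_smul])
  refine ⟨T, fun p B hB => ?_⟩
  induction hB with
  | neg p hp x hx => simp [hT, hδ' p x hx]
  | nonneg p hp B h1 h2 h3 ih =>
    rw [← sub_eq_zero]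
    apply ext_zero
    · simp [Ring.lie_def, h1, hT1]
    · intro x
      induction x using neg_induction with
      | h0 => simp
      | hadd x y hx hy => rw [map_add, lie_add, hx, hy, add_zero]
      | h q hq x hx =>
        rw [sub_lie, lie_lie, ih q hq x hx, hT, smul_lie]
        simp [hδ' q x hx, add_smul]

theorem comp_iSupIndep : iSupIndep (comp S) := by
  obtain ⟨T, hT⟩ := exists_degree_neg (S := S)
  let f : Module.End ℝ (Amb S) := LieAlgebra.ad ℝ (Amb S) T
  refine iSupIndep.mono ((Module.End.eigenspaces_iSupIndep f).comp
    (Int.cast_injective (α := ℝ))) fun p B hB => ?_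
  exact Module.End.mem_eigenspace_iff.2 (hT p B hB)

variable (S) in
/-- The prolongation. -/
def alg : LieSubalgebra ℝ (Amb S) where
  toSubmodule := ⨆ p, comp S p
  lie_mem' := by
    intro x y hx hy
    refine Submodule.iSup_induction _ (motive := fun x => ⁅x, y⁆ ∈ _) hx ?_ (by simp) ?_
    · intro p x hx
      refine Submodule.iSup_induction _ (motive := fun y => ⁅x, y⁆ ∈ _) hy ?_ (by simp) ?_
      · intro q y hy
        exact Submodule.mem_iSup_of_mem (p + q) (mem_lie hx hy)
      · intro a b ha hb
        rw [lie_add]; exact Submodule.add_mem _ ha hb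
    · intro a b ha hb
      rw [add_lie]; exact Submodule.add_mem _ ha hb

theorem mem_alg {p : ℤ} {T : Amb S} (hT : Mem S p T) : T ∈ alg S :=
  Submodule.mem_iSup_of_mem (p := comp S) p hT

variable (S) in
/-- The gradation of the prolongation. -/
def grading : LieGrading (alg S) where
  deg p := (comp S p).comap (alg S).toSubmodule.subtype
  isInternal := by
    rw [DirectSum.isInternal_submodule_iff_iSupIndep_and_iSup_eq_top]
    constructor
    · intro p
      rw [Submodule.disjoint_def]
      intro x hx hx'
      refine Subtype.ext (Submodule.disjoint_def.1 (comp_iSupIndep (S := S) p) x hx ?_)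
      refine (iSup₂_le fun j hj y hy => ?_ : _ ≤ (⨆ j, ⨆ (_ : j ≠ p), comp S j).comap
        (alg S).toSubmodule.subtype) hx'
      exact (le_iSup₂ (f := fun j (_ : j ≠ p) => comp S j) j hj) hy
    · rw [eq_top_iff]
      rintro ⟨x, hx⟩ -
      have hx' : x ∈ ⨆ p, comp S p := hx
      induction hx' using Submodule.iSup_induction' with
      | mem p x hx' => exact Submodule.mem_iSup_of_mem p hx'
      | zero => exact zero_mem _
      | add x y hx' hy' ihx ihy => exact add_mem (ihx hx') (ihy hy')
  lie_mem := fun hx hy => mem_lie hx hy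

variable (S) in
/-- The inclusion of `m` in the prolongation. -/
noncomputable def incl : S.neg →ₗ⁅ℝ⁆ alg S where
  toFun x := ⟨lam S x, by
    induction x using neg_induction with
    | h0 => simp
    | hadd x y hx hy => rw [map_add]; exact add_mem hx hy
    | h q hq x hx => exact mem_alg (.neg q hq x hx)⟩
  map_add' x y := Subtype.ext (by simp)
  map_smul' t x := Subtype.ext (by simp)
  map_lie' {x y} := Subtype.ext (by simp)

variable (S) in
/-- The inclusion of `m₋₁` in the component of degree `-1` of the prolongation. -/
noncomputable def equivFun : S.deg (-1) →ₗ[ℝ] (grading S).deg (-1) where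
  toFun x := ⟨incl S (nu S x), Mem.neg (-1) (by norm_num) (nu S x) x.2⟩
  map_add' x y := Subtype.ext (by simp)
  map_smul' t x := Subtype.ext (by simp)

variable (S) in
/-- `m₋₁` is the component of degree `-1` of the prolongation. -/
noncomputable def equiv : S.deg (-1) ≃ₗ[ℝ] (grading S).deg (-1) :=
  LinearEquiv.ofBijective (equivFun S)
    ⟨fun x y h => nu_injective (lam_injective
        (congrArg (fun z : (grading S).deg (-1) => ((z : alg S) : Amb S)) h)),
      fun y => by
        obtain ⟨x, hx, h⟩ := (mem_neg_iff (by norm_num) _).1 y.2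
        exact ⟨⟨x, hx⟩, Subtype.ext (Subtype.ext h)⟩⟩

theorem coe_equiv (x : S.deg (-1)) : ((equiv S x : alg S) : Amb S) = lam S (nu S x) := rfl

variable (S) in
/-- The partial complex structure of the prolongation. -/
noncomputable def cJ : (grading S).deg (-1) →ₗ[ℝ] (grading S).deg (-1) :=
  (equiv S).toLinearMap ∘ₗ S.J ∘ₗ (equiv S).symm.toLinearMap

theorem cJ_equiv (x : S.deg (-1)) : cJ S (equiv S x) = equiv S (S.J x) := by
  simp [cJ]

theorem coe_J {x : (grading S).deg (-1)} {a : S.deg (-1)} (h : equiv S a = x) :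
    ((cJ S x : alg S) : Amb S) = lam S (nu S (S.J a)) := by
  rw [← h, cJ_equiv]; rfl

theorem coe_eq {x : (grading S).deg (-1)} {a : S.deg (-1)} (h : equiv S a = x) :
    ((x : alg S) : Amb S) = lam S (nu S a) := by
  rw [← h]; rfl

theorem cJ_sq (x : (grading S).deg (-1)) : cJ S (cJ S x) = -x := by
  have h : ∀ u : (grading S).deg (-1), cJ S u = equiv S (S.J ((equiv S).symm u)) := fun _ => rfl
  rw [h, h, LinearEquiv.symm_apply_apply, S.isCR.sq]
  exact (equiv S).toLinearMap.map_neg _ |>.trans (congrArg Neg.neg ((equiv S).apply_symm_apply x))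

theorem cJ_lie (x y : (grading S).deg (-1)) :
    ⁅(cJ S x : alg S), (cJ S y : alg S)⁆ = ⁅(x : alg S), (y : alg S)⁆ := by
  obtain ⟨a, ha⟩ := (equiv S).surjective x
  obtain ⟨b, hb⟩ := (equiv S).surjective y
  have h : ⁅nu S (S.J a), nu S (S.J b)⁆ = ⁅nu S a, nu S b⁆ :=
    Subtype.ext (S.isCR.lie_J_J a b)
  have h' := congrArg (lam S) h
  rw [LieHom.map_lie, LieHom.map_lie, ← coe_J ha, ← coe_J hb, ← coe_eq ha, ← coe_eq hb] at h'
  exact Subtype.ext h'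

theorem cJ_zero (z : alg S) (hz : z ∈ (grading S).deg 0) (x y : (grading S).deg (-1))
    (h : ⁅z, (x : alg S)⁆ = y) : ⁅z, (cJ S x : alg S)⁆ = cJ S y := by
  obtain ⟨a, ha⟩ := (equiv S).surjective x
  obtain ⟨b, hb⟩ := (equiv S).surjective y
  have h1 : ⁅(z : Amb S), ((x : alg S) : Amb S)⁆ = ((y : alg S) : Amb S) :=
    congrArg (fun z : alg S => (z : Amb S)) h
  rw [coe_eq ha, coe_eq hb] at h1
  have h2 := ((mem_nonneg_iff le_rfl _).1 hz).2.2 rfl a b h1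
  refine Subtype.ext ?_
  change ⁅(z : Amb S), ((cJ S x : alg S) : Amb S)⁆ = ((cJ S y : alg S) : Amb S)
  rw [coe_J ha, coe_J hb]
  exact h2

theorem cJ_isCR : IsCRStructure (grading S) (cJ S) := ⟨cJ_sq, cJ_lie, cJ_zero⟩

variable (S) in
/-- The graded `CR` structure of the prolongation. -/
noncomputable def cr : CRAlgebra (alg S) where
  toLieGrading := grading S
  J := cJ S
  isCR := cJ_isCR

theorem incl_mem_neg (x : S.neg) : incl S x ∈ (cr S).neg := by
  induction x using neg_induction with
  | h0 => simp
  | hadd x y hx hy => rw [map_add]; exact add_mem hx hy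
  | h q hq x hx => exact (cr S).mem_neg hq (.neg q hq x hx)

theorem incl_surjective (y : (cr S).neg) : ∃ x : S.neg, incl S x = y := by
  induction y using neg_induction with
  | h0 => exact ⟨0, by simp⟩
  | hadd y z hy hz =>
    obtain ⟨a, ha⟩ := hy
    obtain ⟨b, hb⟩ := hz
    exact ⟨a + b, by simp [ha, hb]⟩
  | h q hq y hy =>
    obtain ⟨x, -, h⟩ := (mem_neg_iff hq _).1 hy
    exact ⟨x, Subtype.ext h⟩

theorem cr_transitive (hS : S.IsFundamental) : (cr S).IsTransitive := by
  intro p hp Y hY hY0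
  by_contra! hc
  apply hY0
  have h1 : ∀ k : ℕ, ∀ x ∈ S.deg (-1 - k), ∀ hx : x ∈ S.neg,
      ⁅(Y : Amb S), lam S ⟨x, hx⟩⁆ = 0 := by
    have h0 : ∀ x : S.neg, (x : A) ∈ S.deg (-1) → ⁅(Y : Amb S), lam S x⁆ = 0 := by
      intro x hx
      have := congrArg Subtype.val (hc (incl S x) (.neg (-1) (by norm_num) x hx))
      rw [← lie_skew, neg_eq_zero]
      exact this
    intro k
    induction k with
    | zero =>
      intro x hx hx'
      exact h0 ⟨x, hx'⟩ (by simpa using hx)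
    | succ k ih =>
      intro x hx
      have hx' : x ∈ Submodule.span ℝ
          {z | ∃ x ∈ S.deg (-1), ∃ y ∈ S.deg (-1 - k), ⁅x, y⁆ = z} := by
        have := hS (-1 - k) (by omega)
        change S.deg _ = _ at this
        rw [show (-1 - (k : ℤ) - 1) = -1 - ((k + 1 : ℕ) : ℤ) by push_cast; ring] at this
        rw [this] at hx
        exact hx
      clear hx
      have hsub : ∀ z ∈ {z | ∃ x ∈ S.deg (-1), ∃ y ∈ S.deg (-1 - k), ⁅x, y⁆ = z},
          z ∈ S.neg := by
        rintro _ ⟨x, hx, y, hy, rfl⟩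
        exact S.neg.lie_mem (S.mem_neg (by norm_num) hx) (S.mem_neg (by omega) hy)
      have hspan := Submodule.span_le (p := S.neg.toSubmodule).2 hsub
      induction hx' using Submodule.span_induction with
      | mem z hz =>
        obtain ⟨x, hx, y, hy, rfl⟩ := hz
        intro hz'
        have e : (⟨⁅x, y⁆, hz'⟩ : S.neg)
          = ⁅(⟨x, S.mem_neg (by norm_num) hx⟩ : S.neg), ⟨y, S.mem_neg (by omega) hy⟩⁆ := rfl
        rw [e, LieHom.map_lie, leibniz_lie, h0 _ hx, ih y hy, zero_lie, lie_zero, add_zero]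
      | zero =>
        intro hz
        have e : (⟨0, hz⟩ : S.neg) = 0 := rfl
        simp [e]
      | add x y hx hy ihx ihy =>
        intro hz
        have e : (⟨x + y, hz⟩ : S.neg) = ⟨x, hspan hx⟩ + ⟨y, hspan hy⟩ := rfl
        rw [e, map_add, lie_add, ihx, ihy, add_zero]
      | smul t x hx ihx =>
        intro hz
        have e : (⟨t • x, hz⟩ : S.neg) = t • ⟨x, hspan hx⟩ := rfl
        rw [e, map_smul, lie_smul, ihx, smul_zero]
  refine Subtype.ext (ext_zero ((mem_nonneg_iff hp _).1 hY).1 fun x => ?_)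
  induction x using neg_induction with
  | h0 => simp
  | hadd x y hx hy => rw [map_add, lie_add, hx, hy, add_zero]
  | h q hq x hx =>
    obtain ⟨k, hk⟩ : ∃ k : ℕ, q = -1 - k := ⟨(-1 - q).toNat, by omega⟩
    exact h1 k x (hk ▸ hx) x.2

theorem isProlongation (hS : S.IsFundamental) : IsProlongation S (cr S) (incl S) where
  injective x y h := lam_injective (congrArg Subtype.val h)
  mem_deg p hp y := by
    refine (mem_neg_iff hp _).trans ?_
    exact exists_congr fun x => and_congr_right fun _ =>
      ⟨fun h => Subtype.ext h, fun h => congrArg Subtype.val h⟩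
  map_J x y h := by
    have : y = equiv S x := Subtype.ext h.symm
    subst this
    exact congrArg Subtype.val (cJ_equiv x).symm
  transitive := cr_transitive hS
  complete p hp D hD hJ := by
    let κ : S.neg →ₗ[ℝ] (cr S).neg :=
      { toFun := fun x => ⟨incl S x, incl_mem_neg x⟩
        map_add' := fun x y => Subtype.ext (by simp)
        map_smul' := fun t x => Subtype.ext (by simp) }
    have hκ : ∀ x y, κ ⁅x, y⁆ = ⁅κ x, κ y⁆ := fun x y => Subtype.ext (LieHom.map_lie _ x y)
    obtain ⟨T, hT1, hT⟩ := exists_of_derivation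
      ((alg S).toSubmodule.subtype ∘ₗ (D : (cr S).neg →ₗ[ℝ] alg S) ∘ₗ κ) (by
        intro x y
        have := congrArg (fun z : alg S => (z : Amb S)) (D.apply_lie_eq_sub (κ x) (κ y))
        simp only [LinearMap.comp_apply, hκ]
        refine this.trans ?_
        change ⁅lam S x, (D (κ y) : Amb S)⁆ - ⁅lam S y, (D (κ x) : Amb S)⁆ =
          ⁅(D (κ x) : Amb S), lam S y⁆ + ⁅lam S x, (D (κ y) : Amb S)⁆
        rw [← lie_skew (D (κ x) : Amb S) (lam S y)]
        abel)
    have hT' : ∀ x, ⁅T, lam S x⁆ = (D (κ x) : Amb S) := hT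
    have hmem : Mem S p T := by
      refine (mem_nonneg_iff hp T).2 ⟨hT1, fun q hq x hx => ?_, fun hp0 x y h => ?_⟩
      · rw [hT', add_comm]
        exact hD q hq (κ x) (.neg q hq x hx)
      · rw [hT'] at h ⊢
        have h2 := hJ hp0 (equiv S x) (equiv S y) (Subtype.ext h)
        have h3 : cJ S (equiv S x) = equiv S (S.J x) := cJ_equiv x
        have h4 : cJ S (equiv S y) = equiv S (S.J y) := cJ_equiv y
        have h5 : κ (nu S (S.J x)) = ⟨cJ S (equiv S x), (cr S).mem_neg (by norm_num)
            (cJ S (equiv S x)).2⟩ := Subtype.ext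
            (congrArg (fun z : (grading S).deg (-1) => (z : alg S)) h3.symm)
        rw [h5]
        refine (congrArg (fun z : alg S => (z : Amb S)) h2).trans ?_
        exact congrArg (fun z : (grading S).deg (-1) => ((z : alg S) : Amb S)) h4
    refine ⟨⟨T, mem_alg hmem⟩, hmem, fun x => ?_⟩
    obtain ⟨y, hy⟩ := incl_surjective x
    have : x = κ y := Subtype.ext hy.symm
    subst this
    exact Subtype.ext (hT' y).symm

end Existence

/-- Every fundamental graded `CR` algebra has a maximal transitive `CR` prolongation, so that a
statement about all the `G`, `ι` with `IsProlongation S G ι` is a statement about an actual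
algebra (and it is determined up to isomorphism by the conditions). -/
theorem exists_isProlongation.{u} {A : Type u} [LieRing A] [LieAlgebra ℝ A] (S : CRAlgebra A)
    (hS : S.IsFundamental) :
    ∃ (g : Type u) (_ : LieRing g) (_ : LieAlgebra ℝ g) (G : CRAlgebra g)
      (ι : S.neg →ₗ⁅ℝ⁆ g), IsProlongation S G ι :=
  ⟨_, _, _, _, _, Existence.isProlongation hS⟩

end LeviTanaka

/-!
Let `R = s ⊕ l` be the Abelian extension, `m = R₋`, and `g` the prolongation of `m`.

The prolongation is finite dimensional (`IsProlongation.finiteDimensional`). The partial complex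
structure forces the centralizer of `⨁_{p < -1} g_p` in `g` to vanish in positive degree
(`CRAlgebra.eq_zero_of_mem_ann`), so this centralizer is finite dimensional. Each `g_{p-1}`, `p < 0`,
is spanned by commutators of elements of `g₋₁` and `g_p`, and removing one commutator at a time from
the subspace that is centralized keeps the centralizer finite dimensional
(`finiteDimensional_of_commutator`); when nothing is left, the centralizer is `g`.

Let `g₁` be a maximal semisimple ideal of `g`. It is complemented by its orthogonal `g₂` for the
Killing form, and `g₂` is proper (`exists_isCompl_isSemisimple_isProper`). The degree derivation
commutes with `J` on `m`, so it is inner in `g`, and therefore `g₁` and `g₂` are graded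
(`IsProlongation.isHomogeneous_ideal`); nondegeneracy makes them stable under `J`
(`CRAlgebra.J_mem_of_isCompl`).

By the maximality of the prolongation, `R` embeds in `g` (`IsProlongation.exists_lieHom`). The ideals
`A₁`, `A₂` that `g₁`, `g₂` cut out on `R` are independent and their sum contains `m`. The
projection of `Aᵢ` on `s` is an ideal of `s`, hence perfect, and this forces
`Aᵢ = (Aᵢ ∩ s) ⊕ (Aᵢ ∩ l)` (`mem_iff_parts`). The orthogonal of the sum of the `Aᵢ ∩ s` commutes with
`s₋₁` and meets that sum in zero, so it vanishes by transitivity (`isCompl_idealPart`). By complete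
reducibility `l` is spanned by `s · l`, which is contained in the sum of the `Aᵢ ∩ l`, and by
invariant vectors, which lie in the negative part by transitivity and hence also in that sum
(`isCompl_modulePart`). Thus `R = A₁ ⊕ A₂`.

The properties of `R` and `g` pass to direct factors; in particular the direct factor `gᵢ` of `g` is
the prolongation of its own negative part (`IsFactor.exists_isProlongation`).
-/

namespace LeviTanaka

/-! ### Graded vector spaces -/

section Graded

variable {V W : Type*} [AddCommGroup V] [Module ℝ V] [AddCommGroup W] [Module ℝ W]
  {deg : ℤ → Submodule ℝ V} {deg' : ℤ → Submodule ℝ W}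

/-- The projection of a graded vector space on its component of degree `p`, as an endomorphism. -/
noncomputable def gproj (h : DirectSum.IsInternal deg) (p : ℤ) : V →ₗ[ℝ] V :=
  (deg p).subtype ∘ₗ DirectSum.component ℝ ℤ (fun p => deg p) p ∘ₗ
    (LinearEquiv.ofBijective (DirectSum.coeLinearMap deg) h).symm.toLinearMap

theorem gproj_mem (h : DirectSum.IsInternal deg) (p : ℤ) (x : V) : gproj h p x ∈ deg p :=
  Subtype.prop _

theorem ofBijective_symm_of_mem (h : DirectSum.IsInternal deg) {p : ℤ} {x : V} (hx : x ∈ deg p) :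
    (LinearEquiv.ofBijective (DirectSum.coeLinearMap deg) h).symm x =
      DirectSum.lof ℝ ℤ (fun p => deg p) p ⟨x, hx⟩ := by
  rw [LinearEquiv.symm_apply_eq]
  exact (DirectSum.coeLinearMap_lof deg p ⟨x, hx⟩).symm

theorem gproj_of_mem (h : DirectSum.IsInternal deg) {p : ℤ} {x : V} (hx : x ∈ deg p) :
    gproj h p x = x := by
  simp only [gproj, LinearMap.comp_apply, LinearEquiv.coe_coe, ofBijective_symm_of_mem h hx,
    DirectSum.component.lof_self]
  rfl

theorem gproj_of_mem_ne (h : DirectSum.IsInternal deg) {p q : ℤ} {x : V} (hx : x ∈ deg q)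
    (hpq : p ≠ q) : gproj h p x = 0 := by
  simp only [gproj, LinearMap.comp_apply, LinearEquiv.coe_coe, ofBijective_symm_of_mem h hx]
  rw [DirectSum.component.of, dif_neg (Ne.symm hpq)]
  rfl

theorem iSup_deg (h : DirectSum.IsInternal deg) : ⨆ p, deg p = ⊤ :=
  ((DirectSum.isInternal_submodule_iff_iSupIndep_and_iSup_eq_top _).1 h).2

/-- Two linear maps that agree on homogeneous elements are equal. -/
theorem gext (h : DirectSum.IsInternal deg) {f g : V →ₗ[ℝ] W}
    (hfg : ∀ p, ∀ x ∈ deg p, f x = g x) : f = g := by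
  have : (⊤ : Submodule ℝ V) ≤ LinearMap.eqLocus f g := by
    rw [← iSup_deg h]
    exact iSup_le fun p x hx => hfg p x hx
  exact LinearMap.ext fun x => this Submodule.mem_top

/-- A linear map of degree `k` commutes with the projections. -/
theorem gproj_map (h : DirectSum.IsInternal deg) (h' : DirectSum.IsInternal deg') {k : ℤ}
    (f : V →ₗ[ℝ] W) (hf : ∀ p, ∀ x ∈ deg p, f x ∈ deg' (p + k)) (p : ℤ) (x : V) :
    gproj h' (p + k) (f x) = f (gproj h p x) := by
  refine LinearMap.congr_fun (f := gproj h' (p + k) ∘ₗ f) (g := f ∘ₗ gproj h p)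
    (gext h fun q y hy => ?_) x
  by_cases hpq : p = q
  · subst hpq
    simp only [LinearMap.comp_apply, gproj_of_mem h hy, gproj_of_mem h' (hf _ y hy)]
  · simp only [LinearMap.comp_apply, gproj_of_mem_ne h hy hpq, map_zero,
      gproj_of_mem_ne h' (hf q y hy) (show p + k ≠ q + k by omega)]

theorem gproj_map_zero (h : DirectSum.IsInternal deg) (h' : DirectSum.IsInternal deg')
    (f : V →ₗ[ℝ] W) (hf : ∀ p, ∀ x ∈ deg p, f x ∈ deg' p) (p : ℤ) (x : V) :
    gproj h' p (f x) = f (gproj h p x) := by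
  have := gproj_map h h' (k := 0) f (fun p x hx => by rw [add_zero]; exact hf p x hx) p x
  rwa [add_zero] at this

theorem exists_finset_sum_gproj (h : DirectSum.IsInternal deg) (x : V) :
    ∃ F : Finset ℤ, x = ∑ p ∈ F, gproj h p x := by
  have hx : x ∈ ⨆ p, deg p := iSup_deg h ▸ Submodule.mem_top
  classical
  suffices H : ∃ F : Finset ℤ, (∀ p ∉ F, gproj h p x = 0) ∧ x = ∑ p ∈ F, gproj h p x from
    ⟨H.choose, H.choose_spec.2⟩
  induction hx using Submodule.iSup_induction' with
  | mem p x hx =>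
    refine ⟨{p}, fun q hq => gproj_of_mem_ne h hx (by simpa using hq), ?_⟩
    simp [gproj_of_mem h hx]
  | zero => exact ⟨∅, by simp, by simp⟩
  | add x y hx hy ihx ihy =>
    obtain ⟨F, hF, eF⟩ := ihx
    obtain ⟨F', hF', eF'⟩ := ihy
    refine ⟨F ∪ F', fun p hp => ?_, ?_⟩
    · rw [Finset.mem_union, not_or] at hp
      rw [map_add, hF p hp.1, hF' p hp.2, add_zero]
    · simp only [map_add, Finset.sum_add_distrib]
      rw [← Finset.sum_subset (Finset.subset_union_left (s₁ := F) (s₂ := F'))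
        (fun p _ hp => hF p hp), ← Finset.sum_subset
        (Finset.subset_union_right (s₁ := F) (s₂ := F')) (fun p _ hp => hF' p hp), ← eF, ← eF']

theorem eq_zero_of_gproj (h : DirectSum.IsInternal deg) {x : V} (hx : ∀ p, gproj h p x = 0) :
    x = 0 := by
  obtain ⟨F, hF⟩ := exists_finset_sum_gproj h x
  rw [hF]
  exact Finset.sum_eq_zero fun p _ => hx p

/-- A subspace is a graded subspace if it contains the homogeneous components of its elements. -/
def IsHomogeneous (h : DirectSum.IsInternal deg) (U : Submodule ℝ V) : Prop :=
  ∀ x ∈ U, ∀ p, gproj h p x ∈ U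

/-- A gradation induces a gradation on the source of an injective linear map with a homogeneous
range. -/
theorem isInternal_comap (h : DirectSum.IsInternal deg) (f : W →ₗ[ℝ] V)
    (hf : Function.Injective f) (hr : IsHomogeneous h (LinearMap.range f)) :
    DirectSum.IsInternal fun p => (deg p).comap f := by
  rw [DirectSum.isInternal_submodule_iff_iSupIndep_and_iSup_eq_top]
  constructor
  · have hind := ((DirectSum.isInternal_submodule_iff_iSupIndep_and_iSup_eq_top _).1 h).1
    intro p
    rw [Submodule.disjoint_def]
    intro x hx hx'
    refine hf ((Submodule.disjoint_def.1 (hind p) (f x) hx ?_).trans (map_zero f).symm)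
    refine (iSup₂_le fun j hj y hy => ?_ :
      _ ≤ (⨆ j, ⨆ (_ : j ≠ p), deg j).comap f) hx'
    exact (le_iSup₂ (f := fun j (_ : j ≠ p) => deg j) j hj) hy
  · rw [eq_top_iff]
    intro x _
    obtain ⟨F, hF⟩ := exists_finset_sum_gproj h (f x)
    choose y hy using fun p => hr (f x) ⟨x, rfl⟩ p
    have : x = ∑ p ∈ F, y p := hf (by rw [map_sum]; simp only [hy]; exact hF)
    rw [this]
    refine Submodule.sum_mem _ fun p _ => Submodule.mem_iSup_of_mem p ?_
    rw [Submodule.mem_comap, hy]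
    exact gproj_mem h p _

/-- A subspace stable under the degree operator is graded. -/
theorem isHomogeneous_of_degree (h : DirectSum.IsInternal deg) (δ : V →ₗ[ℝ] V)
    (hδ : ∀ p : ℤ, ∀ x ∈ deg p, δ x = (p : ℝ) • x) (U : Submodule ℝ V)
    (hU : ∀ x ∈ U, δ x ∈ U) : IsHomogeneous h U := by
  classical
  have key : ∀ F : Finset ℤ, ∀ y : ℤ → V, (∀ p, y p ∈ deg p) → ∑ p ∈ F, y p ∈ U →
      ∀ p ∈ F, y p ∈ U := by
    intro F
    induction F using Finset.induction_on with
    | empty => simp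
    | insert a F ha ih =>
      intro y hy hsum
      have h1 : ∑ p ∈ F, ((p : ℝ) - a) • y p ∈ U := by
        have := U.sub_mem (hU _ hsum) (U.smul_mem (a : ℝ) hsum)
        rw [Finset.sum_insert ha, map_add, map_sum, hδ a _ (hy a), smul_add,
          add_sub_add_left_eq_sub, Finset.smul_sum, ← Finset.sum_sub_distrib] at this
        convert this using 2 with p
        rw [hδ p _ (hy p), sub_smul]
      have h2 := ih (fun p => ((p : ℝ) - a) • y p) (fun p => (deg p).smul_mem _ (hy p)) h1
      have h3 : ∀ p ∈ F, y p ∈ U := by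
        intro p hp
        have hpa : (p : ℝ) - a ≠ 0 := by
          rw [sub_ne_zero]
          exact_mod_cast fun e : p = a => ha (e ▸ hp)
        have := U.smul_mem ((p : ℝ) - a)⁻¹ (h2 p hp)
        simpa [smul_smul, inv_mul_cancel₀ hpa] using this
      intro p hp
      rcases Finset.mem_insert.1 hp with rfl | hp
      · rw [Finset.sum_insert ha] at hsum
        exact (U.add_mem_iff_left (U.sum_mem h3)).1 hsum
      · exact h3 p hp
  intro x hx p
  obtain ⟨F, hF⟩ := exists_finset_sum_gproj h x
  by_cases hp : p ∈ F
  · exact key F (fun p => gproj h p x) (fun p => gproj_mem h p x) (hF ▸ hx) p hp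
  · have : gproj h p x = 0 := by
      conv_lhs => rw [hF]
      rw [map_sum]
      refine Finset.sum_eq_zero fun q hq => gproj_of_mem_ne h (gproj_mem h q x) ?_
      rintro rfl
      exact hp hq
    rw [this]
    exact U.zero_mem

end Graded

/-! ### Graded Lie algebras -/

namespace LieGrading

variable {A B : Type*} [LieRing A] [LieAlgebra ℝ A] [LieRing B] [LieAlgebra ℝ B]

theorem lie_gproj (S : LieGrading A) {q : ℤ} {y : A} (hy : y ∈ S.deg q) (p : ℤ) (x : A) :
    gproj S.isInternal (p + q) ⁅y, x⁆ = ⁅y, gproj S.isInternal p x⁆ :=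
  gproj_map S.isInternal S.isInternal (LieAlgebra.ad ℝ A y : A →ₗ[ℝ] A)
    (fun r z hz => by rw [add_comm]; exact S.lie_mem hy hz) p x

theorem neg_induction (S : LieGrading A) {P : A → Prop} (h0 : P 0)
    (hadd : ∀ x y, P x → P y → P (x + y))
    (h : ∀ q : ℤ, q < 0 → ∀ x ∈ S.deg q, P x) {x : A} (hx : x ∈ S.neg) : P x := by
  have hx' : x ∈ ⨆ p : {p : ℤ // p < 0}, S.deg p := hx
  exact Submodule.iSup_induction _ (motive := P) hx' (fun p x hx => h p p.2 x hx) h0 hadd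

/-- In a transitive graded Lie algebra an element of degree `p ≥ 0` is determined by its brackets
with the component of degree `-1`. -/
theorem IsTransitive.eq_zero {S : LieGrading A} (h : S.IsTransitive) {p : ℤ} (hp : 0 ≤ p) {y : A}
    (hy : y ∈ S.deg p) (hz : ∀ x ∈ S.deg (-1), ⁅x, y⁆ = 0) : y = 0 := by
  by_contra h0
  obtain ⟨x, hx, hxy⟩ := h p hp y hy h0
  exact hxy (hz x hx)

theorem IsTransitive.eq {S : LieGrading A} (h : S.IsTransitive) {p : ℤ} (hp : 0 ≤ p) {y z : A}
    (hy : y ∈ S.deg p) (hz : z ∈ S.deg p) (hyz : ∀ x ∈ S.deg (-1), ⁅y, x⁆ = ⁅z, x⁆) : y = z := by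
  rw [← sub_eq_zero]
  refine h.eq_zero hp (sub_mem hy hz) fun x hx => ?_
  rw [← lie_skew, sub_lie, hyz x hx, sub_self, neg_zero]

theorem IsNondegenerate.eq_zero {S : LieGrading A} (h : S.IsNondegenerate) {y : A}
    (hy : y ∈ S.deg (-1)) (hz : ∀ x ∈ S.deg (-1), ⁅x, y⁆ = 0) : y = 0 := by
  by_contra h0
  obtain ⟨x, hx, hxy⟩ := h y hy h0
  exact hxy (hz x hx)

/-- The gradation induced by an injective homomorphism with a homogeneous range. -/
def comap (S : LieGrading A) (i : B →ₗ⁅ℝ⁆ A) (hi : Function.Injective i)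
    (hr : IsHomogeneous S.isInternal (LinearMap.range (i : B →ₗ[ℝ] A))) : LieGrading B where
  deg p := (S.deg p).comap (i : B →ₗ[ℝ] A)
  isInternal := isInternal_comap S.isInternal _ hi hr
  lie_mem := by
    intro p q x y hx hy
    rw [Submodule.mem_comap] at *
    have := S.lie_mem hx hy
    rwa [LieHom.coe_toLinearMap, LieHom.map_lie]

end LieGrading

/-- The axioms of a graded `CR` algebra pass to the source of a graded embedding that intertwines
the partial complex structures. -/
theorem IsCRStructure.comap {A B : Type*} [LieRing A] [LieAlgebra ℝ A] [LieRing B]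
    [LieAlgebra ℝ B] {S : LieGrading A} {J : S.deg (-1) →ₗ[ℝ] S.deg (-1)} (h : IsCRStructure S J)
    {T : LieGrading B} {K : T.deg (-1) →ₗ[ℝ] T.deg (-1)} (i : B →ₗ⁅ℝ⁆ A)
    (hi : Function.Injective i) (hdeg : ∀ p, ∀ x ∈ T.deg p, i x ∈ S.deg p)
    (hJ : ∀ (x : T.deg (-1)) (y : S.deg (-1)), i x = y → i (K x) = J y) : IsCRStructure T K where
  sq x := by
    refine Subtype.ext (hi ?_)
    rw [hJ (K x) (J ⟨i x, hdeg _ x x.2⟩) (hJ x _ rfl), h.sq]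
    simp
  lie_J_J x y := by
    refine hi ?_
    rw [LieHom.map_lie, LieHom.map_lie, hJ x ⟨i x, hdeg _ x x.2⟩ rfl,
      hJ y ⟨i y, hdeg _ y y.2⟩ rfl, h.lie_J_J]
  lie_zero a ha x y hxy := by
    refine hi ?_
    rw [LieHom.map_lie, hJ x ⟨i x, hdeg _ x x.2⟩ rfl, hJ y ⟨i y, hdeg _ y y.2⟩ rfl]
    refine h.lie_zero _ (hdeg 0 a ha) _ _ ?_
    exact (LieHom.map_lie i a x).symm.trans (congrArg i hxy)

/-- An operator on a subspace restricts to the preimage of the subspace under an injective map, if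
it preserves the range. -/
theorem exists_comap_operator {V W : Type*} [AddCommGroup V] [Module ℝ V] [AddCommGroup W]
    [Module ℝ W] (f : W →ₗ[ℝ] V) (hf : Function.Injective f) {U : Submodule ℝ V}
    (J : U →ₗ[ℝ] U) (hJ : ∀ (x : W) (hx : f x ∈ U), ∃ y, f y = J ⟨f x, hx⟩) :
    ∃ K : U.comap f →ₗ[ℝ] U.comap f, ∀ x (hx : f x ∈ U), f (K ⟨x, hx⟩) = J ⟨f x, hx⟩ := by
  choose k hk using hJ
  have hk' : ∀ x hx, k x hx ∈ U.comap f := fun x hx => by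
    rw [Submodule.mem_comap, hk]; exact Subtype.prop _
  refine ⟨⟨⟨fun x => ⟨k x x.2, hk' x x.2⟩, fun x y => Subtype.ext (hf ?_)⟩,
    fun t x => Subtype.ext (hf ?_)⟩, fun x hx => hk x hx⟩
  · refine (hk _ _).trans ((congrArg (fun z : U => (J z : V)) (Subtype.ext (map_add f _ _) :
      (⟨f (x + y : U.comap f), (x + y).2⟩ : U) = ⟨f x, x.2⟩ + ⟨f y, y.2⟩)).trans ?_)
    simp only [map_add, Submodule.coe_add, hk]
  · refine (hk _ _).trans ((congrArg (fun z : U => (J z : V)) (Subtype.ext (map_smul f _ _) :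
      (⟨f (t • x : U.comap f), (t • x).2⟩ : U) = t • ⟨f x, x.2⟩)).trans ?_)
    simp only [map_smul, Submodule.coe_smul, hk, RingHom.id_apply]

/-- A graded `CR` algebra induces a graded `CR` structure on the source of an injective
homomorphism whose range is homogeneous and stable under `J`. -/
theorem CRAlgebra.exists_isInduced {A B : Type*} [LieRing A] [LieAlgebra ℝ A] [LieRing B]
    [LieAlgebra ℝ B] (S : CRAlgebra A) (i : B →ₗ⁅ℝ⁆ A) (hi : Function.Injective i)
    (hr : IsHomogeneous S.isInternal (LinearMap.range (i : B →ₗ[ℝ] A)))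
    (hJ : ∀ (x : B) (hx : i x ∈ S.deg (-1)), ∃ y, i y = S.J ⟨i x, hx⟩) :
    ∃ T : CRAlgebra B, T.IsInduced S i := by
  obtain ⟨K, hK⟩ := exists_comap_operator (i : B →ₗ[ℝ] A) hi S.J hJ
  have hK' : ∀ (x : (S.toLieGrading.comap i hi hr).deg (-1)) (y : S.deg (-1)), i x = y →
      i (K x : B) = S.J y := by
    rintro x y hxy
    have : y = ⟨i x, x.2⟩ := Subtype.ext hxy.symm
    rw [this]
    exact hK x x.2
  exact ⟨⟨S.toLieGrading.comap i hi hr, K, S.isCR.comap i hi (fun p x hx => hx) hK'⟩,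
    fun p x => Iff.rfl, hK'⟩

/-! ### A finiteness criterion for representations of nilpotent Lie algebras -/

section Commutator

variable {V : Type*} [AddCommGroup V] [Module ℝ V]

/-- If `z = [x, y]` commutes with `x` and `y` and maps onto its (finite dimensional) kernel, then
`z` is injective: the operators induced on `ker z²` would otherwise exhibit the identity of `ker z`
as a sum of commutators. -/
theorem eq_zero_of_commutator (x y z : Module.End ℝ V) (hxy : x * y - y * x = z)
    (hx : Commute x z) (hy : Commute y z) [FiniteDimensional ℝ (LinearMap.ker z)]
    (hz : ∀ u, z u = 0 → ∃ v, z v = u) {u : V} (hu : z u = 0) : u = 0 := by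
  let K := LinearMap.ker z
  have hx' : ∀ v, z (x v) = x (z v) := fun v => (LinearMap.congr_fun hx v).symm
  have hy' : ∀ v, z (y v) = y (z v) := fun v => (LinearMap.congr_fun hy v).symm
  have hxy' : ∀ v, x (y v) - y (x v) = z v := fun v => LinearMap.congr_fun hxy v
  let zr : K.comap z →ₗ[ℝ] K := z.restrict fun v hv => hv
  obtain ⟨g, hg⟩ := zr.exists_rightInverse_of_surjective (LinearMap.range_eq_top.2 fun u => by
    obtain ⟨v, hv⟩ := hz u u.2
    exact ⟨⟨v, show z v ∈ K from hv ▸ u.2⟩, Subtype.ext hv⟩)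
  let σ : K →ₗ[ℝ] V := (K.comap z).subtype ∘ₗ g
  have hσ : ∀ u : K, z (σ u) = u := fun u => congrArg Subtype.val (LinearMap.congr_fun hg u)
  have hxK : ∀ v ∈ K, x v ∈ K := fun v hv => by
    rw [LinearMap.mem_ker] at *; rw [hx', hv, map_zero]
  have hyK : ∀ v ∈ K, y v ∈ K := fun v hv => by
    rw [LinearMap.mem_ker] at *; rw [hy', hv, map_zero]
  let x₀ : K →ₗ[ℝ] K := x.restrict hxK
  let y₀ : K →ₗ[ℝ] K := y.restrict hyK
  let x₁ : K →ₗ[ℝ] K := (x ∘ₗ σ - σ ∘ₗ x₀).codRestrict K fun u => by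
    have : z (σ (x₀ u)) = x u := hσ _
    change z (x (σ u) - σ (x₀ u)) = 0
    rw [map_sub, hx', hσ, this, sub_self]
  let y₁ : K →ₗ[ℝ] K := (y ∘ₗ σ - σ ∘ₗ y₀).codRestrict K fun u => by
    have : z (σ (y₀ u)) = y u := hσ _
    change z (y (σ u) - σ (y₀ u)) = 0
    rw [map_sub, hy', hσ, this, sub_self]
  have hx₁ : ∀ u, x (σ u) = σ (x₀ u) + x₁ u := fun u => (add_sub_cancel _ _).symm
  have hy₁ : ∀ u, y (σ u) = σ (y₀ u) + y₁ u := fun u => (add_sub_cancel _ _).symm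
  have key : (1 : Module.End ℝ K) = (x₁ * y₀ - y₀ * x₁) + (x₀ * y₁ - y₁ * x₀) := by
    refine LinearMap.ext fun u => Subtype.ext ?_
    have h1 := hxy' (σ u)
    rw [hσ, hy₁, hx₁, map_add, map_add, hx₁, hy₁] at h1
    have h2 : σ (x₀ (y₀ u)) = σ (y₀ (x₀ u)) := by
      refine congrArg σ (Subtype.ext ?_)
      have := hxy' u
      rw [LinearMap.mem_ker.1 u.2, sub_eq_zero] at this
      exact this
    rw [h2] at h1
    change (u : V) = (x₁ (y₀ u) - y (x₁ u)) + (x (y₁ u) - y₁ (x₀ u))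
    rw [← h1]
    abel
  have htr := congrArg (LinearMap.trace ℝ K) key
  rw [map_add, map_sub, map_sub, LinearMap.trace_mul_comm ℝ x₁ y₀, LinearMap.trace_mul_comm ℝ x₀ y₁,
    sub_self, sub_self, add_zero, LinearMap.trace_one, Nat.cast_eq_zero] at htr
  have := Module.finrank_zero_iff.1 htr
  exact congrArg Subtype.val (Subsingleton.elim (⟨u, hu⟩ : K) 0)

/-- If a locally nilpotent operator `z = [x, y]` commutes with `x` and `y` and has a finite
dimensional kernel, then the space is finite dimensional. -/
theorem finiteDimensional_of_commutator (x y z : Module.End ℝ V) (hxy : x * y - y * x = z)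
    (hx : Commute x z) (hy : Commute y z) (hnil : ∀ v, ∃ n : ℕ, (z ^ n) v = 0)
    [FiniteDimensional ℝ (LinearMap.ker z)] : FiniteDimensional ℝ V := by
  let K := LinearMap.ker z
  let f : ℕ →o (Submodule ℝ K)ᵒᵈ :=
    ⟨fun n => OrderDual.toDual ((LinearMap.range (z ^ n)).comap K.subtype), by
      refine monotone_nat_of_le_succ fun n => ?_
      rintro u ⟨v, hv⟩
      exact ⟨z v, by rw [← hv, pow_succ]; rfl⟩⟩
  obtain ⟨N, hN⟩ := monotone_stabilizes_iff_artinian.2 (inferInstance : IsArtinian ℝ K) f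
  -- on the range of `z ^ N` the operator `z` maps onto its kernel
  let U := LinearMap.range (z ^ N)
  have hU : ∀ w : Module.End ℝ V, Commute w z → ∀ u ∈ U, w u ∈ U := by
    rintro w hw _ ⟨v, rfl⟩
    exact ⟨w v, (LinearMap.congr_fun (hw.pow_right N) v).symm⟩
  let xU : Module.End ℝ U := x.restrict (hU x hx)
  let yU : Module.End ℝ U := y.restrict (hU y hy)
  let zU : Module.End ℝ U := z.restrict (hU z (Commute.refl z))
  have hfin : FiniteDimensional ℝ (LinearMap.ker zU) := by
    let j : LinearMap.ker zU →ₗ[ℝ] K :=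
      (U.subtype ∘ₗ (LinearMap.ker zU).subtype).codRestrict K fun u =>
        congrArg Subtype.val (LinearMap.mem_ker.1 u.2)
    exact FiniteDimensional.of_injective j fun a b h =>
      Subtype.ext (Subtype.ext (congrArg (Subtype.val : K → V) h))
  have hinj : ∀ u ∈ U, z u = 0 → u = 0 := by
    intro u hu hzu
    have := eq_zero_of_commutator xU yU zU
      (LinearMap.ext fun v => Subtype.ext (LinearMap.congr_fun hxy v))
      (LinearMap.ext fun v => Subtype.ext (LinearMap.congr_fun hx v))
      (LinearMap.ext fun v => Subtype.ext (LinearMap.congr_fun hy v))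
      (fun w hw => by
        have hw' : z w = 0 := congrArg Subtype.val hw
        have h1 : (⟨w, hw'⟩ : K) ∈ (f (N + 1)).ofDual := by
          rw [← hN (N + 1) (by omega)]
          exact w.2
        obtain ⟨v, hv⟩ := h1
        exact ⟨⟨(z ^ N) v, v, rfl⟩, Subtype.ext (by
          rw [pow_succ'] at hv
          exact hv)⟩)
      (u := ⟨u, hu⟩) (Subtype.ext hzu)
    exact congrArg Subtype.val this
  have hpow : ∀ n : ℕ, ∀ u ∈ U, (z ^ n) u = 0 → u = 0 := by
    intro n
    induction n with
    | zero => intro u _ h; simpa using h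
    | succ n ih =>
      intro u hu h
      rw [pow_succ] at h
      exact hinj u hu (ih (z u) (hU z (Commute.refl z) u hu) h)
  have hzN : ∀ v, (z ^ N) v = 0 := fun v => by
    obtain ⟨n, hn⟩ := hnil ((z ^ N) v)
    exact hpow n _ ⟨v, rfl⟩ hn
  have hker : ∀ n : ℕ, FiniteDimensional ℝ (LinearMap.ker (z ^ n)) := by
    intro n
    induction n with
    | zero =>
      rw [pow_zero]
      have : LinearMap.ker (1 : Module.End ℝ V) = ⊥ := LinearMap.ker_id
      rw [this]
      infer_instance
    | succ n ih =>
      refine Module.Finite.iff_fg.2 (Submodule.fg_of_fg_map_of_fg_inf_ker z ?_ ?_)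
      · refine Module.Finite.iff_fg.1
          (Submodule.finiteDimensional_of_le (S₂ := LinearMap.ker (z ^ n)) ?_)
        rintro _ ⟨v, hv, rfl⟩
        rw [SetLike.mem_coe, LinearMap.mem_ker, pow_succ] at hv
        exact hv
      · exact Module.Finite.iff_fg.1 (Submodule.finiteDimensional_of_le (S₂ := K) inf_le_right)
  have := hker N
  have htop : LinearMap.ker (z ^ N) = ⊤ := eq_top_iff.2 fun v _ => hzN v
  rw [htop] at this
  exact Module.finite_def.2 (Module.Finite.iff_fg.1 this)

end Commutator

/-! ### Finite dimensionality of transitive nondegenerate graded `CR` algebras -/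

namespace LieGrading

variable {A : Type*} [LieRing A] [LieAlgebra ℝ A]

/-- The sum of the components of degree less than `n`. -/
def below (S : LieGrading A) (n : ℤ) : Submodule ℝ A := ⨆ p : {p : ℤ // p < n}, S.deg p

theorem mem_below (S : LieGrading A) {p n : ℤ} (hp : p < n) {x : A} (hx : x ∈ S.deg p) :
    x ∈ S.below n :=
  Submodule.mem_iSup_of_mem (p := fun p : {p : ℤ // p < n} => S.deg p) ⟨p, hp⟩ hx

theorem below_le (S : LieGrading A) {n : ℤ} {U : Submodule ℝ A}
    (h : ∀ p < n, S.deg p ≤ U) : S.below n ≤ U :=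
  iSup_le fun p => h p p.2

theorem lie_mem_below (S : LieGrading A) {p n m : ℤ} (hpn : p + n ≤ m) {w x : A}
    (hw : w ∈ S.deg p) (hx : x ∈ S.below n) : ⁅w, x⁆ ∈ S.below m := by
  have : S.below n ≤ (S.below m).comap (LieAlgebra.ad ℝ A w : A →ₗ[ℝ] A) :=
    S.below_le fun q hq y hy => S.mem_below (by omega) (S.lie_mem hw hy)
  exact this hx

/-- The centralizer of a subspace. -/
def ann (B : Submodule ℝ A) : Submodule ℝ A where
  carrier := {v | ∀ b ∈ B, ⁅b, v⁆ = 0}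
  zero_mem' := fun b _ => lie_zero b
  add_mem' := fun hv hw b hb => by rw [lie_add, hv b hb, hw b hb, add_zero]
  smul_mem' := fun t v hv b hb => by rw [lie_smul, hv b hb, smul_zero]

theorem ann_sup_span {B : Submodule ℝ A} {z v : A} (hv : v ∈ ann B) (hz : ⁅z, v⁆ = 0) :
    v ∈ ann (B ⊔ Submodule.span ℝ {z}) := by
  intro b hb
  obtain ⟨c, hc, d, hd, rfl⟩ := Submodule.mem_sup.1 hb
  obtain ⟨t, rfl⟩ := Submodule.mem_span_singleton.1 hd
  rw [add_lie, hv c hc, smul_lie, hz, smul_zero, add_zero]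

/-- Finite dimensionality of centralizers descends along the removal of one bracket `[x, y]`. -/
theorem finiteDimensional_ann (S : LieGrading A) {N : ℤ} (hN : ∀ p ≤ N, S.deg p = ⊥) {n : ℤ}
    (hn : n < 0) {B : Submodule ℝ A} (hB : S.below (n - 1) ≤ B) (hB' : B ≤ S.below n)
    {x y : A} (hx : x ∈ S.deg (-1)) (hy : y ∈ S.deg n)
    (h : FiniteDimensional ℝ (ann (B ⊔ Submodule.span ℝ {⁅x, y⁆}))) :
    FiniteDimensional ℝ (ann B) := by
  have hz : ⁅x, y⁆ ∈ S.deg (-1 + n) := S.lie_mem hx hy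
  have hstab : ∀ {r : ℤ}, r < 0 → ∀ w ∈ S.deg r, ∀ v ∈ ann B, ⁅w, v⁆ ∈ ann B := by
    intro r hr w hw v hv b hb
    have h1 : ⁅w, b⁆ ∈ B := hB (S.lie_mem_below (by omega) hw (hB' hb))
    rw [leibniz_lie, hv b hb, lie_zero, add_zero, ← lie_skew b w, neg_lie, hv _ h1, neg_zero]
  have hcomm : ∀ {r : ℤ}, r < 0 → ∀ w ∈ S.deg r, ∀ v ∈ ann B, ⁅w, ⁅⁅x, y⁆, v⁆⁆ = ⁅⁅x, y⁆, ⁅w, v⁆⁆ := by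
    intro r hr w hw v hv
    have h1 : ⁅w, ⁅x, y⁆⁆ ∈ B := hB (S.mem_below (by omega) (S.lie_mem hw hz))
    rw [leibniz_lie, hv _ h1, zero_add]
  let op : ∀ {r : ℤ}, r < 0 → ∀ w ∈ S.deg r, Module.End ℝ (ann B) := fun hr w hw =>
    (LieAlgebra.ad ℝ A w : A →ₗ[ℝ] A).restrict (hstab hr w hw)
  have hpow : ∀ (k : ℕ) (v : ann B), (((op (by omega) ⁅x, y⁆ hz) ^ k) v : A) =
      ((LieAlgebra.ad ℝ A ⁅x, y⁆ : Module.End ℝ A) ^ k) v := by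
    intro k
    induction k with
    | zero => intro v; simp
    | succ k ih => intro v; rw [pow_succ, pow_succ]; exact ih _
  have hnil : ∀ v : A, ∃ k : ℕ, ((LieAlgebra.ad ℝ A ⁅x, y⁆ : Module.End ℝ A) ^ k) v = 0 := by
    intro v
    have hv : v ∈ ⨆ p, S.deg p := iSup_deg S.isInternal ▸ Submodule.mem_top
    induction hv using Submodule.iSup_induction' with
    | mem p v hv =>
      have hk : ∀ k : ℕ, ((LieAlgebra.ad ℝ A ⁅x, y⁆ : Module.End ℝ A) ^ k) v ∈
          S.deg (p + k * (-1 + n)) := by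
        intro k
        induction k with
        | zero => simpa using hv
        | succ k ih =>
          rw [pow_succ']
          have := S.lie_mem hz ih
          rw [show -1 + n + (p + k * (-1 + n)) = p + ((k + 1 : ℕ) : ℤ) * (-1 + n) by
            push_cast; ring] at this
          exact this
      refine ⟨(p - N).toNat, ?_⟩
      have := hk (p - N).toNat
      rw [hN] at this
      · exact this
      · have : p - N ≤ ((p - N).toNat : ℤ) := Int.self_le_toNat _
        nlinarith [Int.natCast_nonneg (p - N).toNat]
    | zero => exact ⟨0, rfl⟩
    | add v w _ _ hv hw =>
      obtain ⟨k, hk⟩ := hv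
      obtain ⟨j, hj⟩ := hw
      refine ⟨k + j, ?_⟩
      rw [map_add, pow_add, Module.End.mul_apply, Module.End.mul_apply, hj, map_zero, add_zero,
        ← Module.End.mul_apply, ← pow_add, add_comm, pow_add, Module.End.mul_apply, hk, map_zero]
  have : FiniteDimensional ℝ (LinearMap.ker (op (by omega) ⁅x, y⁆ hz)) := by
    let j : LinearMap.ker (op (by omega) ⁅x, y⁆ hz) →ₗ[ℝ]
        ann (B ⊔ Submodule.span ℝ {⁅x, y⁆}) :=
      ((ann B).subtype ∘ₗ (LinearMap.ker (op (by omega) ⁅x, y⁆ hz)).subtype).codRestrict _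
        fun u => ann_sup_span u.1.2 (congrArg Subtype.val (LinearMap.mem_ker.1 u.2))
    exact FiniteDimensional.of_injective j fun a b h =>
      Subtype.ext (Subtype.ext (congrArg
        (Subtype.val : ann (B ⊔ Submodule.span ℝ {⁅x, y⁆}) → A) h))
  refine finiteDimensional_of_commutator (op (by norm_num) x hx) (op hn y hy)
    (op (by omega) ⁅x, y⁆ hz) ?_ ?_ ?_ ?_
  · exact LinearMap.ext fun v => Subtype.ext (lie_lie x y (v : A)).symm
  · exact LinearMap.ext fun v => Subtype.ext (hcomm (by norm_num) x hx v v.2)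
  · exact LinearMap.ext fun v => Subtype.ext (hcomm hn y hy v v.2)
  · intro v
    obtain ⟨k, hk⟩ := hnil v
    exact ⟨k, Subtype.ext ((hpow k v).trans hk)⟩

/-- A fundamental graded Lie algebra, bounded below and with finite dimensional components of
negative degree, is finite dimensional if the centralizer of its part of degree `≤ -2` is. -/
theorem finiteDimensional_of_ann (S : LieGrading A) (hF : S.IsFundamental) {N : ℤ}
    (hN : ∀ p ≤ N, S.deg p = ⊥) (hfin : ∀ p < 0, FiniteDimensional ℝ (S.deg p))
    (h : FiniteDimensional ℝ (ann (S.below (-1)))) : FiniteDimensional ℝ A := by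
  classical
  have hstep : ∀ n : ℤ, n < 0 → FiniteDimensional ℝ (ann (S.below n)) →
      FiniteDimensional ℝ (ann (S.below (n - 1))) := by
    intro n hn hfd
    have hspan : S.deg (n - 1) = _ := hF n hn
    have hfg := Module.Finite.iff_fg.1 (hfin (n - 1) (by omega))
    rw [hspan, Submodule.fg_span_iff_fg_span_finset_subset] at hfg
    obtain ⟨F, hF, hFs⟩ := hfg
    rw [← hspan] at hFs
    have hle : S.below (n - 1) ≤ S.below n := S.below_le fun p hp y hy => S.mem_below (by omega) hy
    have key : ∀ F : Finset A,
        (F : Set A) ⊆ {z | ∃ x ∈ S.deg (-1), ∃ y ∈ S.deg n, ⁅x, y⁆ = z} →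
        FiniteDimensional ℝ (ann (S.below (n - 1) ⊔ Submodule.span ℝ (F : Set A))) →
        FiniteDimensional ℝ (ann (S.below (n - 1))) := by
      intro F
      induction F using Finset.induction_on with
      | empty => intro _ h; rwa [Finset.coe_empty, Submodule.span_empty, sup_bot_eq] at h
      | insert z F hz ih =>
        intro hF h
        rw [Finset.coe_insert, Set.insert_subset_iff] at hF
        obtain ⟨⟨x, hx, y, hy, rfl⟩, hF⟩ := hF
        refine ih hF (S.finiteDimensional_ann hN hn le_sup_left (sup_le hle ?_) hx hy ?_)
        · refine Submodule.span_le.2 fun w hw => ?_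
          obtain ⟨x, hx, y, hy, rfl⟩ := hF hw
          exact S.mem_below (by omega) (S.lie_mem hx hy)
        · rwa [Finset.coe_insert, Submodule.span_insert, sup_comm (Submodule.span ℝ _),
            ← sup_assoc] at h
    refine key F hF ?_
    have hsup : S.below (n - 1) ⊔ S.deg (n - 1) = S.below n := by
      refine le_antisymm (sup_le hle fun y hy => S.mem_below (by omega) hy)
        (S.below_le fun p hp => ?_)
      rcases (show p < n - 1 ∨ p = n - 1 by omega) with hp | rfl
      · exact le_trans (fun y hy => S.mem_below hp hy) le_sup_left
      · exact le_sup_right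
    rwa [← hFs, hsup]
  have hall : ∀ k : ℕ, FiniteDimensional ℝ (ann (S.below (-1 - k))) := by
    intro k
    induction k with
    | zero => simpa using h
    | succ k ih =>
      have := hstep _ (by omega) ih
      rwa [show (-1 - (k : ℤ) - 1) = -1 - ((k + 1 : ℕ) : ℤ) by push_cast; ring] at this
  have htop : ann (S.below (-1 - ((-N).toNat : ℤ))) = ⊤ := by
    have : S.below (-1 - ((-N).toNat : ℤ)) = ⊥ :=
      le_bot_iff.1 (S.below_le fun p hp => (hN p (by omega)).le)
    rw [this, eq_top_iff]
    intro v _ b hb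
    rw [(Submodule.mem_bot ℝ).1 hb, zero_lie]
  have := hall (-N).toNat
  rw [htop] at this
  exact Module.finite_def.2 (Module.Finite.iff_fg.1 this)

end LieGrading

/-- In a transitive nondegenerate graded `CR` algebra no nonzero element of positive degree
commutes with the part of degree `≤ -2`. In degree `1` the reason is that such an element `T`
yields a `ℂ`-bilinear symmetric map `(x, y) ↦ [[T, x], y]` on the component of degree `-1`, whose
values are skew for the Levi form and therefore in its kernel. -/
theorem CRAlgebra.eq_zero_of_mem_ann {A : Type*} [LieRing A] [LieAlgebra ℝ A] (S : CRAlgebra A)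
    (hT : S.IsTransitive) (hN : S.IsNondegenerate) :
    ∀ k : ℕ, ∀ T ∈ S.deg (k + 1), T ∈ LieGrading.ann (S.below (-1)) → T = 0 := by
  intro k
  induction k with
  | zero =>
    intro T hT1 hTa
    have hTa : ∀ w ∈ S.deg (-2), ⁅T, w⁆ = 0 := fun w hw => by
      rw [← lie_skew, hTa w (S.mem_below (by norm_num) hw), neg_zero]
    rw [Nat.cast_zero, zero_add] at hT1
    have hmem : ∀ {x}, x ∈ S.deg (-1) → ⁅T, x⁆ ∈ S.deg 0 := fun hx => S.lie_mem hT1 hx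
    have hmem2 : ∀ {x y}, x ∈ S.deg (-1) → y ∈ S.deg (-1) → ⁅⁅T, x⁆, y⁆ ∈ S.deg (-1) :=
      fun hx hy => by simpa using S.lie_mem (hmem hx) hy
    have hlie : ∀ {x y}, x ∈ S.deg (-1) → y ∈ S.deg (-1) → ⁅x, y⁆ ∈ S.deg (-2) :=
      fun hx hy => S.lie_mem hx hy
    have hsymm : ∀ {x y}, x ∈ S.deg (-1) → y ∈ S.deg (-1) → ⁅⁅T, x⁆, y⁆ = ⁅⁅T, y⁆, x⁆ := by
      intro x y hx hy
      have := hTa _ (hlie hx hy)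
      rw [leibniz_lie, ← lie_skew x ⁅T, y⁆, ← sub_eq_add_neg, sub_eq_zero] at this
      exact this
    have hskew : ∀ {x y z}, x ∈ S.deg (-1) → y ∈ S.deg (-1) → z ∈ S.deg (-1) →
        ⁅⁅⁅T, x⁆, y⁆, z⁆ + ⁅y, ⁅⁅T, x⁆, z⁆⁆ = 0 := by
      intro x y z hx hy hz
      have h2 : ⁅x, ⁅y, z⁆⁆ ∈ S.below (-1) :=
        S.mem_below (by norm_num) (S.lie_mem hx (hlie hy hz))
      have h3 : ⁅T, ⁅x, ⁅y, z⁆⁆⁆ = 0 := by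
        rw [← lie_skew, ‹T ∈ LieGrading.ann _› _ h2, neg_zero]
      rw [leibniz_lie, hTa _ (hlie hy hz), lie_zero, add_zero, leibniz_lie] at h3
      exact h3
    have hJ : ∀ (x : A) (hx : x ∈ S.deg (-1)) (y : S.deg (-1)),
        ⁅⁅T, x⁆, (S.J y : A)⁆ = S.J ⟨⁅⁅T, x⁆, y⁆, hmem2 hx y.2⟩ := fun x hx y =>
      S.isCR.lie_zero _ (hmem hx) y ⟨_, hmem2 hx y.2⟩ rfl
    refine hT.eq_zero (p := 1) (by norm_num) hT1 fun x hx => ?_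
    rw [← lie_skew, neg_eq_zero]
    refine hT.eq_zero le_rfl (hmem hx) fun y hy => ?_
    rw [← lie_skew, neg_eq_zero]
    refine hN.eq_zero (hmem2 hx hy) fun z hz => ?_
    rw [← lie_skew, neg_eq_zero]
    -- with `u = [[T, x], y]` the skewness for `(x, y)` and for `(J x, y)` gives `[J u, J z] = 0`
    let x' : S.deg (-1) := ⟨x, hx⟩
    let y' : S.deg (-1) := ⟨y, hy⟩
    let z' : S.deg (-1) := ⟨z, hz⟩
    let u : S.deg (-1) := ⟨⁅⁅T, x⁆, y⁆, hmem2 hx hy⟩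
    let v : S.deg (-1) := ⟨⁅⁅T, x⁆, z⁆, hmem2 hx hz⟩
    have eu : ⁅⁅T, (S.J x' : A)⁆, y⁆ = S.J u := by
      rw [hsymm (S.J x').2 hy, hJ y hy x']
      exact congrArg (fun w : S.deg (-1) => (S.J w : A)) (Subtype.ext (hsymm hy hx))
    have ev : ⁅⁅T, (S.J x' : A)⁆, (S.J z' : A)⁆ = -v := by
      rw [hsymm (S.J x').2 (S.J z').2, hJ _ (S.J z').2 x']
      have : (⟨⁅⁅T, (S.J z' : A)⁆, (x' : A)⁆, hmem2 (S.J z').2 x'.2⟩ : S.deg (-1)) = S.J v :=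
        Subtype.ext ((hsymm (S.J z').2 hx).trans (hJ x hx z'))
      rw [this, S.isCR.sq]
      rfl
    have h1 : ⁅(u : A), z⁆ + ⁅y, (v : A)⁆ = 0 := hskew hx hy hz
    have h2 := hskew (S.J x').2 hy (S.J z').2
    rw [eu, ev, S.isCR.lie_J_J, lie_neg, ← sub_eq_add_neg] at h2
    have h3 : (2 : ℝ) • ⁅(u : A), z⁆ = 0 := by
      rw [two_smul]
      calc ⁅(u : A), z⁆ + ⁅(u : A), z⁆
          = (⁅(u : A), z⁆ + ⁅y, (v : A)⁆) + (⁅(u : A), (z' : A)⁆ - ⁅y, (v : A)⁆) := by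
            change _ = _ + (⁅(u : A), z⁆ - _); abel
        _ = 0 := by rw [h1, h2, add_zero]
    exact (smul_eq_zero.1 h3).resolve_left two_ne_zero
  | succ k ih =>
    intro T hT1 hTa
    refine hT.eq_zero (by positivity) hT1 fun x hx => ?_
    refine ih _ ?_ fun b hb => ?_
    · have := S.lie_mem hx hT1
      rwa [show -1 + (((k + 1 : ℕ) : ℤ) + 1) = (k : ℤ) + 1 by push_cast; ring] at this
    · have h1 : ⁅x, b⁆ ∈ S.below (-1) := S.lie_mem_below (by norm_num) hx hb
      rw [leibniz_lie, hTa b hb, lie_zero, add_zero, ← lie_skew b x, neg_lie, hTa _ h1, neg_zero]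

/-- A fundamental, transitive, nondegenerate graded `CR` algebra whose negative part is finite
dimensional is finite dimensional. -/
theorem CRAlgebra.finiteDimensional {A : Type*} [LieRing A] [LieAlgebra ℝ A] (S : CRAlgebra A)
    (hF : S.IsFundamental) (hT : S.IsTransitive) (hnd : S.IsNondegenerate) {N : ℤ}
    (hN : ∀ p ≤ N, S.deg p = ⊥) (hfin : ∀ p < 0, FiniteDimensional ℝ (S.deg p)) :
    FiniteDimensional ℝ A := by
  refine S.finiteDimensional_of_ann hF hN hfin ?_
  have h0 : FiniteDimensional ℝ (S.deg 0) := by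
    have := hfin (-1) (by norm_num)
    let j : S.deg 0 →ₗ[ℝ] S.deg (-1) →ₗ[ℝ] S.deg (-1) :=
      LinearMap.mk₂ ℝ (fun a x => ⟨⁅(a : A), (x : A)⁆, by simpa using S.lie_mem a.2 x.2⟩)
        (fun a b x => Subtype.ext (add_lie _ _ _)) (fun t a x => Subtype.ext (smul_lie _ _ _))
        (fun a x y => Subtype.ext (lie_add _ _ _)) (fun t a x => Subtype.ext (lie_smul _ _ _))
    refine FiniteDimensional.of_injective j fun a b hab => Subtype.ext ?_
    exact hT.eq le_rfl a.2 b.2 fun x hx =>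
      congrArg Subtype.val (LinearMap.congr_fun hab (⟨x, hx⟩ : S.deg (-1)))
  -- the centralizer is a graded subspace, hence contained in the part of degree in `(N, 0]`
  have hle : LieGrading.ann (S.below (-1)) ≤ ⨆ p ∈ Finset.Ioc N 0, S.deg p := by
    intro v hv
    have hcomp : ∀ p, gproj S.isInternal p v ∈ LieGrading.ann (S.below (-1)) := by
      intro p b hb
      have : S.below (-1) ≤ LinearMap.ker
          ((LieAlgebra.ad ℝ A (gproj S.isInternal p v) : A →ₗ[ℝ] A)) :=
        S.below_le fun q hq y hy => by
          rw [LinearMap.mem_ker]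
          change ⁅gproj S.isInternal p v, y⁆ = 0
          rw [← lie_skew, ← S.lie_gproj hy, hv y (S.mem_below hq hy), map_zero, neg_zero]
      rw [← lie_skew]
      exact neg_eq_zero.2 (this hb)
    obtain ⟨F, hF⟩ := exists_finset_sum_gproj S.isInternal v
    rw [hF]
    refine Submodule.sum_mem _ fun p _ => ?_
    by_cases hp : p ∈ Finset.Ioc N 0
    · exact Submodule.mem_iSup_of_mem p (Submodule.mem_iSup_of_mem hp (gproj_mem _ p v))
    · have : gproj S.isInternal p v = 0 := by
        rw [Finset.mem_Ioc, not_and_or, not_lt, not_le] at hp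
        rcases hp with hp | hp
        · have := gproj_mem S.isInternal p v
          rwa [hN p hp, Submodule.mem_bot] at this
        · obtain ⟨k, rfl⟩ : ∃ k : ℕ, p = k + 1 := ⟨(p - 1).toNat, by omega⟩
          exact S.eq_zero_of_mem_ann hT hnd k _ (gproj_mem _ _ v) (hcomp _)
      rw [this]
      exact Submodule.zero_mem _
  have hfd : FiniteDimensional ℝ (⨆ p ∈ Finset.Ioc N 0, S.deg p : Submodule ℝ A) := by
    have : ∀ p ∈ Finset.Ioc N 0, (S.deg p).FG := fun p hp => by
      rcases (Finset.mem_Ioc.1 hp).2.lt_or_eq with h | rfl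
      · exact Module.Finite.iff_fg.1 (hfin p h)
      · exact Module.Finite.iff_fg.1 h0
    exact Module.Finite.iff_fg.2 (Submodule.fg_biSup _ _ this)
  exact Submodule.finiteDimensional_of_le hle

/-! ### Semisimple ideals and the Killing form -/

section Semisimple

variable {L : Type*} [LieRing L] [LieAlgebra ℝ L]

theorem lie_eq_zero_of_disjoint {I J : LieIdeal ℝ L} (h : Disjoint I J) {x y : L} (hx : x ∈ I)
    (hy : y ∈ J) : ⁅x, y⁆ = 0 := by
  have : ⁅x, y⁆ ∈ I ⊓ J := ⟨lie_mem_left ℝ L I x y hx, lie_mem_right ℝ L J x y hy⟩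
  rwa [h.eq_bot, LieSubmodule.mem_bot] at this

theorem isKilling_iff : LieAlgebra.IsKilling ℝ L ↔
    ∀ x : L, (∀ y, killingForm ℝ L x y = 0) → x = 0 := by
  constructor
  · intro _ x hx
    have : x ∈ LinearMap.ker (killingForm ℝ L) := LinearMap.ext hx
    rwa [LieAlgebra.IsKilling.ker_killingForm_eq_bot, Submodule.mem_bot] at this
  · intro h
    refine ⟨(LieSubmodule.eq_bot_iff _).2 fun x hx => h x fun y => ?_⟩
    rw [LieModule.traceForm_comm]
    exact (LieIdeal.mem_killingCompl ℝ L ⊤).1 hx y (LieSubmodule.mem_top y)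

theorem killingForm_eq_zero_of_disjoint {I J : LieIdeal ℝ L} (h : Disjoint I J) {x y : L}
    (hx : x ∈ I) (hy : y ∈ J) : killingForm ℝ L x y = 0 := by
  rw [killingForm_apply_apply]
  have : (LieAlgebra.ad ℝ L x ∘ₗ LieAlgebra.ad ℝ L y : L →ₗ[ℝ] L) = 0 :=
    LinearMap.ext fun z => lie_eq_zero_of_disjoint h hx (lie_mem_left ℝ L J y z hy)
  rw [this, map_zero]

variable [FiniteDimensional ℝ L]

theorem isSemisimple_iff_isKilling : LieAlgebra.IsSemisimple ℝ L ↔ LieAlgebra.IsKilling ℝ L :=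
  ⟨fun _ => inferInstance, fun _ => inferInstance⟩

/-- An ideal is semisimple if and only if the Killing form of the ambient algebra is nondegenerate
on it. -/
theorem isSemisimple_ideal_iff (I : LieIdeal ℝ L) : LieAlgebra.IsSemisimple ℝ I ↔
    ∀ x ∈ I, (∀ y ∈ I, killingForm ℝ L x y = 0) → x = 0 := by
  rw [isSemisimple_iff_isKilling, isKilling_iff, I.killingForm_eq]
  exact ⟨fun h x hx hxy => congrArg Subtype.val (h ⟨x, hx⟩ fun y => hxy y y.2),
    fun h x hx => Subtype.ext (h x x.2 fun y hy => hx ⟨y, hy⟩)⟩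

theorem isSemisimple_ideal [LieAlgebra.IsSemisimple ℝ L] (I : LieIdeal ℝ L) :
    LieAlgebra.IsSemisimple ℝ I := by
  rw [isSemisimple_ideal_iff]
  intro x hx hxy
  have h : x ∈ I ⊓ LieIdeal.killingCompl ℝ L I := ⟨hx, fun y hy => by
    rw [LieModule.traceForm_comm]; exact hxy y hy⟩
  rwa [(LieIdeal.isCompl_killingCompl I).disjoint.eq_bot, LieSubmodule.mem_bot] at h

theorem isCompl_killingCompl_of_isSemisimple (I : LieIdeal ℝ L)
    (h : LieAlgebra.IsSemisimple ℝ I) : IsCompl I (LieIdeal.killingCompl ℝ L I) := by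
  rw [isSemisimple_ideal_iff] at h
  have hd : Disjoint I (LieIdeal.killingCompl ℝ L I) := by
    rw [disjoint_iff, LieSubmodule.eq_bot_iff]
    rintro x ⟨hx, hx'⟩
    refine h x hx fun y hy => ?_
    rw [LieModule.traceForm_comm]
    exact hx' y hy
  rwa [← LieSubmodule.isCompl_toSubmodule, I.toSubmodule_killingCompl,
    LinearMap.BilinForm.isCompl_orthogonal_iff_disjoint (LieModule.traceForm_isSymm ℝ L L).isRefl,
    ← I.toSubmodule_killingCompl, LieSubmodule.disjoint_toSubmodule]

/-- The sum of two semisimple ideals with trivial intersection is semisimple. -/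
theorem isSemisimple_sup {I J : LieIdeal ℝ L} (h : Disjoint I J)
    (hI : LieAlgebra.IsSemisimple ℝ I) (hJ : LieAlgebra.IsSemisimple ℝ J) :
    LieAlgebra.IsSemisimple ℝ ↥(I ⊔ J) := by
  rw [isSemisimple_ideal_iff] at *
  intro x hx hxy
  obtain ⟨a, ha, b, hb, rfl⟩ := LieSubmodule.mem_sup _ _ x |>.1 hx
  have h1 : a = 0 := hI a ha fun y hy => by
    have := hxy y (le_sup_left (a := I) (b := J) hy)
    rwa [map_add, LinearMap.add_apply, killingForm_eq_zero_of_disjoint h.symm hb hy,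
      add_zero] at this
  have h2 : b = 0 := hJ b hb fun y hy => by
    have := hxy y (le_sup_right (a := I) (b := J) hy)
    rwa [map_add, LinearMap.add_apply, killingForm_eq_zero_of_disjoint h ha hy,
      zero_add] at this
  rw [h1, h2, add_zero]

variable (L) in
/-- A finite dimensional Lie algebra is the direct sum of a semisimple ideal and of an ideal that
contains no semisimple ideal. -/
theorem exists_isCompl_isSemisimple_isProper : ∃ I J : LieIdeal ℝ L, IsCompl I J ∧
    LieAlgebra.IsSemisimple ℝ I ∧ IsProper J := by
  have hne : {I : LieIdeal ℝ L | LieAlgebra.IsSemisimple ℝ I}.Nonempty :=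
    ⟨⊥, (isSemisimple_ideal_iff _).2 fun x hx _ => (LieSubmodule.mem_bot x).1 hx⟩
  obtain ⟨I, hI, hmax⟩ := wellFounded_gt.has_min _ hne
  have hc := isCompl_killingCompl_of_isSemisimple I hI
  refine ⟨I, LieIdeal.killingCompl ℝ L I, hc, hI, ?_⟩
  generalize LieIdeal.killingCompl ℝ L I = J at hc ⊢
  intro K hK
  -- an ideal of `J` is an ideal of `L`
  let K' : LieIdeal ℝ L :=
    { K.toSubmodule.map J.toSubmodule.subtype with
      lie_mem := by
        rintro x _ ⟨k, hk, rfl⟩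
        obtain ⟨a, ha, b, hb, rfl⟩ := (LieSubmodule.mem_sup I J x).1
          (hc.sup_eq_top ▸ LieSubmodule.mem_top x)
        refine ⟨⁅(⟨b, hb⟩ : J), k⁆, K.lie_mem hk, ?_⟩
        have : ⁅a, (k : L)⁆ = 0 := lie_eq_zero_of_disjoint hc.disjoint ha k.2
        change ⁅b, (k : L)⁆ = ⁅a + b, (k : L)⁆
        rw [add_lie, this, zero_add] }
  have hK'J : K' ≤ J := by
    rintro _ ⟨k, hk, rfl⟩
    exact k.2
  have hK' : LieAlgebra.IsSemisimple ℝ K' := by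
    rw [isSemisimple_ideal_iff, J.killingForm_eq] at hK
    rw [isSemisimple_ideal_iff]
    rintro _ ⟨k, hk, rfl⟩ h
    exact congrArg Subtype.val (hK k hk fun y hy => h y ⟨y, hy, rfl⟩)
  have hle : K' ≤ I := by
    by_contra hn
    exact hmax _ (isSemisimple_sup (hc.disjoint.mono_right hK'J) hI hK')
      (lt_of_le_of_ne le_sup_left fun e => hn (e ▸ le_sup_right))
  rw [LieSubmodule.eq_bot_iff]
  intro k hk
  have : (k : L) ∈ I ⊓ J := ⟨hle ⟨k, hk, rfl⟩, k.2⟩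
  rw [hc.disjoint.eq_bot, LieSubmodule.mem_bot] at this
  exact Subtype.ext this

/-- Every ideal of a semisimple Lie algebra is perfect. -/
theorem ideal_le_lie_self [LieAlgebra.IsSemisimple ℝ L] (I : LieIdeal ℝ L) : I ≤ ⁅I, I⁆ := by
  have hc := LieIdeal.isCompl_killingCompl (K := ℝ) ⁅I, I⁆
  intro x hx
  obtain ⟨a, ha, b, hb, rfl⟩ := (LieSubmodule.mem_sup _ _ x).1
    (hc.sup_eq_top ▸ LieSubmodule.mem_top x)
  have hbI : b ∈ I := (add_mem_cancel_left (LieSubmodule.lie_le_left I I ha)).1 hx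
  have h0 : b = 0 := by
    refine isKilling_iff.1 inferInstance b fun y => ?_
    have hI := LieIdeal.isCompl_killingCompl (K := ℝ) I
    -- `b` is orthogonal to `[I, I]` and commutes with `I`, hence is central
    have hcomm : ∀ z ∈ I, ⁅b, z⁆ = 0 := fun z hz => by
      have : ⁅b, z⁆ ∈ ⁅I, I⁆ ⊓ LieIdeal.killingCompl ℝ L ⁅I, I⁆ :=
        ⟨LieSubmodule.lie_mem_lie hbI hz, lie_mem_left ℝ L _ b z hb⟩
      rwa [hc.disjoint.eq_bot, LieSubmodule.mem_bot] at this
    have : LieAlgebra.ad ℝ L b = 0 := by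
      refine LinearMap.ext fun z => ?_
      obtain ⟨u, hu, v, hv, rfl⟩ := (LieSubmodule.mem_sup _ _ z).1
        (hI.sup_eq_top ▸ LieSubmodule.mem_top z)
      change ⁅b, u + v⁆ = 0
      rw [lie_add, hcomm u hu, lie_eq_zero_of_disjoint hI.disjoint hbI hv, add_zero]
    rw [killingForm_apply_apply, this, LinearMap.zero_comp, map_zero]
  rwa [h0, add_zero]

end Semisimple

/-! ### Complete reducibility with respect to trivial quotients -/

section Weyl

variable {L V : Type*} [LieRing L] [LieAlgebra ℝ L] [FiniteDimensional ℝ L]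
  [LieAlgebra.IsSemisimple ℝ L] [AddCommGroup V] [Module ℝ V] [LieRingModule L V]
  [LieModule ℝ L V] [FiniteDimensional ℝ V]

attribute [local instance 100] LieRing.ofAssociativeRing

/-- The trace form of a faithful representation of a semisimple Lie algebra is nondegenerate. -/
theorem traceForm_nondegenerate [LieModule.IsFaithful ℝ L V] :
    (LieModule.traceForm ℝ L V).Nondegenerate := by
  let N : LieIdeal ℝ L :=
    { LinearMap.ker (LieModule.traceForm ℝ L V) with
      lie_mem := by
        intro x y hy
        refine LinearMap.ext fun z => ?_
        rw [LieModule.traceForm_apply_lie_apply', show LieModule.traceForm ℝ L V y = 0 from hy]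
        simp }
  have hN : LieModule.traceForm ℝ N V = 0 :=
    LinearMap.ext fun x => LinearMap.ext fun y => LinearMap.congr_fun x.2 (y : L)
  have hnil := LieModule.isNilpotent_derivedSeries_of_traceForm_eq_zero hN
  let D := LieAlgebra.derivedSeries ℝ N 1
  have hD : LieRing.IsNilpotent D := by
    rw [LieAlgebra.isNilpotent_iff_forall (R := ℝ)]
    intro x
    obtain ⟨k, hk⟩ := LieModule.isNilpotent_toEnd_of_isNilpotent ℝ D V x
    obtain ⟨k, hk⟩ := LieAlgebra.ad_nilpotent_of_nilpotent (R := ℝ) ⟨k, hk⟩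
    have hpow : ∀ (k : ℕ) (y : D), LieModule.toEnd ℝ D V ((LieAlgebra.ad ℝ D x ^ k) y) =
        (LieAlgebra.ad ℝ (Module.End ℝ V) (LieModule.toEnd ℝ D V x) ^ k)
          (LieModule.toEnd ℝ D V y) := by
      intro k
      induction k with
      | zero => intro y; simp
      | succ k ih =>
        intro y
        rw [pow_succ, pow_succ, Module.End.mul_apply, Module.End.mul_apply, ih,
          LieAlgebra.ad_apply, LieHom.map_lie, LieAlgebra.ad_apply]
    refine ⟨k, LinearMap.ext fun y => Subtype.ext (Subtype.ext ?_)⟩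
    refine LieModule.ext_of_isFaithful (R := ℝ) (M := V) fun v => ?_
    have := LinearMap.congr_fun ((hpow k y).trans (by rw [hk])) v
    exact this.trans (zero_lie v).symm
  have hDs : LieAlgebra.IsSolvable D := inferInstance
  have hNs : LieAlgebra.IsSolvable N := by
    obtain ⟨k, hk⟩ := LieAlgebra.IsSolvable.solvable ℝ D
    rw [LieIdeal.derivedSeries_eq_bot_iff] at hk
    refine LieAlgebra.IsSolvable.mk (R := ℝ) (k := k + 1) ?_
    rw [LieAlgebra.derivedSeries_def, LieAlgebra.derivedSeriesOfIdeal_add]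
    exact hk
  have hbot := LieAlgebra.HasTrivialRadical.eq_bot_of_isSolvable (R := ℝ) N
  refine (LieModule.traceForm_isSymm ℝ L V).isRefl.nondegenerate_iff_separatingLeft.mpr ?_
  rw [LinearMap.separatingLeft_iff_ker_eq_bot]
  exact congrArg LieSubmodule.toSubmodule hbot

/-- The Casimir operator of the trace form: a nonzero semisimple Lie algebra acting faithfully has
an intertwining operator with values in `⁅L, V⁆` that is not nilpotent, its trace being `dim L`. -/
theorem exists_casimir_of_isFaithful [LieModule.IsFaithful ℝ L V] [Nontrivial L] :
    ∃ C : Module.End ℝ V, (∀ (x : L) (v : V), ⁅x, C v⁆ = C ⁅x, v⁆) ∧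
      (∀ W : Submodule ℝ V, (∀ (x : L) (v : V), ⁅x, v⁆ ∈ W) → ∀ v, C v ∈ W) ∧ ¬ IsNilpotent C := by
  let B := LieModule.traceForm ℝ L V
  have hB : B.Nondegenerate := traceForm_nondegenerate
  have hs : LinearMap.BilinForm.IsSymm B := ⟨LieModule.traceForm_comm ℝ L V⟩
  let b := Module.finBasis ℝ L
  let b' := LinearMap.BilinForm.dualBasis B hB b
  have hb : LinearMap.BilinForm.dualBasis B hB b' = b := LinearMap.BilinForm.dualBasis_dualBasis hB hs b
  let C : Module.End ℝ V := ∑ i, LieModule.toEnd ℝ L V (b i) * LieModule.toEnd ℝ L V (b' i)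
  have hC : ∀ v, C v = ∑ i, ⁅b i, ⁅b' i, v⁆⁆ := fun v => by
    simp only [C, LinearMap.sum_apply, Module.End.mul_apply, LieModule.toEnd_apply_apply]
  have hrepr : ∀ y : L, y = ∑ j, B y (b' j) • b j := fun y => by
    conv_lhs => rw [← b.sum_repr y]
    refine Finset.sum_congr rfl fun j _ => ?_
    rw [← LinearMap.BilinForm.dualBasis_repr_apply hB b' y j, hb]
  have hrepr' : ∀ y : L, y = ∑ j, B y (b j) • b' j := fun y => by
    conv_lhs => rw [← b'.sum_repr y]
    refine Finset.sum_congr rfl fun j _ => ?_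
    rw [LinearMap.BilinForm.dualBasis_repr_apply hB b y j]
  refine ⟨C, fun x v => ?_, fun W hW v => ?_, fun hn => ?_⟩
  · have h1 : ∑ i, ⁅⁅x, b i⁆, ⁅b' i, v⁆⁆ = ∑ i, ∑ j, B ⁅x, b i⁆ (b' j) • ⁅b j, ⁅b' i, v⁆⁆ := by
      refine Finset.sum_congr rfl fun i _ => ?_
      conv_lhs => rw [hrepr ⁅x, b i⁆]
      rw [sum_lie]
      simp only [smul_lie]
    have h2 : ∑ i, ⁅b i, ⁅⁅x, b' i⁆, v⁆⁆ = ∑ i, ∑ j, B ⁅x, b' i⁆ (b j) • ⁅b i, ⁅b' j, v⁆⁆ := by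
      refine Finset.sum_congr rfl fun i _ => ?_
      conv_lhs => rw [hrepr' ⁅x, b' i⁆]
      rw [sum_lie, lie_sum]
      simp only [smul_lie, lie_smul]
    have h3 : ∑ i, ⁅⁅x, b i⁆, ⁅b' i, v⁆⁆ + ∑ i, ⁅b i, ⁅⁅x, b' i⁆, v⁆⁆ = 0 := by
      rw [h1, h2, Finset.sum_comm, ← Finset.sum_add_distrib]
      refine Finset.sum_eq_zero fun i _ => ?_
      rw [← Finset.sum_add_distrib]
      refine Finset.sum_eq_zero fun j _ => ?_
      have : B ⁅x, b j⁆ (b' i) = -B ⁅x, b' i⁆ (b j) := by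
        rw [LieModule.traceForm_apply_lie_apply' ℝ L V x (b j), LieModule.traceForm_comm]
      rw [this, neg_smul, neg_add_cancel]
    calc ⁅x, C v⁆ = (∑ i, ⁅⁅x, b i⁆, ⁅b' i, v⁆⁆ + ∑ i, ⁅b i, ⁅⁅x, b' i⁆, v⁆⁆)
          + ∑ i, ⁅b i, ⁅b' i, ⁅x, v⁆⁆⁆ := by
          rw [hC, lie_sum, ← Finset.sum_add_distrib, ← Finset.sum_add_distrib]
          refine Finset.sum_congr rfl fun i _ => ?_
          rw [leibniz_lie x (b i), leibniz_lie x (b' i), lie_add, add_assoc]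
      _ = C ⁅x, v⁆ := by rw [h3, zero_add, hC]
  · rw [hC]
    exact W.sum_mem fun i _ => hW _ _
  · have h1 : LinearMap.trace ℝ V C = Module.finrank ℝ L := by
      simp only [C, map_sum]
      have : ∀ i, LinearMap.trace ℝ V (LieModule.toEnd ℝ L V (b i) * LieModule.toEnd ℝ L V (b' i))
          = 1 := fun i => by
        have := LinearMap.BilinForm.apply_dualBasis_right hB hs b i i
        rw [if_pos rfl] at this
        exact this
      simp [this]
    have h2 := (LinearMap.isNilpotent_trace_of_isNilpotent hn).eq_zero
    rw [h1, Nat.cast_eq_zero] at h2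
    exact Module.finrank_pos.ne' h2

/-- A Casimir operator for a nontrivial representation, obtained from the faithful representation
of a complement of the kernel. -/
theorem exists_casimir {x : L} {v : V} (hxv : ⁅x, v⁆ ≠ 0) :
    ∃ C : Module.End ℝ V, (∀ (x : L) (v : V), ⁅x, C v⁆ = C ⁅x, v⁆) ∧
      (∀ W : Submodule ℝ V, (∀ (x : L) (v : V), ⁅x, v⁆ ∈ W) → ∀ v, C v ∈ W) ∧ ¬ IsNilpotent C := by
  let K := LieModule.ker ℝ L V
  have hK : ∀ y ∈ K, ∀ v : V, ⁅y, v⁆ = 0 := fun y hy v =>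
    (LieModule.mem_ker ℝ L V y).1 hy v
  have hc := LieIdeal.isCompl_killingCompl K
  let I := LieIdeal.killingCompl ℝ L K
  have hss : LieAlgebra.IsSemisimple ℝ I := isSemisimple_ideal I
  have hdec : ∀ y : L, ∃ z : I, ∀ v : V, ⁅y, v⁆ = ⁅z, v⁆ := fun y => by
    obtain ⟨a, ha, b, hb, rfl⟩ := (LieSubmodule.mem_sup _ _ y).1
      (hc.sup_eq_top ▸ LieSubmodule.mem_top y)
    refine ⟨⟨b, hb⟩, fun v => ?_⟩
    rw [add_lie, hK a ha, zero_add]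
    rfl
  have hf : LieModule.IsFaithful ℝ I V := by
    rw [LieModule.isFaithful_iff']
    intro z hz
    have : (z : L) ∈ K ⊓ I := ⟨(LieModule.mem_ker ℝ L V z).2 hz, z.2⟩
    rw [hc.disjoint.eq_bot, LieSubmodule.mem_bot] at this
    exact Subtype.ext this
  have hn : Nontrivial I := by
    obtain ⟨z, hz⟩ := hdec x
    refine ⟨z, 0, ?_⟩
    rintro rfl
    exact hxv ((hz v).trans (zero_lie v))
  obtain ⟨C, h1, h2, h3⟩ := exists_casimir_of_isFaithful (L := I) (V := V)
  refine ⟨C, fun y v => ?_, fun W hW => h2 W fun z v => hW z v, h3⟩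
  obtain ⟨z, hz⟩ := hdec y
  rw [hz, hz, h1]

/-- If `L` is semisimple and acts trivially on `V / W`, then every element of `V` is congruent to
an invariant element modulo `W`. -/
theorem exists_invariant_sub_mem {W : Submodule ℝ V} (hW : ∀ (x : L) (v : V), ⁅x, v⁆ ∈ W) (v : V) :
    ∃ w, (∀ x : L, ⁅x, w⁆ = 0) ∧ v - w ∈ W := by
  suffices H : ∀ K : LieSubmodule ℝ L V, ∀ v ∈ K, ∃ w, (∀ x : L, ⁅x, w⁆ = 0) ∧ v - w ∈ W from
    H ⊤ v (LieSubmodule.mem_top v)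
  intro K
  have := LieSubmodule.wellFoundedLT_of_isArtinian ℝ L V
  induction K using WellFoundedLT.induction with
  | ind K ih =>
  intro v hv
  by_cases h : ∀ (x : L) (k : K), ⁅x, k⁆ = 0
  · exact ⟨v, fun x => congrArg Subtype.val (h x ⟨v, hv⟩), by simp⟩
  push Not at h
  obtain ⟨x, k, hxk⟩ := h
  obtain ⟨C, h1, h2, h3⟩ := exists_casimir hxk
  obtain ⟨n, hn, hn1⟩ := (C.eventually_isCompl_ker_pow_range_pow.and
    (Filter.eventually_ge_atTop 1)).exists
  have hcomm : ∀ (m : ℕ) (x : L) (k : K), ⁅x, (C ^ m) k⁆ = (C ^ m) ⁅x, k⁆ := by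
    intro m
    induction m with
    | zero => intro x k; simp
    | succ m ih => intro x k; rw [pow_succ, Module.End.mul_apply, ih, h1]; rfl
  -- the Fitting null component of the Casimir operator is a proper submodule
  let K' : LieSubmodule ℝ L V :=
    { (LinearMap.ker (C ^ n)).map K.toSubmodule.subtype with
      lie_mem := by
        rintro x _ ⟨k, hk, rfl⟩
        have h0 : (C ^ n) k = 0 := hk
        let k' : K := k
        have h1 : (C ^ n) ⁅x, k'⁆ = 0 := by
          rw [← hcomm, show (C ^ n) k' = 0 from h0, lie_zero]
        let k'' : K := ⁅x, k'⁆
        exact ⟨k'', h1, rfl⟩ }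
  have hle : K' ≤ K := by
    rintro _ ⟨k, hk, rfl⟩
    exact k.2
  have hlt : K' < K := by
    refine lt_of_le_of_ne hle fun e => h3 ⟨n, LinearMap.ext fun k => ?_⟩
    have : (k : V) ∈ K' := e.ge k.2
    obtain ⟨k', hk', e'⟩ := this
    have : k' = k := Subtype.ext e'
    exact this ▸ hk'
  obtain ⟨a, ha, b, hb, hab⟩ := Submodule.mem_sup.1
    (hn.sup_eq_top ▸ Submodule.mem_top : (⟨v, hv⟩ : K) ∈ _)
  obtain ⟨w, hw, haw⟩ := ih K' hlt a ⟨a, ha, rfl⟩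
  refine ⟨w, hw, ?_⟩
  have hbW : (b : V) ∈ W := by
    obtain ⟨c, rfl⟩ := hb
    obtain ⟨m, rfl⟩ : ∃ m, n = m + 1 := ⟨n - 1, by omega⟩
    rw [pow_succ']
    exact h2 (W.comap K.toSubmodule.subtype) (fun x k => hW x k) _
  have e : v = a + b := (congrArg Subtype.val hab).symm
  rw [e, add_sub_right_comm]
  exact W.add_mem haw hbW

end Weyl

/-! ### Universality of the prolongation -/

section Universality

variable {A g : Type*} [LieRing A] [LieAlgebra ℝ A] [LieRing g] [LieAlgebra ℝ g]
  {S : CRAlgebra A} {G : CRAlgebra g} {ι : S.neg →ₗ⁅ℝ⁆ g}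

namespace IsProlongation

theorem map_mem (h : IsProlongation S G ι) {p : ℤ} (hp : p < 0) {x : S.neg}
    (hx : (x : A) ∈ S.deg p) : ι x ∈ G.deg p :=
  (h.mem_deg p hp _).2 ⟨x, hx, rfl⟩

theorem exists_of_mem_neg (h : IsProlongation S G ι) {y : g} (hy : y ∈ G.neg) :
    ∃ x, ι x = y := by
  refine G.neg_induction (P := fun y => ∃ x, ι x = y) ⟨0, map_zero ι⟩ ?_ (fun q hq x hx => ?_) hy
  · rintro _ _ ⟨a, rfl⟩ ⟨b, rfl⟩
    exact ⟨a + b, map_add ι a b⟩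
  · obtain ⟨a, -, ha⟩ := (h.mem_deg q hq x).1 hx
    exact ⟨a, ha⟩

/-- One step in the construction of the embedding in the prolongation: a linear map compatible with
the brackets with elements of negative degree can be corrected in degree `n ≥ 0` so as to be so on
the elements of degree `≤ n`. -/
theorem exists_step (h : IsProlongation S G ι) {n : ℤ} (hn : 0 ≤ n) (Φ : A →ₗ[ℝ] g)
    (h1 : ∀ x : S.neg, Φ x = ι x) (h2 : ∀ p < n, ∀ x ∈ S.deg p, Φ x ∈ G.deg p)
    (h3 : ∀ x ∈ S.below n, ∀ y : S.neg, Φ ⁅x, (y : A)⁆ = ⁅Φ x, ι y⁆) :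
    ∃ Ψ : A →ₗ[ℝ] g, (∀ x : S.neg, Ψ x = ι x) ∧ (∀ p < n + 1, ∀ x ∈ S.deg p, Ψ x ∈ G.deg p) ∧
      ∀ x ∈ S.below (n + 1), ∀ y : S.neg, Ψ ⁅x, (y : A)⁆ = ⁅Ψ x, ι y⁆ := by
  obtain ⟨κ, hκ⟩ := (ι : S.neg →ₗ[ℝ] g).exists_leftInverse_of_injective
    (LinearMap.ker_eq_bot.2 h.injective)
  have hκ1 : ∀ x, κ (ι x) = x := fun x => LinearMap.congr_fun hκ x
  have hκ2 : ∀ y ∈ G.neg, ι (κ y) = y := fun y hy => by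
    obtain ⟨x, rfl⟩ := h.exists_of_mem_neg hy
    rw [hκ1]
  have hκlie : ∀ a b : G.neg, κ ⁅(a : g), (b : g)⁆ = ⁅κ a, κ b⁆ := fun a b => by
    rw [← hκ2 a a.2, ← hκ2 b b.2, ← LieHom.map_lie, hκ1, hκ1, hκ1]
  have hκdeg : ∀ q < 0, ∀ y ∈ G.deg q, ((κ y : S.neg) : A) ∈ S.deg q := fun q hq y hy => by
    obtain ⟨x, hx, rfl⟩ := (h.mem_deg q hq y).1 hy
    rwa [hκ1]
  have hbelow : ∀ x ∈ S.deg n, ∀ y : S.neg, ⁅x, (y : A)⁆ ∈ S.below n := fun x hx y => by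
    obtain ⟨y, hy⟩ := y
    refine S.neg_induction (P := fun y => ⁅x, y⁆ ∈ S.below n) (by simp) (fun y z hy hz => ?_)
      (fun q hq y hy => S.mem_below (by omega) (S.lie_mem hx hy)) hy
    rw [lie_add]
    exact add_mem hy hz
  have hex : ∀ x : S.deg n, ∃ a ∈ G.deg n, ∀ y : S.neg, Φ ⁅(x : A), (y : A)⁆ = ⁅a, ι y⁆ := by
    rintro ⟨x, hx⟩
    let D : LieDerivation ℝ G.neg g :=
      { toLinearMap := Φ ∘ₗ (LieAlgebra.ad ℝ A x : A →ₗ[ℝ] A) ∘ₗ S.neg.toSubmodule.subtype ∘ₗ κ ∘ₗ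
          G.neg.toSubmodule.subtype
        leibniz' := by
          intro a b
          change Φ ⁅x, ((κ ⁅(a : g), (b : g)⁆ : S.neg) : A)⁆ =
            ⁅(a : g), Φ ⁅x, ((κ b : S.neg) : A)⁆⁆ - ⁅(b : g), Φ ⁅x, ((κ a : S.neg) : A)⁆⁆
          have e : ⁅x, ((κ ⁅(a : g), (b : g)⁆ : S.neg) : A)⁆ =
              ⁅⁅x, ((κ a : S.neg) : A)⁆, ((κ b : S.neg) : A)⁆ -
                ⁅⁅x, ((κ b : S.neg) : A)⁆, ((κ a : S.neg) : A)⁆ := by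
            rw [hκlie, LieSubalgebra.coe_bracket, leibniz_lie,
              ← lie_skew _ ⁅x, ((κ b : S.neg) : A)⁆, sub_eq_add_neg]
          rw [e, map_sub, h3 _ (hbelow x hx _), h3 _ (hbelow x hx _), hκ2 a a.2, hκ2 b b.2,
            ← lie_skew _ (b : g), ← lie_skew _ (a : g)]
          abel }
    have hD : ∀ a : G.neg, D a = Φ ⁅x, ((κ a : S.neg) : A)⁆ := fun a => rfl
    obtain ⟨a, ha, haD⟩ := h.complete n hn D
      (fun q hq a haq => by
        rw [hD]
        refine h2 _ (by omega) _ ?_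
        rw [add_comm]
        exact S.lie_mem hx (hκdeg q hq _ haq))
      (fun hn0 a b hab => by
        subst hn0
        rw [hD] at hab ⊢
        let u : S.deg (-1) := ⟨κ a, hκdeg _ (by norm_num) _ a.2⟩
        have hw : ⁅x, (u : A)⁆ ∈ S.deg (-1) := by simpa using S.lie_mem hx u.2
        let w : S.deg (-1) := ⟨⁅x, (u : A)⁆, hw⟩
        have e1 : ι ⟨S.J u, S.mem_neg (by norm_num) (S.J u).2⟩ = G.J a :=
          h.map_J u a (hκ2 a (G.mem_neg (by norm_num) a.2))
        have e2 : ⁅x, (S.J u : A)⁆ = S.J w := S.isCR.lie_zero x hx u w rfl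
        have e3 : ι ⟨w, S.mem_neg (by norm_num) w.2⟩ = b := by
          rw [← h1, ← hab]
        rw [← h.map_J w b e3, ← h1, ← e1, hκ1]
        exact congrArg Φ e2)
    refine ⟨a, ha, fun y => ?_⟩
    have hy : ι y ∈ G.neg := by
      obtain ⟨y, hy⟩ := y
      have : S.neg.toSubmodule ≤ (G.neg.toSubmodule.comap (ι : S.neg →ₗ[ℝ] g)).map
          S.neg.toSubmodule.subtype := S.below_le (n := 0) fun q hq z hz =>
        ⟨⟨z, S.mem_neg hq hz⟩, G.mem_neg hq (h.map_mem hq (x := ⟨z, S.mem_neg hq hz⟩) hz), rfl⟩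
      obtain ⟨z, hz, rfl⟩ := this hy
      exact hz
    have := haD ⟨ι y, hy⟩
    rwa [hD, hκ1] at this
  choose T hT hTlie using hex
  have hTeq : ∀ (x : S.deg n), ∀ a ∈ G.deg n,
      (∀ y : S.neg, Φ ⁅(x : A), (y : A)⁆ = ⁅a, ι y⁆) → T x = a := fun x a ha hay => by
    refine h.transitive.eq hn (hT x) ha fun z hz => ?_
    obtain ⟨u, hu, rfl⟩ := (h.mem_deg (-1) (by norm_num) z).1 hz
    rw [← hTlie, hay]
  let T' : S.deg n →ₗ[ℝ] g :=
    { toFun := T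
      map_add' := fun x y => hTeq _ _ (add_mem (hT x) (hT y)) fun z => by
        rw [Submodule.coe_add, add_lie, map_add, hTlie, hTlie, add_lie]
      map_smul' := fun t x => hTeq _ _ ((G.deg n).smul_mem t (hT x)) fun z => by
        rw [Submodule.coe_smul, smul_lie, map_smul, hTlie, RingHom.id_apply, smul_lie] }
  let π := gproj S.isInternal n
  let Ψ : A →ₗ[ℝ] g := Φ ∘ₗ (LinearMap.id - π) + T' ∘ₗ π.codRestrict (S.deg n) (gproj_mem _ n)
  have hπ : ∀ x ∈ S.below n, π x = 0 := fun x hx =>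
    S.below_le (U := LinearMap.ker π)
      (fun p hp y hy => gproj_of_mem_ne S.isInternal hy (by omega)) hx
  have hΨ : ∀ x ∈ S.below n, Ψ x = Φ x := fun x hx => by
    change Φ (x - π x) + T' ⟨π x, _⟩ = Φ x
    have : (⟨π x, gproj_mem _ n x⟩ : S.deg n) = 0 := Subtype.ext (hπ x hx)
    rw [this, map_zero, add_zero, hπ x hx, sub_zero]
  have hΨ' : ∀ x (hx : x ∈ S.deg n), Ψ x = T ⟨x, hx⟩ := fun x hx => by
    have e : π x = x := gproj_of_mem S.isInternal hx
    change Φ (x - π x) + T' ⟨π x, _⟩ = _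
    have : (⟨π x, gproj_mem _ n x⟩ : S.deg n) = ⟨x, hx⟩ := Subtype.ext e
    rw [this, e, sub_self, map_zero, zero_add]
    rfl
  have hneg : ∀ x ∈ S.neg, x ∈ S.below n := fun x hx =>
    S.below_le (n := 0) (fun p hp y hy => S.mem_below (by omega) hy) hx
  refine ⟨Ψ, fun x => (hΨ x (hneg x x.2)).trans (h1 x), fun p hp x hx => ?_, fun z hz y => ?_⟩
  · rcases (show p < n ∨ p = n by omega) with hp | rfl
    · rw [hΨ x (S.mem_below hp hx)]
      exact h2 p hp x hx
    · rw [hΨ' x hx]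
      exact hT _
  · refine S.below_le (n := n + 1) (U := LinearMap.eqLocus
      (Ψ ∘ₗ (LinearMap.flip (LieModule.toEnd ℝ A A : A →ₗ[ℝ] A →ₗ[ℝ] A) (y : A)))
      ((LinearMap.flip (LieModule.toEnd ℝ g g : g →ₗ[ℝ] g →ₗ[ℝ] g) (ι y)) ∘ₗ Ψ))
      (fun p hp x hx => ?_) hz
    change Ψ ⁅x, (y : A)⁆ = ⁅Ψ x, ι y⁆
    rcases (show p < n ∨ p = n by omega) with hp | rfl
    · have hx' := S.mem_below hp hx
      have : ⁅x, (y : A)⁆ ∈ S.below n := by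
        obtain ⟨y, hy⟩ := y
        refine S.neg_induction (P := fun y => ⁅x, y⁆ ∈ S.below n) (by simp) (fun y z hy hz => ?_)
          (fun q hq y hy => S.mem_below (by omega) (S.lie_mem hx hy)) hy
        rw [lie_add]
        exact add_mem hy hz
      rw [hΨ _ this, hΨ x hx', h3 x hx']
    · rw [hΨ _ (hbelow x hx y), hΨ' x hx, hTlie ⟨x, hx⟩]

/-- A graded `CR` algebra with degrees bounded above maps to the prolongation of its negative part. -/
theorem exists_lieHom (h : IsProlongation S G ι) {N : ℤ} (hN : ∀ p ≥ N, S.deg p = ⊥) :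
    ∃ φ : A →ₗ⁅ℝ⁆ g, (∀ x : S.neg, φ x = ι x) ∧ ∀ p, ∀ x ∈ S.deg p, φ x ∈ G.deg p := by
  have hP : ∀ n : ℕ, ∃ Φ : A →ₗ[ℝ] g, (∀ x : S.neg, Φ x = ι x) ∧
      (∀ p < (n : ℤ), ∀ x ∈ S.deg p, Φ x ∈ G.deg p) ∧
      ∀ x ∈ S.below n, ∀ y : S.neg, Φ ⁅x, (y : A)⁆ = ⁅Φ x, ι y⁆ := by
    intro n
    induction n with
    | zero =>
      obtain ⟨Φ, hΦ⟩ := LinearMap.exists_extend (p := S.neg.toSubmodule) (ι : S.neg →ₗ[ℝ] g)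
      have hΦ' : ∀ x : S.neg, Φ x = ι x := fun x => LinearMap.congr_fun hΦ x
      refine ⟨Φ, hΦ', fun p hp x hx => ?_, fun x hx y => ?_⟩
      · have hp : p < 0 := hp
        have := h.map_mem hp (x := ⟨x, S.mem_neg hp hx⟩) hx
        rwa [← hΦ'] at this
      · have := hΦ' ⁅(⟨x, hx⟩ : S.neg), y⁆
        rw [LieHom.map_lie, ← hΦ' ⟨x, hx⟩] at this
        exact this
    | succ n ih =>
      obtain ⟨Φ, h1, h2, h3⟩ := ih
      have := h.exists_step (Int.natCast_nonneg n) Φ h1 h2 h3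
      exact_mod_cast this
  obtain ⟨Φ, h1, h2, h3⟩ := hP N.toNat
  have hbot : ∀ p, ¬ p < (N.toNat : ℤ) → S.deg p = ⊥ := fun p hp => hN p (by omega)
  have h2 : ∀ p, ∀ x ∈ S.deg p, Φ x ∈ G.deg p := fun p x hx => by
    by_cases hp : p < (N.toNat : ℤ)
    · exact h2 p hp x hx
    · rw [hbot p hp, Submodule.mem_bot] at hx
      rw [hx, map_zero]
      exact zero_mem _
  have h3 : ∀ x, ∀ y ∈ S.neg, Φ ⁅x, y⁆ = ⁅Φ x, Φ y⁆ := fun x y hy => by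
    rw [h1 ⟨y, hy⟩]
    refine h3 x ?_ ⟨y, hy⟩
    have : (⊤ : Submodule ℝ A) ≤ S.below N.toNat := by
      rw [← iSup_deg S.isInternal]
      refine iSup_le fun p x hx => ?_
      by_cases hp : p < (N.toNat : ℤ)
      · exact S.mem_below hp hx
      · rw [hbot p hp, Submodule.mem_bot] at hx
        rw [hx]
        exact zero_mem _
    exact this Submodule.mem_top
  -- in degrees `p, q ≥ 0` the brackets agree by transitivity, by induction on `p + q`
  have h4 : ∀ m : ℕ, ∀ p q : ℤ, (p + 1).toNat + (q + 1).toNat ≤ m → ∀ x ∈ S.deg p,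
      ∀ y ∈ S.deg q, Φ ⁅x, y⁆ = ⁅Φ x, Φ y⁆ := by
    intro m
    induction m with
    | zero =>
      intro p q hpq x hx y hy
      exact h3 x y (S.mem_neg (by omega) hy)
    | succ m ih =>
      intro p q hpq x hx y hy
      rcases lt_or_ge q 0 with hq | hq
      · exact h3 x y (S.mem_neg hq hy)
      rcases lt_or_ge p 0 with hp | hp
      · rw [← lie_skew, map_neg, h3 y x (S.mem_neg hp hx), lie_skew]
      refine h.transitive.eq (add_nonneg hp hq) (h2 _ _ (S.lie_mem hx hy))
        (G.lie_mem (h2 p x hx) (h2 q y hy)) fun z hz => ?_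
      obtain ⟨u, hu, rfl⟩ := (h.mem_deg (-1) (by norm_num) z).1 hz
      rw [← h1, ← h3 _ _ u.2, lie_lie, map_sub,
        ih p (q + -1) (by omega) x hx _ (S.lie_mem hy hu),
        ih q (p + -1) (by omega) y hy _ (S.lie_mem hx hu), h3 y _ u.2, h3 x _ u.2, ← lie_lie]
  refine ⟨{ Φ with map_lie' := fun {x y} => ?_ }, h1, h2⟩
  refine LinearMap.congr_fun (f := Φ ∘ₗ (LieAlgebra.ad ℝ A x : A →ₗ[ℝ] A))
    (g := (LieAlgebra.ad ℝ g (Φ x) : g →ₗ[ℝ] g) ∘ₗ Φ) (gext S.isInternal fun q y hy => ?_) y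
  refine LinearMap.congr_fun
    (f := Φ ∘ₗ (LinearMap.flip (LieModule.toEnd ℝ A A : A →ₗ[ℝ] A →ₗ[ℝ] A) y))
    (g := (LinearMap.flip (LieModule.toEnd ℝ g g : g →ₗ[ℝ] g →ₗ[ℝ] g) (Φ y)) ∘ₗ Φ)
    (gext S.isInternal fun p x hx => ?_) x
  exact h4 _ p q le_rfl x hx y hy

/-- The map to the prolongation is injective on a transitive algebra. -/
theorem injective_of_isTransitive (h : IsProlongation S G ι) (hS : S.IsTransitive)
    (φ : A →ₗ⁅ℝ⁆ g) (h1 : ∀ x : S.neg, φ x = ι x) (h2 : ∀ p, ∀ x ∈ S.deg p, φ x ∈ G.deg p) :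
    Function.Injective φ := by
  have h3 : ∀ m : ℕ, ∀ p : ℤ, p < m → ∀ x ∈ S.deg p, φ x = 0 → x = 0 := by
    intro m
    induction m with
    | zero =>
      intro p hp x hx hx0
      have := h1 ⟨x, S.mem_neg hp hx⟩
      have := h.injective ((this.symm.trans hx0).trans (map_zero ι).symm)
      exact congrArg Subtype.val this
    | succ m ih =>
      intro p hp x hx hx0
      rcases lt_or_ge p m with hpm | hpm
      · exact ih p hpm x hx hx0
      refine hS.eq_zero (p := p) (by omega) hx fun y hy => ?_
      refine ih _ (by omega) _ (S.lie_mem hy hx) ?_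
      rw [LieHom.map_lie, hx0, lie_zero]
  refine (injective_iff_map_eq_zero φ).2 fun x hx => eq_zero_of_gproj S.isInternal fun p => ?_
  refine h3 (p + 1).toNat p (by omega) _ (gproj_mem _ p x) ?_
  have := gproj_map_zero S.isInternal G.isInternal (φ : A →ₗ[ℝ] g) h2 p x
  exact this.symm.trans (by rw [LieHom.coe_toLinearMap, hx, map_zero])

/-- The prolongation contains an element inducing the degree derivation. -/
theorem exists_degree (h : IsProlongation S G ι) :
    ∃ E : g, ∀ p : ℤ, ∀ x ∈ G.deg p, ⁅E, x⁆ = (p : ℝ) • x := by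
  obtain ⟨δ, hδ⟩ := Existence.exists_degree (S := G)
  have hder : ∀ x y : g, δ ⁅x, y⁆ = ⁅δ x, y⁆ + ⁅x, δ y⁆ := by
    intro x y
    have hx : x ∈ ⨆ p, G.deg p := iSup_deg G.isInternal ▸ Submodule.mem_top
    have hy : y ∈ ⨆ p, G.deg p := iSup_deg G.isInternal ▸ Submodule.mem_top
    induction hx using Submodule.iSup_induction' with
    | zero => simp
    | add x x' _ _ hx hx' => rw [add_lie, map_add, hx, hx', map_add, add_lie, add_lie]; abel
    | mem p x hx =>
      induction hy using Submodule.iSup_induction' with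
      | zero => simp
      | add y y' _ _ hy hy' => rw [lie_add, map_add, hy, hy', map_add, lie_add, lie_add]; abel
      | mem q y hy =>
        rw [hδ _ _ (G.lie_mem hx hy), hδ _ _ hx, hδ _ _ hy, smul_lie, lie_smul, ← add_smul]
        push_cast
        rfl
  let D : LieDerivation ℝ G.neg g :=
    { toLinearMap := δ ∘ₗ G.neg.toSubmodule.subtype
      leibniz' := by
        intro a b
        change δ ⁅(a : g), (b : g)⁆ = ⁅(a : g), δ b⁆ - ⁅(b : g), δ a⁆
        rw [hder, ← lie_skew (δ a)]
        abel }
  have hD : ∀ a : G.neg, D a = δ a := fun a => rfl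
  obtain ⟨E, hE, hED⟩ := h.complete 0 le_rfl D
    (fun q hq x hx => by
      rw [hD, hδ q _ hx, add_zero]
      exact (G.deg q).smul_mem _ hx)
    (fun _ x y hxy => by
      rw [hD, hδ _ _ x.2] at hxy
      rw [hD, hδ _ _ (G.J x).2]
      have : y = ((-1 : ℤ) : ℝ) • x := Subtype.ext hxy.symm
      rw [this, map_smul]
      rfl)
  have hneg : ∀ p < 0, ∀ x ∈ G.deg p, ⁅E, x⁆ = (p : ℝ) • x := fun p hp x hx => by
    rw [← hED ⟨x, G.mem_neg hp hx⟩, hD, hδ p x hx]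
  have key : ∀ m : ℕ, ∀ p < (m : ℤ), ∀ x ∈ G.deg p, ⁅E, x⁆ = (p : ℝ) • x := by
    intro m
    induction m with
    | zero => exact hneg
    | succ m ih =>
      intro p hp x hx
      rcases lt_or_ge p m with hpm | hpm
      · exact ih p hpm x hx
      have h0 : ⁅E, x⁆ ∈ G.deg p := by simpa using G.lie_mem hE hx
      refine h.transitive.eq (p := p) (by omega) h0 ((G.deg p).smul_mem _ hx) fun y hy => ?_
      rw [lie_lie, ih (p + -1) (by omega) _ (G.lie_mem hx hy), hneg (-1) (by norm_num) y hy,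
        lie_smul, smul_lie, ← sub_smul]
      push_cast
      ring_nf
  exact ⟨E, fun p x hx => key (p + 1).toNat p (by omega) x hx⟩

/-- The ideals of the prolongation are graded. -/
theorem isHomogeneous_ideal (h : IsProlongation S G ι) (I : LieIdeal ℝ g) :
    IsHomogeneous G.isInternal I.toSubmodule := by
  obtain ⟨E, hE⟩ := h.exists_degree
  exact isHomogeneous_of_degree G.isInternal (LieAlgebra.ad ℝ g E : g →ₗ[ℝ] g) hE _
    fun x hx => I.lie_mem hx

/-- The prolongation of a nondegenerate algebra is nondegenerate. -/
theorem isNondegenerate (h : IsProlongation S G ι) (hS : S.IsNondegenerate) :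
    G.IsNondegenerate := by
  intro y hy hy0
  obtain ⟨u, hu, rfl⟩ := (h.mem_deg (-1) (by norm_num) y).1 hy
  obtain ⟨x, hx, hxu⟩ := hS u hu fun h0 => hy0 (by
    rw [show u = 0 from Subtype.ext h0, map_zero])
  refine ⟨ι ⟨x, S.mem_neg (by norm_num) hx⟩, h.map_mem (by norm_num) hx, fun h0 => hxu ?_⟩
  rw [← LieHom.map_lie] at h0
  exact congrArg Subtype.val (h.injective (h0.trans (map_zero ι).symm))

/-- The prolongation of a fundamental algebra is fundamental. -/
theorem isFundamental (h : IsProlongation S G ι) (hS : S.IsFundamental) : G.IsFundamental := by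
  intro p hp
  refine le_antisymm (fun y hy => ?_) (Submodule.span_le.2 ?_)
  · obtain ⟨u, hu, rfl⟩ := (h.mem_deg (p - 1) (by omega) y).1 hy
    have hu' : (u : A) ∈ Submodule.span ℝ
        {z | ∃ x ∈ S.deg (-1), ∃ y ∈ S.deg p, ⁅x, y⁆ = z} := by
      have : S.deg (p - 1) = _ := hS p hp
      rwa [this] at hu
    have hle : Submodule.span ℝ {z | ∃ x ∈ S.deg (-1), ∃ y ∈ S.deg p, ⁅x, y⁆ = z} ≤
        ((Submodule.span ℝ {z | ∃ x ∈ G.deg (-1), ∃ y ∈ G.deg p, ⁅x, y⁆ = z}).comap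
          (ι : S.neg →ₗ[ℝ] g)).map S.neg.toSubmodule.subtype := by
      refine Submodule.span_le.2 ?_
      rintro _ ⟨x, hx, y, hy, rfl⟩
      refine ⟨⁅(⟨x, S.mem_neg (by norm_num) hx⟩ : S.neg), ⟨y, S.mem_neg hp hy⟩⁆,
        Submodule.subset_span ?_, rfl⟩
      exact ⟨_, h.map_mem (by norm_num) hx, _, h.map_mem hp hy, (LieHom.map_lie ι _ _).symm⟩
    obtain ⟨v, hv, e⟩ := hle hu'
    rw [show u = v from Subtype.ext e.symm]
    exact hv
  · rintro _ ⟨x, hx, y, hy, rfl⟩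
    have := G.lie_mem hx hy
    rwa [show -1 + p = p - 1 by ring] at this

end IsProlongation

end Universality

/-! ### Direct factors of graded `CR` algebras -/

section Factor

variable {A B : Type*} [LieRing A] [LieAlgebra ℝ A] [LieRing B] [LieAlgebra ℝ B]

/-- A homogeneous ideal with a homogeneous complementary ideal in a nondegenerate graded `CR`
algebra is stable under `J`: for `x` in `I` the component `b` of `J x` in the complement `K`
satisfies `[b, c] = [J x, c] = -[x, J c]` for `c` in `K`, and this lies in `I ∩ K`. -/
theorem CRAlgebra.J_mem_of_isCompl (S : CRAlgebra A) (hnd : S.IsNondegenerate)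
    {I K : LieIdeal ℝ A} (h : IsCompl I K) (hI : IsHomogeneous S.isInternal I.toSubmodule)
    (hK : IsHomogeneous S.isInternal K.toSubmodule) {x : A} (hx : x ∈ I)
    (hx' : x ∈ S.deg (-1)) : (S.J ⟨x, hx'⟩ : A) ∈ I := by
  have hdec : ∀ y ∈ S.deg (-1), ∃ a ∈ I, ∃ b ∈ K, a ∈ S.deg (-1) ∧ b ∈ S.deg (-1) ∧
      a + b = y := fun y hy => by
    obtain ⟨a, ha, b, hb, rfl⟩ := (LieSubmodule.mem_sup _ _ y).1
      (h.sup_eq_top ▸ LieSubmodule.mem_top y)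
    refine ⟨_, hI a ha (-1), _, hK b hb (-1), gproj_mem _ _ _, gproj_mem _ _ _, ?_⟩
    rw [← map_add, gproj_of_mem _ hy]
  obtain ⟨a, ha, b, hb, -, hb', hab⟩ := hdec _ (S.J ⟨x, hx'⟩).2
  have hb0 : b = 0 := by
    refine hnd.eq_zero hb' fun y hy => ?_
    obtain ⟨a', ha', c, hc, -, hc', rfl⟩ := hdec y hy
    rw [add_lie, lie_eq_zero_of_disjoint h.disjoint ha' hb, zero_add, ← lie_skew, neg_eq_zero]
    have e1 : ⁅b, c⁆ = ⁅(S.J ⟨x, hx'⟩ : A), c⁆ := by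
      rw [← hab, add_lie, lie_eq_zero_of_disjoint h.disjoint ha hc, zero_add]
    have e2 : ⁅(S.J ⟨x, hx'⟩ : A), c⁆ = -⁅x, (S.J ⟨c, hc'⟩ : A)⁆ := by
      rw [← S.isCR.lie_J_J ⟨x, hx'⟩, S.isCR.sq]
      simp
    have hmem : ⁅b, c⁆ ∈ I ⊓ K := by
      refine ⟨?_, lie_mem_left ℝ A K b c hb⟩
      rw [e1, e2]
      exact neg_mem (lie_mem_left ℝ A I _ _ hx)
    rwa [h.disjoint.eq_bot, LieSubmodule.mem_bot] at hmem
  rw [← hab, hb0, add_zero]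
  exact ha

/-- `B` is a direct factor of the graded `CR` algebra `A`, with inclusion `i` and projection `P`. -/
structure IsFactor (T : CRAlgebra B) (S : CRAlgebra A) (i : B →ₗ⁅ℝ⁆ A) (P : A →ₗ⁅ℝ⁆ B) : Prop where
  isInduced : T.IsInduced S i
  retract : ∀ y, P (i y) = y
  lie_eq : ∀ x y, ⁅x, i y⁆ = i ⁅P x, y⁆
  mem_deg : ∀ p, ∀ x ∈ S.deg p, P x ∈ T.deg p
  map_J : ∀ (x : S.deg (-1)) (y : T.deg (-1)), P x = y → P (S.J x) = T.J y

/-- An ideal with a complementary ideal is a direct factor. -/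
theorem CRAlgebra.IsInduced.exists_isFactor {T : CRAlgebra B} {S : CRAlgebra A} {i : B →ₗ⁅ℝ⁆ A}
    (hT : T.IsInduced S i) (hi : Function.Injective i) (hnd : S.IsNondegenerate)
    {I K : LieIdeal ℝ A} (h : IsCompl I K) (hI : IsHomogeneous S.isInternal I.toSubmodule)
    (hK : IsHomogeneous S.isInternal K.toSubmodule) (hr : ∀ x, x ∈ I ↔ ∃ y, i y = x) :
    ∃ P, IsFactor T S i P := by
  have hdec : ∀ x, ∃ y, ∃ k ∈ K, i y + k = x := fun x => by
    obtain ⟨a, ha, k, hk, rfl⟩ := (LieSubmodule.mem_sup _ _ x).1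
      (h.sup_eq_top ▸ LieSubmodule.mem_top x)
    obtain ⟨y, rfl⟩ := (hr a).1 ha
    exact ⟨y, k, hk, rfl⟩
  have hcom : ∀ y, ∀ k ∈ K, ⁅k, i y⁆ = 0 := fun y k hk =>
    lie_eq_zero_of_disjoint h.disjoint.symm hk ((hr _).2 ⟨y, rfl⟩)
  have huniq : ∀ y y', ∀ k ∈ K, ∀ k' ∈ K, i y + k = i y' + k' → y = y' :=
    fun y y' k hk k' hk' e => by
      have e' : i (y - y') = k' - k := by
        rw [map_sub, sub_eq_sub_iff_add_eq_add, e, add_comm]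
      have : i (y - y') ∈ I ⊓ K := ⟨(hr _).2 ⟨_, rfl⟩, e' ▸ sub_mem hk' hk⟩
      rw [h.disjoint.eq_bot, LieSubmodule.mem_bot] at this
      exact sub_eq_zero.1 (hi (this.trans (map_zero i).symm))
  choose P κ hκ hP using hdec
  have hPeq : ∀ y, ∀ k ∈ K, P (i y + k) = y := fun y k hk => huniq _ _ _ (hκ _) k hk (hP _)
  have hret : ∀ y, P (i y) = y := fun y => by
    simpa using hPeq y 0 (zero_mem K)
  have hdeg : ∀ p, ∀ x ∈ S.deg p, P x ∈ T.deg p := fun p x hx => by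
    obtain ⟨y, hy⟩ := (hr _).1 (hI _ ((hr _).2 ⟨P x, rfl⟩) p)
    have e : i y + gproj S.isInternal p (κ x) = x := by
      rw [hy, ← map_add, hP, gproj_of_mem _ hx]
    rw [← e, hPeq _ _ (hK _ (hκ x) p), hT.mem_deg, hy]
    exact gproj_mem _ p _
  let Q : A →ₗ⁅ℝ⁆ B :=
    { toFun := P
      map_add' := fun x y => by
        rw [← hPeq (P x + P y) (κ x + κ y) (add_mem (hκ x) (hκ y)), map_add,
          add_add_add_comm, hP, hP]
      map_smul' := fun t x => by
        rw [RingHom.id_apply, ← hPeq (t • P x) (t • κ x) (K.smul_mem t (hκ x)), map_smul,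
          ← smul_add, hP]
      map_lie' := fun {x y} => by
        have e : ⁅x, y⁆ = i ⁅P x, P y⁆ + ⁅κ x, κ y⁆ := by
          conv_lhs => rw [← hP x, ← hP y]
          rw [add_lie, lie_add, lie_add, hcom _ _ (hκ x), ← lie_skew _ (κ y), hcom _ _ (hκ y),
            LieHom.map_lie]
          simp
        exact (congrArg P e).trans (hPeq _ _ (K.lie_mem (hκ y))) }
  refine ⟨Q, hT, hret, fun x y => ?_, hdeg, fun x y hxy => ?_⟩
  · change _ = i ⁅P x, y⁆
    conv_lhs => rw [← hP x]
    rw [add_lie, hcom _ _ (hκ x), add_zero, LieHom.map_lie]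
  · obtain rfl : y = ⟨P x, hdeg _ x x.2⟩ := Subtype.ext hxy.symm
    have hi' : i (P x) ∈ S.deg (-1) := (hT.mem_deg _ _).1 (hdeg _ x x.2)
    have hk' : κ x ∈ S.deg (-1) := by
      have := sub_mem x.2 hi'
      rwa [← hP x, hPeq _ _ (hκ _), add_sub_cancel_left] at this
    have e : x = ⟨i (P x), hi'⟩ + ⟨κ x, hk'⟩ := Subtype.ext (hP x).symm
    have e' : (S.J x : A) = i (T.J ⟨P x, hdeg _ x x.2⟩) + S.J ⟨κ x, hk'⟩ := by
      rw [hT.map_J ⟨P x, hdeg _ x x.2⟩ ⟨i (P x), hi'⟩ rfl, ← Submodule.coe_add, ← map_add, ← e]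
    exact (congrArg P e').trans (hPeq _ _ (S.J_mem_of_isCompl hnd h.symm hK hI (hκ x) hk'))

namespace IsFactor

variable {T : CRAlgebra B} {S : CRAlgebra A} {i : B →ₗ⁅ℝ⁆ A} {P : A →ₗ⁅ℝ⁆ B}

theorem injective (h : IsFactor T S i P) : Function.Injective i :=
  Function.LeftInverse.injective h.retract

theorem map_mem (h : IsFactor T S i P) {p : ℤ} {x : B} (hx : x ∈ T.deg p) : i x ∈ S.deg p :=
  (h.isInduced.mem_deg p x).1 hx

theorem exists_lie_ne_zero (h : IsFactor T S i P) {y : B}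
    (hy : i y ≠ 0 → ∃ x ∈ S.deg (-1), ⁅x, i y⁆ ≠ 0) (hy0 : y ≠ 0) :
    ∃ x ∈ T.deg (-1), ⁅x, y⁆ ≠ 0 := by
  obtain ⟨x, hx, hxy⟩ := hy fun h0 => hy0 (h.injective (h0.trans (map_zero i).symm))
  refine ⟨P x, h.mem_deg _ x hx, fun h0 => hxy ?_⟩
  rw [h.lie_eq, h0, map_zero]

theorem isTransitive (h : IsFactor T S i P) (hS : S.IsTransitive) : T.IsTransitive :=
  fun p hp _ hy => h.exists_lie_ne_zero (hS p hp _ (h.map_mem hy))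

theorem isNondegenerate (h : IsFactor T S i P) (hS : S.IsNondegenerate) : T.IsNondegenerate :=
  fun _ hy => h.exists_lie_ne_zero (hS _ (h.map_mem hy))

theorem isFundamental (h : IsFactor T S i P) (hS : S.IsFundamental) : T.IsFundamental := by
  intro p hp
  refine le_antisymm (fun y hy => ?_) (Submodule.span_le.2 ?_)
  · have hy' : i y ∈ S.deg (p - 1) := h.map_mem hy
    have e : S.deg (p - 1) = _ := hS p hp
    rw [e] at hy'
    have hle : Submodule.span ℝ {z | ∃ x ∈ S.deg (-1), ∃ y ∈ S.deg p, ⁅x, y⁆ = z} ≤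
        (Submodule.span ℝ {z | ∃ x ∈ T.deg (-1), ∃ y ∈ T.deg p, ⁅x, y⁆ = z}).comap
          (P : A →ₗ[ℝ] B) := by
      refine Submodule.span_le.2 ?_
      rintro _ ⟨x, hx, z, hz, rfl⟩
      exact Submodule.subset_span ⟨P x, h.mem_deg _ x hx, P z, h.mem_deg _ z hz,
        (LieHom.map_lie P x z).symm⟩
    have := hle hy'
    rwa [Submodule.mem_comap, LieHom.coe_toLinearMap, h.retract] at this
  · rintro _ ⟨x, hx, y, hy, rfl⟩
    have := T.lie_mem hx hy
    rwa [show -1 + p = p - 1 by ring] at this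

theorem map_mem_neg (h : IsFactor T S i P) {x : B} (hx : x ∈ T.neg) : i x ∈ S.neg := by
  refine T.neg_induction (P := fun x => i x ∈ S.neg) (by simp) (fun x y hx hy => ?_)
    (fun q hq x hx => S.mem_neg hq (h.map_mem hx)) hx
  rw [map_add]
  exact add_mem hx hy

theorem proj_mem_neg (h : IsFactor T S i P) {x : A} (hx : x ∈ S.neg) : P x ∈ T.neg := by
  refine S.neg_induction (P := fun x => P x ∈ T.neg) (by simp) (fun x y hx hy => ?_)
    (fun q hq x hx => T.mem_neg hq (h.mem_deg _ _ hx)) hx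
  rw [map_add]
  exact add_mem hx hy

/-- The inclusion of the negative part of a direct factor. -/
def negIncl (h : IsFactor T S i P) : T.neg →ₗ⁅ℝ⁆ S.neg where
  toFun x := ⟨i x, h.map_mem_neg x.2⟩
  map_add' _ _ := Subtype.ext (map_add i _ _)
  map_smul' _ _ := Subtype.ext (map_smul i _ _)
  map_lie' := Subtype.ext (LieHom.map_lie i _ _)

variable {C D : Type*} [LieRing C] [LieAlgebra ℝ C] [LieRing D] [LieAlgebra ℝ D]
  {G : CRAlgebra C} {H : CRAlgebra D} {j : D →ₗ⁅ℝ⁆ C} {Q : C →ₗ⁅ℝ⁆ D} {ι : S.neg →ₗ⁅ℝ⁆ C}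

/-- A direct factor of the prolongation of `m` is the prolongation of its negative part: a
derivation with values in the factor extends to `m`, by zero on the complementary factor. -/
theorem exists_isProlongation (h : IsFactor T S i P) (h' : IsFactor H G j Q)
    (hG : IsProlongation S G ι) (hr : ∀ x : S.neg, (∃ z, j z = ι x) ↔ ∃ y, i y = x) :
    ∃ ι' : T.neg →ₗ⁅ℝ⁆ D, (∀ (y : T.neg) (x : S.neg), i y = x → ι x = j (ι' y)) ∧
      IsProlongation T H ι' := by
  have hι' : ∀ (y : T.neg) (x : S.neg), i y = x → ι x = j ((Q.comp (ι.comp h.negIncl)) y) := by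
    intro y x hyx
    obtain ⟨z, hz⟩ := (hr x).2 ⟨y, hyx⟩
    have e : h.negIncl y = x := Subtype.ext hyx
    rw [LieHom.comp_apply, LieHom.comp_apply, e, ← hz, h'.retract]
  generalize Q.comp (ι.comp h.negIncl) = ι' at hι'
  refine ⟨ι', hι', ?_⟩
  have hι : ∀ y : T.neg, j (ι' y) = ι (h.negIncl y) := fun y => (hι' y _ rfl).symm
  constructor
  · intro y y' e
    have := hG.injective ((hι y).symm.trans ((congrArg j e).trans (hι y')))
    exact Subtype.ext (h.injective (congrArg Subtype.val this))
  · intro p hp z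
    constructor
    · intro hz
      obtain ⟨x, hx, hxz⟩ := (hG.mem_deg p hp _).1 (h'.map_mem hz)
      obtain ⟨y, hy⟩ := (hr x).1 ⟨z, hxz.symm⟩
      have hyp : y ∈ T.deg p := (h.isInduced.mem_deg p y).2 (hy ▸ hx)
      exact ⟨⟨y, T.mem_neg hp hyp⟩, hyp, h'.injective ((hι' _ x hy).symm.trans hxz)⟩
    · rintro ⟨y, hy, rfl⟩
      rw [h'.isInduced.mem_deg, hι]
      exact hG.map_mem hp (h.map_mem hy)
  · intro x y hxy
    refine h'.injective ?_
    have hx : i x ∈ S.deg (-1) := h.map_mem x.2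
    rw [h'.isInduced.map_J y ⟨j y, h'.map_mem y.2⟩ rfl,
      ← hι' _ ⟨S.J ⟨i x, hx⟩, S.mem_neg (by norm_num) (S.J ⟨i x, hx⟩).2⟩
        (h.isInduced.map_J x ⟨i x, hx⟩ rfl)]
    refine hG.map_J ⟨i x, hx⟩ _ ?_
    exact (hι' _ _ rfl).trans (congrArg j hxy)
  · exact h'.isTransitive hG.transitive
  · intro p hp D' hD hDJ
    -- the extension of `D'` by zero on the complementary factor
    let E : LieDerivation ℝ G.neg C :=
      { toLinearMap := (j : D →ₗ[ℝ] C) ∘ₗ (D' : H.neg →ₗ[ℝ] D) ∘ₗ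
          (((Q : C →ₗ[ℝ] D) ∘ₗ G.neg.toSubmodule.subtype).codRestrict H.neg.toSubmodule
            fun x => h'.proj_mem_neg x.2)
        leibniz' := by
          intro a b
          change j (D' ⟨Q ⁅(a : C), (b : C)⁆, _⟩) =
            ⁅(a : C), j (D' ⟨Q b, _⟩)⁆ - ⁅(b : C), j (D' ⟨Q a, _⟩)⁆
          have e : (⟨Q ⁅(a : C), (b : C)⁆, h'.proj_mem_neg ⁅a, b⁆.2⟩ : H.neg) =
              ⁅(⟨Q a, h'.proj_mem_neg a.2⟩ : H.neg), ⟨Q b, h'.proj_mem_neg b.2⟩⁆ :=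
            Subtype.ext (LieHom.map_lie Q a b)
          rw [e, D'.apply_lie_eq_sub, map_sub, h'.lie_eq, h'.lie_eq]
          rfl }
    have hE : ∀ a : G.neg, E a = j (D' ⟨Q a, h'.proj_mem_neg a.2⟩) := fun a => rfl
    obtain ⟨a, ha, haE⟩ := hG.complete p hp E
      (fun q hq x hx => by
        rw [hE]
        exact h'.map_mem (hD q hq _ (h'.mem_deg q x hx)))
      (fun hp0 x y hxy => by
        rw [hE] at hxy ⊢
        have hQx : Q x ∈ H.deg (-1) := h'.mem_deg _ x x.2
        let u : H.deg (-1) := ⟨Q x, hQx⟩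
        have hw : D' ⟨u, H.mem_neg (by norm_num) u.2⟩ ∈ H.deg (-1) := by
          rw [h'.isInduced.mem_deg]
          exact hxy ▸ y.2
        have := hDJ hp0 u ⟨_, hw⟩ rfl
        have e : (⟨Q (G.J x), h'.proj_mem_neg (G.mem_neg (by norm_num) (G.J x).2)⟩ : H.neg) =
          ⟨H.J u, H.mem_neg (by norm_num) (H.J u).2⟩ := Subtype.ext (h'.map_J x u rfl)
        rw [e, this]
        exact h'.isInduced.map_J ⟨_, hw⟩ y hxy)
    refine ⟨Q a, h'.mem_deg p a ha, fun x => h'.injective ?_⟩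
    have hx : j x ∈ G.neg := h'.map_mem_neg x.2
    have := haE ⟨j x, hx⟩
    rw [hE, h'.lie_eq] at this
    rw [← this]
    exact congrArg (fun z => j (D' z)) (Subtype.ext (h'.retract x).symm)

end IsFactor

end Factor

/-! ### Abelian extensions -/

namespace AbExt

section

variable {L V : Type*} [LieRing L] [LieAlgebra ℝ L]
  [AddCommGroup V] [Module ℝ V] [LieRingModule L V]

variable (L V) in
/-- The inclusion of `V` in `L ⊕ V`. -/
def inr : V →ₗ[ℝ] AbExt L V where
  toFun v := ⟨0, v⟩
  map_add' _ _ := AbExt.ext (add_zero 0).symm rfl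
  map_smul' t _ := AbExt.ext (smul_zero t).symm rfl

theorem lie_inr (z : AbExt L V) (v : V) : ⁅z, inr L V v⁆ = inr L V ⁅z.fst, v⁆ := by
  refine AbExt.ext (lie_zero z.fst) ?_
  change ⁅z.fst, v⁆ - ⁅(0 : L), z.snd⁆ = ⁅z.fst, v⁆
  rw [zero_lie, sub_zero]

variable [LieModule ℝ L V]

variable (L V) in
/-- The inclusion of `L` in `L ⊕ V`. -/
def inl : L →ₗ⁅ℝ⁆ AbExt L V where
  toFun x := ⟨x, 0⟩
  map_add' _ _ := AbExt.ext rfl (add_zero 0).symm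
  map_smul' t _ := AbExt.ext rfl (smul_zero t).symm
  map_lie' {x y} := AbExt.ext rfl (by
    change (0 : V) = ⁅x, (0 : V)⁆ - ⁅y, (0 : V)⁆
    rw [lie_zero, lie_zero, sub_zero])

variable (L V) in
/-- The projection of `L ⊕ V` on `L`. -/
def fstHom : AbExt L V →ₗ⁅ℝ⁆ L where
  toFun x := x.fst
  map_add' _ _ := rfl
  map_smul' _ _ := rfl
  map_lie' := rfl

theorem eq_inl_add_inr (z : AbExt L V) : z = inl L V z.fst + inr L V z.snd :=
  AbExt.ext (add_zero z.fst).symm (zero_add z.snd).symm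

/-- The inclusion of Abelian extensions induced by an ideal and a submodule. -/
def incl (I : LieIdeal ℝ L) (K : LieSubmodule ℝ L V) : AbExt I K →ₗ⁅ℝ⁆ AbExt L V where
  toFun z := ⟨z.fst, z.snd⟩
  map_add' _ _ := rfl
  map_smul' _ _ := rfl
  map_lie' := rfl

theorem incl_injective (I : LieIdeal ℝ L) (K : LieSubmodule ℝ L V) :
    Function.Injective (incl I K) := fun _ _ e =>
  AbExt.ext (Subtype.ext (congrArg AbExt.fst e)) (Subtype.ext (congrArg AbExt.snd e))

instance [FiniteDimensional ℝ L] [FiniteDimensional ℝ V] : FiniteDimensional ℝ (AbExt L V) :=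
  (toProdl L V).symm.finiteDimensional

end

end AbExt

section Extension

variable {s : Type*} [LieRing s] [LieAlgebra ℝ s]
  {l : Type*} [AddCommGroup l] [Module ℝ l] [LieRingModule s l] [LieModule ℝ s l]

namespace CRModule

variable {S : CRAlgebra s} (M : CRModule S l)

theorem inl_mem {p : ℤ} {x : s} (hx : x ∈ S.deg p) : AbExt.inl s l x ∈ M.extCR.deg p :=
  ⟨hx, zero_mem (M.deg p)⟩

theorem inr_mem {p : ℤ} {v : l} (hv : v ∈ M.deg p) : AbExt.inr s l v ∈ M.extCR.deg p :=
  ⟨zero_mem (S.deg p), hv⟩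

theorem isTransitive_extCR (hS : S.IsTransitive) (hM : M.IsTransitive) :
    M.extCR.IsTransitive := by
  intro p hp y hy hy0
  by_cases h : y.fst = 0
  · have h' : y.snd ≠ 0 := fun h' => hy0 (AbExt.ext h h')
    obtain ⟨x, hx, hxy⟩ := hM p hp y.snd hy.2 h'
    refine ⟨_, M.inl_mem hx, fun h0 => hxy ?_⟩
    have h0 : ⁅x, y.snd⁆ - ⁅y.fst, (0 : l)⁆ = 0 := congrArg AbExt.snd h0
    rwa [lie_zero, sub_zero] at h0
  · obtain ⟨x, hx, hxy⟩ := hS p hp y.fst hy.1 h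
    exact ⟨_, M.inl_mem hx, fun h0 => hxy (congrArg AbExt.fst h0)⟩

theorem isTransitive_of_extCR (h : M.extCR.IsTransitive) : M.IsTransitive := by
  intro p hp v hv hv0
  obtain ⟨x, hx, hxv⟩ := h p hp _ (M.inr_mem hv) fun h0 => hv0 (congrArg AbExt.snd h0)
  refine ⟨x.fst, hx.1, fun h0 => hxv ?_⟩
  rw [AbExt.lie_inr, h0, map_zero]

theorem isFundamental_extCR (hS : S.IsFundamental) (hM : M.IsFundamental) :
    M.extCR.IsFundamental := by
  intro p hp
  refine le_antisymm (fun z hz => ?_) (Submodule.span_le.2 ?_)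
  · have e1 : S.deg (p - 1) = _ := hS p hp
    have h1 : z.fst ∈ S.deg (p - 1) := hz.1
    have h2 : z.snd ∈ M.deg (p - 1) := hz.2
    rw [e1] at h1
    rw [hM p hp] at h2
    rw [AbExt.eq_inl_add_inr z]
    refine add_mem ?_ ?_
    · refine (Submodule.span_le.2 ?_ : _ ≤ (Submodule.span ℝ _).comap
        (AbExt.inl s l : s →ₗ[ℝ] AbExt s l)) h1
      rintro _ ⟨x, hx, y, hy, rfl⟩
      exact Submodule.subset_span ⟨_, M.inl_mem hx, _, M.inl_mem hy, (LieHom.map_lie _ x y).symm⟩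
    · refine (Submodule.span_le.2 ?_ : _ ≤ (Submodule.span ℝ _).comap (AbExt.inr s l)) h2
      rintro _ ⟨x, hx, y, hy, rfl⟩
      exact Submodule.subset_span ⟨_, M.inl_mem hx, _, M.inr_mem hy, AbExt.lie_inr _ y⟩
  · rintro _ ⟨x, hx, y, hy, rfl⟩
    have := M.extCR.lie_mem hx hy
    rwa [show -1 + p = p - 1 by ring] at this

end CRModule

/-- A finite dimensional graded space has bounded degrees. -/
theorem exists_bound {V : Type*} [AddCommGroup V] [Module ℝ V] [FiniteDimensional ℝ V]
    {deg : ℤ → Submodule ℝ V} (h : DirectSum.IsInternal deg) :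
    ∃ N : ℤ, ∀ p, N ≤ |p| → deg p = ⊥ := by
  have hfin := WellFoundedGT.finite_ne_bot_of_iSupIndep
    ((DirectSum.isInternal_submodule_iff_iSupIndep_and_iSup_eq_top _).1 h).1
  obtain ⟨N, hN⟩ := (hfin.image fun p : ℤ => |p|).bddAbove
  refine ⟨N + 1, fun p hp => ?_⟩
  by_contra h0
  have := hN ⟨p, h0, rfl⟩
  dsimp only at this
  omega

/-- The Levi–Tanaka prolongation of a finite dimensional fundamental nondegenerate algebra is
finite dimensional. -/
theorem IsProlongation.finiteDimensional {A g : Type*} [LieRing A] [LieAlgebra ℝ A]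
    [FiniteDimensional ℝ A] [LieRing g] [LieAlgebra ℝ g] {S : CRAlgebra A} {G : CRAlgebra g}
    {ι : S.neg →ₗ⁅ℝ⁆ g} (h : IsProlongation S G ι) (hF : S.IsFundamental)
    (hnd : S.IsNondegenerate) : FiniteDimensional ℝ g := by
  obtain ⟨N, hN⟩ := exists_bound S.isInternal
  have hle : ∀ p < 0, G.deg p ≤ LinearMap.range (ι : S.neg →ₗ[ℝ] g) := fun p hp y hy => by
    obtain ⟨x, -, hx⟩ := (h.mem_deg p hp y).1 hy
    exact ⟨x, hx⟩
  refine G.finiteDimensional (h.isFundamental hF) h.transitive (h.isNondegenerate hnd)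
    (N := min (-1) (-N)) (fun p hp => ?_) fun p hp =>
      Submodule.finiteDimensional_of_le (hle p hp)
  rw [Submodule.eq_bot_iff]
  intro y hy
  obtain ⟨x, hx, rfl⟩ := (h.mem_deg p (by omega) y).1 hy
  rw [hN p (by rw [abs_of_neg (by omega)]; omega), Submodule.mem_bot] at hx
  rw [show x = 0 from Subtype.ext hx, map_zero]

/-! ### Splitting the Abelian extension -/

/-- A subspace that contains the components of negative degree contains the elements without
components of degree `≥ 0`. -/
theorem mem_of_gproj_eq_zero {deg : ℤ → Submodule ℝ l} (h : DirectSum.IsInternal deg)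
    {U : Submodule ℝ l} (hU : ∀ p < 0, deg p ≤ U) {x : l}
    (hx : ∀ p, 0 ≤ p → gproj h p x = 0) : x ∈ U := by
  obtain ⟨F, hF⟩ := exists_finset_sum_gproj h x
  rw [hF]
  refine U.sum_mem fun p _ => ?_
  rcases lt_or_ge p 0 with hp | hp
  · exact hU p hp (gproj_mem h p x)
  · rw [hx p hp]
    exact zero_mem _

/-- In a transitive module, the elements killed by the component of degree `-1` lie in the negative
part. -/
theorem ModuleGrading.IsTransitive.mem_of_lie_eq_zero {S : LieGrading s} {M : ModuleGrading S l}
    (h : M.IsTransitive) {U : Submodule ℝ l} (hU : ∀ p < 0, M.deg p ≤ U) {v : l}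
    (hv : ∀ x ∈ S.deg (-1), ⁅x, v⁆ = 0) : v ∈ U := by
  refine mem_of_gproj_eq_zero M.isInternal hU fun p hp => ?_
  by_contra h0
  obtain ⟨x, hx, hxv⟩ := h p hp _ (gproj_mem M.isInternal p v) h0
  refine hxv ?_
  have := gproj_map M.isInternal M.isInternal (LieModule.toEnd ℝ s l x : l →ₗ[ℝ] l) (k := -1)
    (fun r z hz => by rw [add_comm]; exact M.lie_mem hx hz) p v
  rw [LieModule.toEnd_apply_apply, LieModule.toEnd_apply_apply, hv x hx, map_zero] at this
  exact this.symm

section Parts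

/-- The ideal of `s` cut out by an ideal of `s ⊕ l`. -/
def idealPart (A : LieIdeal ℝ (AbExt s l)) : LieIdeal ℝ s where
  toSubmodule := A.toSubmodule.comap (AbExt.inl s l : s →ₗ[ℝ] AbExt s l)
  lie_mem {x m} hm := by
    have := A.lie_mem (x := AbExt.inl s l x) hm
    rwa [LieHom.coe_toLinearMap, ← LieHom.map_lie] at this

/-- The submodule of `l` cut out by an ideal of `s ⊕ l`. -/
def modulePart (A : LieIdeal ℝ (AbExt s l)) : LieSubmodule ℝ s l where
  toSubmodule := A.toSubmodule.comap (AbExt.inr s l)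
  lie_mem {x v} hv := by
    have := A.lie_mem (x := AbExt.inl s l x) hv
    rwa [AbExt.lie_inr] at this

theorem mem_idealPart {A : LieIdeal ℝ (AbExt s l)} {x : s} :
    x ∈ idealPart A ↔ AbExt.inl s l x ∈ A := Iff.rfl

theorem mem_modulePart {A : LieIdeal ℝ (AbExt s l)} {v : l} :
    v ∈ modulePart A ↔ AbExt.inr s l v ∈ A := Iff.rfl

theorem fst_lie_mem_modulePart {A : LieIdeal ℝ (AbExt s l)} {z : AbExt s l} (hz : z ∈ A) (v : l) :
    ⁅z.fst, v⁆ ∈ modulePart A := by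
  rw [mem_modulePart, ← AbExt.lie_inr]
  exact lie_mem_left ℝ _ A _ _ hz

end Parts

section Split

variable [FiniteDimensional ℝ s] [LieAlgebra.IsSemisimple ℝ s]

/-- The projection on `s` of an ideal of `s ⊕ l` is contained in the ideal: it is perfect, and the
ideal contains the products of the elements of its projection with the elements of `l`. -/
theorem inl_fst_mem {A : LieIdeal ℝ (AbExt s l)} {z : AbExt s l} (hz : z ∈ A) :
    z.fst ∈ idealPart A := by
  let I : LieIdeal ℝ s :=
    { toSubmodule := A.toSubmodule.map (AbExt.fstHom s l : AbExt s l →ₗ[ℝ] s)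
      lie_mem := by
        rintro x _ ⟨w, hw, rfl⟩
        exact ⟨⁅AbExt.inl s l x, w⁆, A.lie_mem hw, rfl⟩ }
  have hle : ⁅I, I⁆ ≤ idealPart A := by
    rw [LieSubmodule.lie_le_iff]
    rintro _ ⟨a, ha, rfl⟩ _ ⟨b, hb, rfl⟩
    have h1 : ⁅a, AbExt.inl s l b.fst⁆ ∈ A := lie_mem_left ℝ _ A _ _ ha
    have h2 := fst_lie_mem_modulePart hb a.snd
    rw [mem_modulePart] at h2
    have e : AbExt.inl s l ⁅a.fst, b.fst⁆ =
        ⁅a, AbExt.inl s l b.fst⁆ + AbExt.inr s l ⁅b.fst, a.snd⁆ := by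
      refine AbExt.ext (add_zero ⁅a.fst, b.fst⁆).symm ?_
      change 0 = ⁅a.fst, (0 : l)⁆ - ⁅b.fst, a.snd⁆ + ⁅b.fst, a.snd⁆
      rw [lie_zero, zero_sub, neg_add_cancel]
    change AbExt.inl s l ⁅a.fst, b.fst⁆ ∈ A
    rw [e]
    exact add_mem h1 h2
  exact hle (ideal_le_lie_self I ⟨z, hz, rfl⟩)

theorem mem_iff_parts (A : LieIdeal ℝ (AbExt s l)) (z : AbExt s l) :
    z ∈ A ↔ z.fst ∈ idealPart A ∧ z.snd ∈ modulePart A := by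
  constructor
  · intro hz
    have h1 : AbExt.inl s l z.fst ∈ A := inl_fst_mem hz
    refine ⟨h1, ?_⟩
    rw [AbExt.eq_inl_add_inr z] at hz
    exact (add_mem_cancel_left h1).1 hz
  · rintro ⟨h1, h2⟩
    rw [AbExt.eq_inl_add_inr z]
    exact add_mem (mem_idealPart.1 h1) (mem_modulePart.1 h2)

variable {S : CRAlgebra s} (M : CRModule S l) {A₁ A₂ : LieIdeal ℝ (AbExt s l)}

/-- Two independent ideals of `s ⊕ l` whose sum contains the negative part split `s`: the Killing
orthogonal of the sum of their parts in `s` commutes with `s₋₁`, so by transitivity it lies in the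
negative part, and hence in the sum. -/
theorem isCompl_idealPart (hS : S.IsTransitive) (hd : Disjoint A₁ A₂)
    (hneg : ∀ p < 0, ∀ z ∈ M.extCR.deg p, z ∈ A₁ ⊔ A₂) :
    IsCompl (idealPart A₁) (idealPart A₂) := by
  constructor
  · rw [disjoint_iff, LieSubmodule.eq_bot_iff]
    rintro x ⟨h1, h2⟩
    have : AbExt.inl s l x ∈ A₁ ⊓ A₂ := ⟨h1, h2⟩
    rw [hd.eq_bot, LieSubmodule.mem_bot] at this
    exact congrArg AbExt.fst this
  · have hneg' : ∀ p < 0, S.deg p ≤ (idealPart A₁ ⊔ idealPart A₂).toSubmodule := by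
      intro p hp x hx
      obtain ⟨a, ha, b, hb, e⟩ := (LieSubmodule.mem_sup _ _ _).1 (hneg p hp _ (M.inl_mem hx))
      exact (LieSubmodule.mem_sup _ _ _).2 ⟨_, inl_fst_mem ha, _, inl_fst_mem hb,
        congrArg AbExt.fst e⟩
    have hc := LieIdeal.isCompl_killingCompl (K := ℝ) (idealPart A₁ ⊔ idealPart A₂)
    have hbot : LieIdeal.killingCompl ℝ s (idealPart A₁ ⊔ idealPart A₂) = ⊥ := by
      rw [LieSubmodule.eq_bot_iff]
      intro x hx
      have hx' : x ∈ idealPart A₁ ⊔ idealPart A₂ :=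
        ModuleGrading.IsTransitive.mem_of_lie_eq_zero hS hneg' fun y hy =>
          lie_eq_zero_of_disjoint hc.disjoint (hneg' _ (by norm_num) hy) hx
      have h0 := (LieSubmodule.eq_bot_iff _).1 hc.disjoint.eq_bot x ⟨hx', hx⟩
      exact h0
    rw [codisjoint_iff, ← hc.sup_eq_top, hbot, sup_bot_eq]

/-- Two independent ideals of `s ⊕ l` whose sum contains the negative part split `l`: the sum of
their parts in `l` contains `s · l` and, by transitivity, the invariant elements. -/
theorem isCompl_modulePart [FiniteDimensional ℝ l] (hS : S.IsTransitive) (hM : M.IsTransitive)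
    (hd : Disjoint A₁ A₂) (hneg : ∀ p < 0, ∀ z ∈ M.extCR.deg p, z ∈ A₁ ⊔ A₂) :
    IsCompl (modulePart A₁) (modulePart A₂) := by
  constructor
  · rw [disjoint_iff, LieSubmodule.eq_bot_iff]
    rintro v ⟨h1, h2⟩
    have : AbExt.inr s l v ∈ A₁ ⊓ A₂ := ⟨h1, h2⟩
    rw [hd.eq_bot, LieSubmodule.mem_bot] at this
    exact congrArg AbExt.snd this
  · rw [codisjoint_iff, eq_top_iff]
    intro v _
    have hneg' : ∀ p < 0, M.deg p ≤ (modulePart A₁ ⊔ modulePart A₂).toSubmodule := by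
      intro p hp x hx
      obtain ⟨a, ha, b, hb, e⟩ := (LieSubmodule.mem_sup _ _ _).1 (hneg p hp _ (M.inr_mem hx))
      exact (LieSubmodule.mem_sup _ _ _).2 ⟨_, ((mem_iff_parts _ _).1 ha).2, _,
        ((mem_iff_parts _ _).1 hb).2, congrArg AbExt.snd e⟩
    have hact : ∀ (x : s) (v : l), ⁅x, v⁆ ∈ (modulePart A₁ ⊔ modulePart A₂).toSubmodule := by
      intro x v
      obtain ⟨a, ha, b, hb, rfl⟩ := (LieSubmodule.mem_sup _ _ x).1
        ((isCompl_idealPart M hS hd hneg).sup_eq_top ▸ LieSubmodule.mem_top x)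
      rw [add_lie]
      exact (LieSubmodule.mem_sup _ _ _).2 ⟨_, fst_lie_mem_modulePart (mem_idealPart.1 ha) v, _,
        fst_lie_mem_modulePart (mem_idealPart.1 hb) v, rfl⟩
    obtain ⟨w, hw, hvw⟩ := exists_invariant_sub_mem hact v
    have := ModuleGrading.IsTransitive.mem_of_lie_eq_zero hM hneg' fun y _ => hw y
    have h := add_mem hvw this
    rwa [sub_add_cancel] at h

end Split

/-! ### Graded `CR` structures on the parts -/

section Induced

variable {S : CRAlgebra s} (M : CRModule S l) {A : LieIdeal ℝ (AbExt s l)}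

theorem CRModule.gproj_inl (p : ℤ) (x : s) : gproj M.extCR.isInternal p (AbExt.inl s l x) =
    AbExt.inl s l (gproj S.isInternal p x) :=
  gproj_map_zero S.isInternal M.extCR.isInternal (AbExt.inl s l : s →ₗ[ℝ] AbExt s l)
    (fun _ _ hx => M.inl_mem hx) p x

theorem CRModule.gproj_inr (p : ℤ) (v : l) : gproj M.extCR.isInternal p (AbExt.inr s l v) =
    AbExt.inr s l (gproj M.isInternal p v) :=
  gproj_map_zero M.isInternal M.extCR.isInternal (AbExt.inr s l)
    (fun _ _ hx => M.inr_mem hx) p v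

/-- A graded ideal of `s ⊕ l` stable under `J` induces graded `CR` structures on its parts, for
which the inclusion of Abelian extensions is compatible with all the structures. -/
theorem exists_isInduced_parts (hA : IsHomogeneous M.extCR.isInternal A.toSubmodule)
    (hJ : ∀ x ∈ A, ∀ hx : x ∈ M.extCR.deg (-1), (M.extCR.J ⟨x, hx⟩ : AbExt s l) ∈ A) :
    ∃ (S' : CRAlgebra (idealPart A)) (M' : CRModule S' (modulePart A)),
      S'.IsInduced S (fun x => (x : s)) ∧ M'.IsInduced M (fun y => (y : l)) ∧
      M'.extCR.IsInduced M.extCR (AbExt.incl (idealPart A) (modulePart A)) := by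
  obtain ⟨S', hS'⟩ := S.exists_isInduced (idealPart A).incl Subtype.val_injective
    (by
      rintro _ ⟨x, rfl⟩ p
      refine ⟨⟨gproj S.isInternal p x, ?_⟩, rfl⟩
      rw [mem_idealPart, ← M.gproj_inl]
      exact hA _ x.2 p)
    (fun x hx => by
      have h := hJ _ x.2 (M.inl_mem hx)
      have e : M.extCR.J ⟨AbExt.inl s l x, M.inl_mem hx⟩ = AbExt.inl s l (S.J ⟨x, hx⟩) :=
        AbExt.ext rfl (congrArg Subtype.val (map_zero M.J))
      have h' : AbExt.inl s l (S.J ⟨x, hx⟩) ∈ A := e ▸ h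
      exact ⟨⟨S.J ⟨x, hx⟩, h'⟩, rfl⟩)
  let f : modulePart A →ₗ[ℝ] l := (modulePart A).toSubmodule.subtype
  have hf : Function.Injective f := Subtype.val_injective
  obtain ⟨K, hK⟩ := exists_comap_operator f hf M.J fun v hv => by
    have h := hJ _ v.2 (M.inr_mem hv)
    have e : M.extCR.J ⟨AbExt.inr s l v, M.inr_mem hv⟩ = AbExt.inr s l (M.J ⟨v, hv⟩) :=
      AbExt.ext (congrArg Subtype.val (map_zero S.J)) rfl
    have h' : AbExt.inr s l (M.J ⟨v, hv⟩) ∈ A := e ▸ h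
    exact ⟨⟨M.J ⟨v, hv⟩, h'⟩, rfl⟩
  let N : ModuleGrading S'.toLieGrading (modulePart A) :=
    { deg := fun p => (M.deg p).comap f
      isInternal := isInternal_comap M.isInternal f hf (by
        rintro _ ⟨v, rfl⟩ p
        refine ⟨⟨gproj M.isInternal p v, ?_⟩, rfl⟩
        rw [mem_modulePart, ← M.gproj_inr]
        exact hA _ v.2 p)
      lie_mem := fun {p q x y} hx hy => M.lie_mem ((hS'.mem_deg p x).1 hx) hy }
  have hdeg : ∀ p x, x ∈ N.ext.deg p ↔ AbExt.incl _ _ x ∈ M.extCR.deg p := fun p x =>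
    ⟨fun hx => ⟨(hS'.mem_deg p _).1 hx.1, hx.2⟩, fun hx => ⟨(hS'.mem_deg p _).2 hx.1, hx.2⟩⟩
  have hJ' : ∀ (x : N.ext.deg (-1)) (y : M.extCR.deg (-1)),
      AbExt.incl (idealPart A) (modulePart A) x = (y : AbExt s l) →
      AbExt.incl _ _ (N.extJ S'.J K x : AbExt (idealPart A) (modulePart A)) = (M.extCR.J y : AbExt s l) := by
    intro x y hxy
    obtain rfl : y = ⟨AbExt.incl _ _ (x : AbExt _ _), (hdeg _ _).1 x.2⟩ := Subtype.ext hxy.symm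
    exact AbExt.ext (hS'.map_J ⟨x.1.fst, x.2.1⟩ _ rfl) (hK x.1.snd x.2.2)
  refine ⟨S', ⟨N, K, M.isCR.comap (AbExt.incl _ _) (AbExt.incl_injective _ _)
    (fun p x hx => (hdeg p x).1 hx) hJ'⟩, ⟨hS'.mem_deg, hS'.map_J⟩,
    ⟨fun p x => Iff.rfl, fun x y hxy => ?_⟩, ⟨hdeg, hJ'⟩⟩
  obtain rfl : y = ⟨f x, x.2⟩ := Subtype.ext hxy.symm
  exact hK x x.2

end Induced

end Extension

/-! ### Levi–Tanaka extensions of the parts -/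

section Main

variable {s l g : Type*} [LieRing s] [LieAlgebra ℝ s] [FiniteDimensional ℝ s]
  [LieAlgebra.IsSemisimple ℝ s] [AddCommGroup l] [Module ℝ l] [LieRingModule s l]
  [LieModule ℝ s l] [LieRing g] [LieAlgebra ℝ g]
  {S : CRAlgebra s} {M : CRModule S l} {G : CRAlgebra g} {ι : M.extCR.neg →ₗ⁅ℝ⁆ g}

/-- The negative part of a graded `CR` algebra splits along a pair of complementary ideals of its
prolongation. -/
theorem IsProlongation.mem_sup_comap {A : Type*} [LieRing A] [LieAlgebra ℝ A] {S : CRAlgebra A}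
    {ι : S.neg →ₗ⁅ℝ⁆ g} (h : IsProlongation S G ι) (φ : A →ₗ⁅ℝ⁆ g)
    (hφ : ∀ x : S.neg, φ x = ι x) {I K : LieIdeal ℝ g} (hIK : IsCompl I K) {p : ℤ} (hp : p < 0)
    {z : A} (hz : z ∈ S.deg p) : z ∈ LieIdeal.comap φ I ⊔ LieIdeal.comap φ K := by
  obtain ⟨a, ha, b, hb, hab⟩ := (LieSubmodule.mem_sup _ _ (ι ⟨z, S.mem_neg hp hz⟩)).1
    (hIK.sup_eq_top ▸ LieSubmodule.mem_top _)
  have e := congrArg (gproj G.isInternal p) hab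
  rw [map_add, gproj_of_mem _ (h.map_mem hp hz)] at e
  obtain ⟨x, -, hx⟩ := (h.mem_deg p hp _).1 (gproj_mem G.isInternal p a)
  obtain ⟨y, -, hy⟩ := (h.mem_deg p hp _).1 (gproj_mem G.isInternal p b)
  refine (LieSubmodule.mem_sup _ _ _).2 ⟨x, ?_, y, ?_, ?_⟩
  · rw [LieIdeal.mem_comap, hφ, hx]
    exact h.isHomogeneous_ideal I a ha p
  · rw [LieIdeal.mem_comap, hφ, hy]
    exact h.isHomogeneous_ideal K b hb p
  · rw [← hx, ← hy, ← map_add] at e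
    exact congrArg Subtype.val (h.injective e)

/-- A direct factor `I` of the Levi–Tanaka extension of `s` by `l` is the Levi–Tanaka extension of
the algebra part of the ideal of `s ⊕ l` that it cuts out by the module part. -/
theorem exists_isExtension (hS : S.IsFundamental) (hS' : S.IsTransitive) (hM : M.IsFundamental)
    (hM' : M.IsTransitive) (hnd : M.extCR.IsNondegenerate) (hG : IsProlongation M.extCR G ι)
    (φ : AbExt s l →ₗ⁅ℝ⁆ g) (hφ : ∀ x : M.extCR.neg, φ x = ι x)
    (hφdeg : ∀ p, ∀ x ∈ M.extCR.deg p, φ x ∈ G.deg p)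
    {I K : LieIdeal ℝ g} (hIK : IsCompl I K)
    (hA : IsCompl (LieIdeal.comap φ I) (LieIdeal.comap φ K)) :
    ∃ (S' : CRAlgebra (idealPart (LieIdeal.comap φ I)))
      (M' : CRModule S' (modulePart (LieIdeal.comap φ I))) (G' : CRAlgebra I)
      (ι' : M'.extCR.neg →ₗ⁅ℝ⁆ I),
      S'.IsInduced S (fun x => (x : s)) ∧ M'.IsInduced M (fun y => (y : l)) ∧
      G'.IsInduced G (fun x => (x : g)) ∧
      (∀ (z : M'.extCR.neg) (w : M.extCR.neg),
        w.1.fst = z.1.fst → w.1.snd = z.1.snd → ι w = ι' z) ∧ IsExtension M' G' ι' := by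
  have hhom : ∀ I : LieIdeal ℝ g, IsHomogeneous M.extCR.isInternal
      (LieIdeal.comap φ I).toSubmodule := fun I x hx p => by
    have := hG.isHomogeneous_ideal I _ (LieIdeal.mem_comap.1 hx) p
    have e := gproj_map_zero M.extCR.isInternal G.isInternal (φ : AbExt s l →ₗ[ℝ] g) hφdeg p x
    rw [LieHom.coe_toLinearMap] at e
    rw [e] at this
    exact this
  obtain ⟨S', M', hS1, hM1, hMind⟩ := exists_isInduced_parts M (hhom I) fun x hx hx' =>
    M.extCR.J_mem_of_isCompl hnd hA (hhom I) (hhom K) hx hx'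
  have hmem : ∀ z, z ∈ LieIdeal.comap φ I ↔
      ∃ y, AbExt.incl (idealPart (LieIdeal.comap φ I)) (modulePart (LieIdeal.comap φ I)) y = z := by
    intro z
    rw [mem_iff_parts]
    constructor
    · exact fun hz => ⟨⟨⟨z.fst, hz.1⟩, ⟨z.snd, hz.2⟩⟩, rfl⟩
    · rintro ⟨y, rfl⟩
      exact ⟨y.fst.2, y.snd.2⟩
  obtain ⟨P, hP⟩ := hMind.exists_isFactor (AbExt.incl_injective _ _) hnd hA (hhom I) (hhom K) hmem
  have hGnd := hG.isNondegenerate hnd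
  obtain ⟨G', hG'⟩ := G.exists_isInduced I.incl Subtype.val_injective
    (by
      rintro _ ⟨x, rfl⟩ p
      exact ⟨⟨_, hG.isHomogeneous_ideal I x x.2 p⟩, rfl⟩)
    (fun x hx => ⟨⟨_, G.J_mem_of_isCompl hGnd hIK (hG.isHomogeneous_ideal I)
      (hG.isHomogeneous_ideal K) x.2 hx⟩, rfl⟩)
  obtain ⟨Q, hQ⟩ := hG'.exists_isFactor Subtype.val_injective hGnd hIK (hG.isHomogeneous_ideal I)
    (hG.isHomogeneous_ideal K) fun x => ⟨fun hx => ⟨⟨x, hx⟩, rfl⟩, by rintro ⟨y, rfl⟩; exact y.2⟩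
  obtain ⟨ι', hι', hpro⟩ := hP.exists_isProlongation hQ hG fun x => by
    rw [← hmem, LieIdeal.mem_comap, hφ]
    exact ⟨by rintro ⟨z, hz⟩; exact hz ▸ z.2, fun hx => ⟨⟨_, hx⟩, rfl⟩⟩
  refine ⟨S', M', G', ι', hS1, hM1, ⟨hG'.mem_deg, hG'.map_J⟩,
    fun z w h1 h2 => hι' z w (AbExt.ext h1.symm h2.symm),
    ⟨isSemisimple_ideal _, ?_, hP.isFundamental (M.isFundamental_extCR hS hM),
      hP.isNondegenerate hnd⟩, hpro⟩
  exact M'.isTransitive_of_extCR (hP.isTransitive (M.isTransitive_extCR hS' hM'))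

end Main

end LeviTanaka

theorem mainTheorem7 {s l g : Type*}
    [LieRing s] [LieAlgebra ℝ s] [FiniteDimensional ℝ s] [LieAlgebra.IsSemisimple ℝ s]
    [AddCommGroup l] [Module ℝ l] [LieRingModule s l] [LieModule ℝ s l] [FiniteDimensional ℝ l]
    (S : LeviTanaka.CRAlgebra s) (hS : S.IsFundamental) (hS' : S.IsTransitive)
    (M : LeviTanaka.CRModule S l) (hM : M.IsFundamental) (hM' : M.IsTransitive)
    (hnd : M.extCR.IsNondegenerate)
    [LieRing g] [LieAlgebra ℝ g] (G : LeviTanaka.CRAlgebra g) (ι : M.extCR.neg →ₗ⁅ℝ⁆ g)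
    (hG : LeviTanaka.IsProlongation M.extCR G ι) :
    ∃ (s₁ s₂ : LieIdeal ℝ s) (l₁ l₂ : LieSubmodule ℝ s l)
      (S₁ : LeviTanaka.CRAlgebra s₁) (S₂ : LeviTanaka.CRAlgebra s₂) (M₁ : LeviTanaka.CRModule S₁ l₁) (M₂ : LeviTanaka.CRModule S₂ l₂),
      S₁.IsInduced S (fun x => (x : s)) ∧ S₂.IsInduced S (fun x => (x : s)) ∧
      M₁.IsInduced M (fun y => (y : l)) ∧ M₂.IsInduced M (fun y => (y : l)) ∧
      (IsCompl s₁ s₂ ∧ IsCompl l₁ l₂) ∧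
      ((∃ I₁ : LieIdeal ℝ (LeviTanaka.AbExt s l), ∀ z, z ∈ I₁ ↔ z.fst ∈ s₁ ∧ z.snd ∈ l₁) ∧
        (∃ I₂ : LieIdeal ℝ (LeviTanaka.AbExt s l), ∀ z, z ∈ I₂ ↔ z.fst ∈ s₂ ∧ z.snd ∈ l₂)) ∧
      ∃ (g₁ g₂ : LieIdeal ℝ g) (G₁ : LeviTanaka.CRAlgebra g₁) (G₂ : LeviTanaka.CRAlgebra g₂)
        (ι₁ : M₁.extCR.neg →ₗ⁅ℝ⁆ g₁) (ι₂ : M₂.extCR.neg →ₗ⁅ℝ⁆ g₂),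
        IsCompl g₁ g₂ ∧
        G₁.IsInduced G (fun x => (x : g)) ∧ G₂.IsInduced G (fun x => (x : g)) ∧
        (∀ (z : M₁.extCR.neg) (w : M.extCR.neg),
          w.1.fst = z.1.fst → w.1.snd = z.1.snd → ι w = ι₁ z) ∧
        (∀ (z : M₂.extCR.neg) (w : M.extCR.neg),
          w.1.fst = z.1.fst → w.1.snd = z.1.snd → ι w = ι₂ z) ∧
        (LeviTanaka.IsExtension M₁ G₁ ι₁ ∧ LieAlgebra.IsSemisimple ℝ g₁) ∧
        (LeviTanaka.IsExtension M₂ G₂ ι₂ ∧ LeviTanaka.IsProper g₂) := by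
  have hF := M.isFundamental_extCR hS hM
  have hT := M.isTransitive_extCR hS' hM'
  have : FiniteDimensional ℝ g := hG.finiteDimensional hF hnd
  obtain ⟨g₁, g₂, hg, hss, hproper⟩ := LeviTanaka.exists_isCompl_isSemisimple_isProper (L := g)
  obtain ⟨N, hN⟩ := LeviTanaka.exists_bound M.extCR.isInternal
  obtain ⟨φ, hφ, hφdeg⟩ := hG.exists_lieHom (N := N) fun p hp => hN p (hp.trans (le_abs_self p))
  have hφinj := hG.injective_of_isTransitive hT φ hφ hφdeg
  have hd : Disjoint (LieIdeal.comap φ g₁) (LieIdeal.comap φ g₂) := by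
    rw [disjoint_iff, LieSubmodule.eq_bot_iff]
    rintro x ⟨h1, h2⟩
    have : φ x ∈ g₁ ⊓ g₂ := ⟨h1, h2⟩
    rw [hg.disjoint.eq_bot, LieSubmodule.mem_bot] at this
    exact hφinj (this.trans (map_zero φ).symm)
  have hneg : ∀ p < 0, ∀ z ∈ M.extCR.deg p, z ∈ LieIdeal.comap φ g₁ ⊔ LieIdeal.comap φ g₂ :=
    fun p hp z hz => hG.mem_sup_comap φ hφ hg hp hz
  have hs := LeviTanaka.isCompl_idealPart M hS' hd hneg
  have hl := LeviTanaka.isCompl_modulePart M hS' hM' hd hneg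
  have hA : IsCompl (LieIdeal.comap φ g₁) (LieIdeal.comap φ g₂) := by
    refine ⟨hd, ?_⟩
    rw [codisjoint_iff, eq_top_iff]
    intro z _
    obtain ⟨a, ha, b, hb, hab⟩ := (LieSubmodule.mem_sup _ _ z.fst).1
      (hs.sup_eq_top ▸ LieSubmodule.mem_top _)
    obtain ⟨v, hv, w, hw, hvw⟩ := (LieSubmodule.mem_sup _ _ z.snd).1
      (hl.sup_eq_top ▸ LieSubmodule.mem_top _)
    exact (LieSubmodule.mem_sup _ _ _).2 ⟨⟨a, v⟩, (LeviTanaka.mem_iff_parts _ _).2 ⟨ha, hv⟩,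
      ⟨b, w⟩, (LeviTanaka.mem_iff_parts _ _).2 ⟨hb, hw⟩, LeviTanaka.AbExt.ext hab hvw⟩
  obtain ⟨S₁, M₁, G₁, ι₁, hS₁, hM₁, hG₁, hι₁, hE₁⟩ := LeviTanaka.exists_isExtension hS hS' hM hM'
    hnd hG φ hφ hφdeg hg hA
  obtain ⟨S₂, M₂, G₂, ι₂, hS₂, hM₂, hG₂, hι₂, hE₂⟩ := LeviTanaka.exists_isExtension hS hS' hM hM'
    hnd hG φ hφ hφdeg hg.symm hA.symm
  exact ⟨_, _, _, _, S₁, S₂, M₁, M₂, hS₁, hS₂, hM₁, hM₂, ⟨hs, hl⟩,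
    ⟨⟨_, LeviTanaka.mem_iff_parts _⟩, ⟨_, LeviTanaka.mem_iff_parts _⟩⟩,
    g₁, g₂, G₁, G₂, ι₁, ι₂, hg, hG₁, hG₂, hι₁, hι₂, ⟨hE₁, hss⟩, ⟨hE₂, hproper⟩⟩
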